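/- An instance of Weighted Min $k$-Vertex Cover consists of a finite vertex set $V$ with $n=|V|$, a non-negative real weight $w_e$ for every $e\subseteq V$ with $1\le |e|\le 2$ (edges and self-loops), and an integer $0\le k\le n$. For $S\subseteq V$ let $E(S)=\sum_{e\cap S\ne\emptyset} w_e$ be the total weight of the edges covered by $S$, and let $\mathrm{OPT}=\min_{S\subseteq V,\ |S|=k}E(S)$. For every $\varepsilon>0$ there is a (deterministic) algorithm that, on every such instance, outputs a set $S\subseteq V$ with $|S|=k$ and $E(S)\le(1+\varepsilon)\cdot\mathrm{OPT}$, and that runs in time $O(1/\varepsilon)^{O(k)}\cdot\mathrm{poly}(n)$. That is, there are constants $A,B\in\mathbb N$ and a polynomial $p$, independent of $\varepsilon$, such that for every $\varepsilon>0$ the running time of the algorithm for $\varepsilon$ is at most $\bigl(A\cdot\max\{1,1/\varepsilon\}\bigr)^{Bk}\cdot p(n)$. Running time is the number of steps of a unit-cost random access machine that can copy, add, subtract and compare integers (without unit-cost multiplication), use them as addresses, and copy, add and compare weights; the input is $n$, $k$ and the $n\times n$ matrix of the weights. -/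

import Mathlib

open scoped NNReal

/-! ### Weighted Min `k`-Vertex Cover

An edge-weighted graph on `V` is a complete graph with all self-loops in which every edge
`e : Sym2 V` (a pair of vertices, or a loop on the diagonal) has a weight `w e ≥ 0`. -/

namespace MinKVC

/-- The total weight of the edges covered by `S`, an edge being covered when at least one of
its endpoints lies in `S`. Every edge is counted once. -/
def coverWeight {V : Type*} [Fintype V] [DecidableEq V] (w : Sym2 V → ℝ≥0) (S : Finset V) : ℝ≥0 :=
  ∑ e with ∃ v ∈ S, v ∈ e, w e

/-- The optimum of Weighted Min `k`-Vertex Cover: the minimum of the covered weight over all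
sets of exactly `k` vertices. -/
noncomputable def optMin {V : Type*} [Fintype V] [DecidableEq V] (w : Sym2 V → ℝ≥0) (k : ℕ)
    (hk : k ≤ Fintype.card V) : ℝ≥0 :=
  (Finset.powersetCard k Finset.univ).inf'
    (Finset.powersetCard_nonempty.2 hk) (coverWeight w)

end MinKVC

/-! ### Random access machine with real weights

A unit-cost random access machine. It has integer registers, an integer memory that is addressed
through the registers, and a memory of nonnegative reals that is addressed through the registers.
The only operations on integers are constants, copying, addition and truncated subtraction (no
multiplication in one step), the only operations on reals are copying and addition, and the only
tests are comparisons. A program is a finite structured program, and is independent of the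
input. -/

namespace RAM

/-- A state of the machine. -/
structure State where
  /-- the integer registers (a program mentions finitely many of them) -/
  reg : ℕ → ℕ
  /-- the integer memory -/
  mem : ℕ → ℕ
  /-- the memory for weights -/
  wt : ℕ → ℝ≥0

/-- Elementary instructions; the arguments `i j l` are numbers of registers. -/
inductive Instr where
  /-- `reg[i] := c` -/
  | const (i c : ℕ)
  /-- `reg[i] := reg[j]` -/
  | move (i j : ℕ)
  /-- `reg[i] := reg[j] + reg[l]` -/
  | add (i j l : ℕ)
  /-- `reg[i] := max (reg[j] - reg[l]) 0` -/
  | sub (i j l : ℕ)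
  /-- `reg[i] := mem[reg[j]]` -/
  | load (i j : ℕ)
  /-- `mem[reg[i]] := reg[j]` -/
  | store (i j : ℕ)
  /-- `wt[reg[i]] := wt[reg[j]]` -/
  | wmove (i j : ℕ)
  /-- `wt[reg[i]] := wt[reg[j]] + wt[reg[l]]` -/
  | wadd (i j l : ℕ)

/-- The effect of an elementary instruction. -/
noncomputable def Instr.exec : Instr → State → State
  | .const i c, s => { s with reg := Function.update s.reg i c }
  | .move i j, s => { s with reg := Function.update s.reg i (s.reg j) }
  | .add i j l, s => { s with reg := Function.update s.reg i (s.reg j + s.reg l) }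
  | .sub i j l, s => { s with reg := Function.update s.reg i (s.reg j - s.reg l) }
  | .load i j, s => { s with reg := Function.update s.reg i (s.mem (s.reg j)) }
  | .store i j, s => { s with mem := Function.update s.mem (s.reg i) (s.reg j) }
  | .wmove i j, s => { s with wt := Function.update s.wt (s.reg i) (s.wt (s.reg j)) }
  | .wadd i j l, s =>
      { s with wt := Function.update s.wt (s.reg i) (s.wt (s.reg j) + s.wt (s.reg l)) }

/-- Tests. -/
inductive Test where
  /-- `reg[i] < reg[j]` -/
  | lt (i j : ℕ)
  /-- `wt[reg[i]] < wt[reg[j]]` -/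
  | wlt (i j : ℕ)

/-- The test succeeds in the state. -/
def Test.Holds : Test → State → Prop
  | .lt i j, s => s.reg i < s.reg j
  | .wlt i j, s => s.wt (s.reg i) < s.wt (s.reg j)

/-- Programs. -/
inductive Program where
  /-- an elementary instruction -/
  | instr (a : Instr)
  /-- sequential composition -/
  | seq (P Q : Program)
  /-- `if b then P else Q` -/
  | ite (b : Test) (P Q : Program)
  /-- `while b do P` -/
  | loop (b : Test) (P : Program)

/-- `Runs P s t s'`: started in state `s`, the program `P` halts in state `s'` after exactly `t`
steps, where each execution of an instruction and each evaluation of a test is one step. -/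
inductive Runs : Program → State → ℕ → State → Prop where
  | instr (a : Instr) (s : State) : Runs (.instr a) s 1 (a.exec s)
  | seq {P Q : Program} {s s' s'' : State} {t t' : ℕ} :
      Runs P s t s' → Runs Q s' t' s'' → Runs (.seq P Q) s (t + t') s''
  | ite_true {b : Test} {P Q : Program} {s s' : State} {t : ℕ} :
      b.Holds s → Runs P s t s' → Runs (.ite b P Q) s (1 + t) s'
  | ite_false {b : Test} {P Q : Program} {s s' : State} {t : ℕ} :
      ¬ b.Holds s → Runs Q s t s' → Runs (.ite b P Q) s (1 + t) s'
  | loop_true {b : Test} {P : Program} {s s' s'' : State} {t t' : ℕ} :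
      b.Holds s → Runs P s t s' → Runs (.loop b P) s' t' s'' →
      Runs (.loop b P) s (1 + t + t') s''
  | loop_false {b : Test} {P : Program} {s : State} :
      ¬ b.Holds s → Runs (.loop b P) s 1 s

/-- The machine is deterministic: final state and number of steps are unique. -/
theorem Runs.unique {P : Program} {s s₁ s₂ : State} {t₁ t₂ : ℕ}
    (h₁ : Runs P s t₁ s₁) (h₂ : Runs P s t₂ s₂) : t₁ = t₂ ∧ s₁ = s₂ := by
  induction h₁ generalizing t₂ s₂ with
  | instr a s => cases h₂; exact ⟨rfl, rfl⟩
  | seq _ _ ih₁ ih₂ =>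
    cases h₂ with
    | seq h h' =>
      obtain ⟨rfl, rfl⟩ := ih₁ h
      obtain ⟨rfl, rfl⟩ := ih₂ h'
      exact ⟨rfl, rfl⟩
  | ite_true hb _ ih =>
    cases h₂ with
    | ite_true _ h => obtain ⟨rfl, rfl⟩ := ih h; exact ⟨rfl, rfl⟩
    | ite_false hb' _ => exact absurd hb hb'
  | ite_false hb _ ih =>
    cases h₂ with
    | ite_true hb' _ => exact absurd hb' hb
    | ite_false _ h => obtain ⟨rfl, rfl⟩ := ih h; exact ⟨rfl, rfl⟩
  | loop_true hb _ _ ih₁ ih₂ =>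
    cases h₂ with
    | loop_true _ h h' =>
      obtain ⟨rfl, rfl⟩ := ih₁ h
      obtain ⟨rfl, rfl⟩ := ih₂ h'
      exact ⟨rfl, rfl⟩
    | loop_false hb' => exact absurd hb hb'
  | loop_false hb =>
    cases h₂ with
    | loop_true hb' _ _ => exact absurd hb' hb
    | loop_false _ => exact ⟨rfl, rfl⟩

end RAM

namespace MinKVC

/-- The initial state on the instance `(w, k)` with vertex set `Fin n`: register `0` holds `n`,
register `1` holds `k`, cell `i * n + j` of the weight memory holds the weight of the edge
`{i, j}` for `i, j < n`, and everything else is zero. -/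
noncomputable def inputState {n : ℕ} (w : Sym2 (Fin n) → ℝ≥0) (k : ℕ) : RAM.State where
  reg := fun i => if i = 0 then n else if i = 1 then k else 0
  mem := fun _ => 0
  wt := fun a => if h : a / n < n ∧ a % n < n then w s(⟨a / n, h.1⟩, ⟨a % n, h.2⟩) else 0

/-- The set of vertices that a final state describes: its indicator vector is read off from the
first `n` cells of the integer memory. -/
def outputSet (n : ℕ) (s : RAM.State) : Finset (Fin n) :=
  Finset.univ.filter fun v => s.mem v ≠ 0

/-- The program `P` is a `ρ`-approximation algorithm for Weighted Min `k`-Vertex Cover that runs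
in time `T n k` on instances with `n` vertices and parameter `k`: on every instance that has a
feasible solution, it halts within this time and outputs a set of exactly `k` vertices whose
covered weight is at most `ρ` times the optimum. -/
def IsApproxAlgorithm (P : RAM.Program) (ρ : ℝ) (T : ℕ → ℕ → ℝ) : Prop :=
  ∀ (n k : ℕ) (hk : k ≤ Fintype.card (Fin n)) (w : Sym2 (Fin n) → ℝ≥0),
    ∃ (t : ℕ) (s : RAM.State), RAM.Runs P (inputState w k) t s ∧ (t : ℝ) ≤ T n k ∧
      (outputSet n s).card = k ∧
      (coverWeight w (outputSet n s) : ℝ) ≤ ρ * (optMin w k hk : ℝ)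

end MinKVC

/-!
The algorithm tries all strings of length `9 k` over an alphabet of `m + 4` symbols, where `m` is
about `2 / ε`. A decoder turns each string into a set of vertices, and the best set of `k` vertices
that arises is returned. There are `(m + 4) ^ (9 k)` strings, each of which is decoded in polynomial
time, so that the point is to show that some string yields a near-optimal set.

Let `R` be an optimal set. For a vertex `v` sort all vertices by decreasing weight of their edge to
`v`. Some `K ⊆ R` lies among the first `m * #K` vertices of this list, while the edges from `v` to
`R \ K` carry at most a `1 / m` fraction of the weighted degree of `v` (`exists_kept`). The members
of `K` are hence described by `O(#K)` symbols: one per block of `m` consecutive vertices of the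
list, and one per member for its place in the block. Exploring `R` from a vertex `r` in this manner,
in breadth-first order, yields a set `C` that contains `r` and has few edges to `R \ C`, and a
string of length at most `3 * #C` that leads from `r` to `C` (`exists_walk`).

The string cannot name `r`, as there are `n` vertices. The decoder therefore follows it from all
roots simultaneously, and takes the result `C'` of least cost. As `C'` costs no more than `C` and
has the same size, one may replace `C` by `C'` and continue with `R \ C`, provided that `C'` is
disjoint from `R`. If `C'` meets `R`, then the position in `C'` of a common vertex `v` can be
encoded by at most `#C'` symbols, and the decoder explores again from the root `v`, which it now
knows. When `C` is the smallest of the explored sets, this is paid for by the larger set explored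
from `v`. In total the symbols number at most `9 * #R`, and the cost exceeds that of `R` by at most
`1 / m` times the weighted degrees in `R`, which is at most `2 / m` times the cost of `R`
(`exists_string`, `exists_decode`).

The decoder is defined as a function (`decode`). It is implemented on the machine by a program for
each of its operations, and the programs are verified with total correctness rules that bound the
number of steps (`RAM.Tot`); see `decodeProg_spec` and `mainProg_spec`.
-/

/-! ### Sorted lists of neighbours -/

namespace MinKVC

open Finset Function

section Ranks

/-- The last index below `j` that satisfies `P`, and `d` if there is none. -/
noncomputable def lastIdx (P : ℕ → Prop) (d : ℕ) : ℕ → ℕ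
  | 0 => d
  | j + 1 => open Classical in if P j then j else lastIdx P d j

theorem lastIdx_spec {P : ℕ → Prop} {n : ℕ} (j : ℕ) (h : ∃ i < j, P i) :
    lastIdx P n j < j ∧ P (lastIdx P n j) := by
  induction j with
  | zero => simp at h
  | succ j ih =>
    unfold lastIdx
    split_ifs with hj
    · exact ⟨Nat.lt_succ_self j, hj⟩
    · obtain ⟨i, hi, hPi⟩ := h
      have : i < j := by
        rcases Nat.lt_succ_iff_lt_or_eq.1 hi with h | rfl
        · exact h
        · exact absurd hPi hj
      obtain ⟨h1, h2⟩ := ih ⟨i, this, hPi⟩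
      exact ⟨by omega, h2⟩

theorem lastIdx_eq {P : ℕ → Prop} {n v : ℕ} (hv : v < n) (hP : P v)
    (huniq : ∀ u < n, P u → u = v) : lastIdx P n n = v := by
  obtain ⟨h1, h2⟩ := lastIdx_spec (n := n) n ⟨v, hv, hP⟩
  exact huniq _ h1 h2

variable (W : ℕ → ℕ → ℝ≥0) (n : ℕ)

/-- `a` comes before `b` in the list of the neighbours of `v`: the list is sorted by decreasing
weight of the edge to `v`, ties being broken by the index. -/
def Precedes (v a b : ℕ) : Prop := W v b < W v a ∨ (¬ W v a < W v b ∧ a < b)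

open Classical in
/-- The position of `u` in the sorted list of the neighbours of `v`. -/
noncomputable def rank (v u : ℕ) : ℕ := #{a ∈ range n | Precedes W v a u}

variable {W n}

theorem Precedes.irrefl {v a : ℕ} : ¬ Precedes W v a a := by simp [Precedes]

theorem Precedes.le {v a b : ℕ} (h : Precedes W v a b) : W v b ≤ W v a := by
  rcases h with h | h
  · exact h.le
  · exact not_lt.1 h.1

theorem Precedes.trans {v a b c : ℕ} (h : Precedes W v a b) (h' : Precedes W v b c) :
    Precedes W v a c := by
  rcases h with h | h <;> rcases h' with h' | h'
  · exact .inl (h'.trans h)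
  · exact .inl (lt_of_le_of_lt (not_lt.1 h'.1) h)
  · exact .inl (lt_of_lt_of_le h' (not_lt.1 h.1))
  · exact .inr ⟨not_lt.2 ((not_lt.1 h'.1).trans (not_lt.1 h.1)), h.2.trans h'.2⟩

theorem precedes_trichotomy (v : ℕ) {a b : ℕ} (h : a ≠ b) :
    Precedes W v a b ∨ Precedes W v b a := by
  unfold Precedes
  rcases lt_trichotomy (W v a) (W v b) with h1 | h1 | h1
  · exact .inr (.inl h1)
  · rcases lt_or_gt_of_ne h with h2 | h2
    · exact .inl (.inr ⟨by simp [h1], h2⟩)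
    · exact .inr (.inr ⟨by simp [h1], h2⟩)
  · exact .inl (.inl h1)

theorem rank_lt {v u : ℕ} (hu : u < n) : rank W n v u < n := by
  classical
  have : {a ∈ range n | Precedes W v a u} ⊂ range n := by
    refine filter_ssubset.2 ⟨u, mem_range.2 hu, Precedes.irrefl⟩
  simpa [rank] using card_lt_card this

theorem rank_lt_rank {v a b : ℕ} (ha : a < n) (h : Precedes W v a b) :
    rank W n v a < rank W n v b := by
  classical
  refine card_lt_card ⟨fun x hx => ?_, fun hs => ?_⟩
  · rw [mem_filter] at hx ⊢
    exact ⟨hx.1, hx.2.trans h⟩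
  · have := hs (mem_filter.2 ⟨mem_range.2 ha, h⟩)
    exact Precedes.irrefl (mem_filter.1 this).2

theorem rank_inj {v a b : ℕ} (ha : a < n) (hb : b < n) (h : rank W n v a = rank W n v b) :
    a = b := by
  by_contra hne
  rcases precedes_trichotomy (W := W) v hne with h1 | h1
  · exact (rank_lt_rank ha h1).ne h
  · exact (rank_lt_rank hb h1).ne' h

theorem weight_le_of_rank_lt {v a b : ℕ} (hb : b < n)
    (h : rank W n v a < rank W n v b) : W v b ≤ W v a := by
  have hne : a ≠ b := by rintro rfl; exact h.ne rfl
  rcases precedes_trichotomy (W := W) v hne with h1 | h1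
  · exact h1.le
  · exact absurd (rank_lt_rank hb h1) (by omega)

/-- A set of density at most `1 / m` in every initial segment carries at most a `1 / m` fraction
of the sum of a decreasing sequence. -/
theorem sum_le_of_sparse {h : ℕ → ℝ≥0} {N m : ℕ} (D : Finset ℕ)
    (anti : ∀ p q, p < q → q < N → h q ≤ h p)
    (sparse : ∀ p ≤ N, m * #{x ∈ D | x < p} ≤ p) (hD : D ⊆ range N) :
    m * ∑ x ∈ D, h x ≤ ∑ x ∈ range N, h x := by
  -- The initial segment of length `p` has slack `p - m * #D`, every unit of which is worth `t`.
  have key : ∀ p ≤ N, ∀ t : ℝ≥0, (∀ q < p, t ≤ h q) →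
      m * ∑ x ∈ D with x < p, h x + ((p - m * #{x ∈ D | x < p} : ℕ) : ℝ≥0) * t
        ≤ ∑ x ∈ range p, h x := by
    intro p
    induction p with
    | zero => intro _ t _; simp
    | succ p ih =>
      intro hp t ht
      have ih' := ih (by omega) (h p) (fun q hq => anti q p hq (by omega))
      have hs := sparse p (by omega)
      have hs' := sparse (p + 1) hp
      have ht' := ht p (by omega)
      rw [sum_range_succ]
      refine le_trans ?_ (add_le_add_left ih' (h p))
      by_cases hpD : p ∈ D
      · have hf : {x ∈ D | x < p + 1} = insert p {x ∈ D | x < p} := by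
          ext x; simp only [mem_filter, mem_insert]
          constructor
          · rintro ⟨h1, h2⟩
            by_cases hx : x = p
            · exact .inl hx
            · exact .inr ⟨h1, by omega⟩
          · rintro (rfl | ⟨h1, h2⟩)
            · exact ⟨hpD, by omega⟩
            · exact ⟨h1, by omega⟩
        have hnm : p ∉ ({x ∈ D | x < p} : Finset ℕ) := by simp
        rw [hf, sum_insert hnm, card_insert_of_notMem hnm]
        rw [hf, card_insert_of_notMem hnm] at hs'
        set d := #{x ∈ D | x < p}
        have e1 : p - m * d + 1 = (p + 1 - m * (d + 1)) + m := by
          rw [mul_add, mul_one] at hs' ⊢; omega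
        have e2 : ((p - m * d : ℕ) : ℝ≥0) * h p + h p
            = ((p + 1 - m * (d + 1) : ℕ) : ℝ≥0) * h p + m * h p := by
          rw [← add_one_mul, ← add_mul]; congr 1; exact_mod_cast e1
        rw [add_assoc, e2, mul_add]
        have : ((p + 1 - m * (d + 1) : ℕ) : ℝ≥0) * t ≤ ((p + 1 - m * (d + 1) : ℕ) : ℝ≥0) * h p := by
          gcongr
        calc _ ≤ m * h p + m * ∑ x ∈ D with x < p, h x
              + ((p + 1 - m * (d + 1) : ℕ) : ℝ≥0) * h p := by gcongr
          _ = _ := by ring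
      · have hf : {x ∈ D | x < p + 1} = {x ∈ D | x < p} := by
          ext x; simp only [mem_filter]
          refine and_congr_right fun h1 => ⟨fun h2 => ?_, fun h2 => by omega⟩
          have : x ≠ p := by rintro rfl; exact hpD h1
          omega
        rw [hf]
        set d := #{x ∈ D | x < p}
        have e1 : p + 1 - m * d = (p - m * d) + 1 := by omega
        rw [e1, Nat.cast_add, Nat.cast_one, add_assoc, add_one_mul]
        gcongr
  have h0 := key N le_rfl 0 (fun _ _ => zero_le)
  have hDf : {x ∈ D | x < N} = D := by
    rw [filter_eq_self]; intro x hx; exact mem_range.1 (hD hx)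
  simpa [hDf] using h0

theorem image_rank (v : ℕ) : (range n).image (rank W n v) = range n := by
  refine eq_of_subset_of_card_le ?_ ?_
  · intro x hx
    obtain ⟨u, hu, rfl⟩ := mem_image.1 hx
    exact mem_range.2 (rank_lt (mem_range.1 hu))
  · rw [card_image_of_injOn]
    intro a ha b hb h
    exact rank_inj (by simpa using ha) (by simpa using hb) h

/-- The neighbours of `v` in `A` that are worth following: some `K ⊆ A` lies among the first
`m * #K` neighbours of `v`, and the rest of `A` carries at most a `1 / m` fraction of the weighted
degree of `v`. -/
theorem exists_kept {m : ℕ} (hm : 0 < m) (v : ℕ) {A : Finset ℕ} (hA : A ⊆ range n) :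
    ∃ K ⊆ A, (∀ u ∈ K, rank W n v u < m * #K) ∧
      m * ∑ u ∈ A \ K, W v u ≤ ∑ u ∈ range n, W v u := by
  -- `K` is the part of `A` in the longest prefix, of length a multiple of `m`, in which `A` has
  -- density at least `1 / m`. In all longer such prefixes `A` is sparser, hence `A \ K` is sparse.
  let P : ℕ → Prop := fun c => c ≤ #{u ∈ A | rank W n v u < m * c}
  have hcard : #A ≤ n := by simpa using card_le_card hA
  set c := Nat.findGreatest P n with hc
  have hPc : P c := Nat.findGreatest_spec (P := P) (Nat.zero_le n) (Nat.zero_le _)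
  have hmax : ∀ q, c < q → #{u ∈ A | rank W n v u < m * q} < q := by
    intro q hq
    by_cases hqn : q ≤ n
    · exact not_le.1 (Nat.findGreatest_is_greatest (P := P) hq hqn)
    · exact lt_of_le_of_lt (card_filter_le _ _) (by omega)
  set K := {u ∈ A | rank W n v u < m * c} with hK
  have hKc : #K = c := by
    refine le_antisymm ?_ hPc
    have h1 : K ⊆ {u ∈ A | rank W n v u < m * (c + 1)} := by
      intro u hu
      rw [mem_filter] at hu ⊢
      exact ⟨hu.1, lt_of_lt_of_le hu.2 (Nat.mul_le_mul_left m (Nat.le_succ c))⟩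
    have h2 := card_le_card h1
    have h3 := hmax (c + 1) (Nat.lt_succ_self c)
    omega
  refine ⟨K, filter_subset _ _, fun u hu => hKc ▸ (mem_filter.1 hu).2, ?_⟩
  have hAK : A \ K ⊆ range n := sdiff_subset.trans hA
  have inj : ∀ B ⊆ range n, Set.InjOn (rank W n v) (B : Set ℕ) := fun B hB a ha b hb h =>
    rank_inj (mem_range.1 (hB ha)) (mem_range.1 (hB hb)) h
  let h : ℕ → ℝ≥0 := fun p => W v (lastIdx (fun i => rank W n v i = p) n n)
  have hh : ∀ u < n, h (rank W n v u) = W v u := by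
    intro u hu
    simp only [h]
    rw [lastIdx_eq (P := fun i => rank W n v i = rank W n v u) hu rfl
      fun a ha e => rank_inj ha hu e]
  have s1 : ∀ B ⊆ range n, ∑ u ∈ B, W v u = ∑ p ∈ B.image (rank W n v), h p := by
    intro B hB
    rw [sum_image (inj B hB)]
    exact sum_congr rfl fun u hu => (hh u (mem_range.1 (hB hu))).symm
  rw [s1 _ hAK, s1 _ subset_rfl, image_rank]
  refine sum_le_of_sparse _ ?_ ?_ ?_
  · intro p q hpq hq
    have hp' : p ∈ (range n).image (rank W n v) := by
      rw [image_rank]; exact mem_range.2 (by omega)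
    have hq' : q ∈ (range n).image (rank W n v) := by
      rw [image_rank]; exact mem_range.2 hq
    obtain ⟨a, ha, rfl⟩ := mem_image.1 hp'
    obtain ⟨b, hb, rfl⟩ := mem_image.1 hq'
    rw [hh a (mem_range.1 ha), hh b (mem_range.1 hb)]
    exact weight_le_of_rank_lt (mem_range.1 hb) hpq
  · intro p _
    have hcardle : #{x ∈ (A \ K).image (rank W n v) | x < p} ≤
        #{u ∈ A \ K | rank W n v u < p} := by
      rw [filter_image]; exact card_image_le
    by_cases hpc : p ≤ m * c
    · have : {u ∈ A \ K | rank W n v u < p} = ∅ := by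
        rw [filter_eq_empty_iff]
        intro u hu hlt
        rw [mem_sdiff] at hu
        exact hu.2 (mem_filter.2 ⟨hu.1, lt_of_lt_of_le hlt hpc⟩)
      rw [this, card_empty, Nat.le_zero] at hcardle
      rw [hcardle]; simp
    · have hq : c < p / m + 1 := by
        have : c ≤ p / m := (Nat.le_div_iff_mul_le hm).2 (by rw [mul_comm]; omega)
        omega
      have h1 := hmax _ hq
      have h2 : {u ∈ A \ K | rank W n v u < p} ⊆ {u ∈ A | rank W n v u < m * (p / m + 1)} := by
        intro u hu
        rw [mem_filter] at hu ⊢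
        refine ⟨(mem_sdiff.1 hu.1).1, hu.2.trans ?_⟩
        exact Nat.lt_mul_div_succ p hm
      have h3 := card_le_card h2
      have h4 : #{x ∈ (A \ K).image (rank W n v) | x < p} ≤ p / m := by omega
      exact (Nat.mul_le_mul_left m h4).trans (Nat.mul_div_le p m)
  · rw [← image_rank (W := W) (n := n) v]
    exact image_subset_image hAK

end Ranks

end MinKVC

/-! ### The decoder and its explorations -/

namespace MinKVC

open Finset Function

/-- The vertices below `n` that carry a nonzero stamp. -/
def supp (n : ℕ) (f : ℕ → ℕ) : Finset ℕ := {v ∈ range n | f v ≠ 0}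

theorem mem_supp {n : ℕ} {f : ℕ → ℕ} {v : ℕ} : v ∈ supp n f ↔ v < n ∧ f v ≠ 0 := by
  simp [supp]

/-- The stamps are a numbering of the support by `1, …, t`. -/
structure Stamped (n : ℕ) (f : ℕ → ℕ) (t : ℕ) : Prop where
  le : ∀ v < n, f v ≤ t
  surj : ∀ i, 0 < i → i ≤ t → ∃ v < n, f v = i
  inj : ∀ u < n, ∀ v < n, f u = f v → f u ≠ 0 → u = v

theorem Stamped.card {n t : ℕ} {f : ℕ → ℕ} (h : Stamped n f t) : #(supp n f) = t := by
  have : #(supp n f) = #(Icc 1 t) := by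
    refine card_nbij f ?_ ?_ ?_
    · intro v hv
      rw [mem_coe, mem_supp] at hv
      rw [mem_coe, mem_Icc]
      exact ⟨Nat.pos_of_ne_zero hv.2, h.le v hv.1⟩
    · intro u hu v hv e
      rw [mem_coe, mem_supp] at hu hv
      exact h.inj u hu.1 v hv.1 e hu.2
    · intro i hi
      rw [mem_coe, mem_Icc] at hi
      obtain ⟨v, hv, e⟩ := h.surj i hi.1 hi.2
      exact ⟨v, by rw [mem_coe, mem_supp]; exact ⟨hv, by omega⟩, e⟩
  simpa using this

theorem Stamped.update {n t u : ℕ} {f : ℕ → ℕ} (h : Stamped n f t) (hu : u < n) (hf : f u = 0) :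
    Stamped n (update f u (t + 1)) (t + 1) where
  le v hv := by
    rcases eq_or_ne v u with rfl | hne
    · simp
    · rw [update_of_ne hne]; exact (h.le v hv).trans (Nat.le_succ t)
  surj i hi hit := by
    rcases eq_or_ne i (t + 1) with rfl | hne
    · exact ⟨u, hu, by simp⟩
    · obtain ⟨v, hv, e⟩ := h.surj i hi (by omega)
      refine ⟨v, hv, ?_⟩
      rw [update_of_ne, e]
      rintro rfl; omega
  inj a ha b hb := by
    have hl := h.le
    by_cases hau : a = u <;> by_cases hbu : b = u
    · exact fun _ _ => hau.trans hbu.symm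
    · rw [hau, update_self, update_of_ne hbu]
      intro e; have := hl b hb; omega
    · rw [hbu, update_self, update_of_ne hau]
      intro e; have := hl a ha; omega
    · rw [update_of_ne hau, update_of_ne hbu]
      exact h.inj a ha b hb

theorem supp_update {n u t : ℕ} {f : ℕ → ℕ} (hu : u < n) (ht : t ≠ 0) :
    supp n (update f u t) = insert u (supp n f) := by
  ext v
  rw [mem_insert, mem_supp, mem_supp]
  rcases eq_or_ne v u with rfl | hne
  · simp [hu, ht]
  · simp [hne]

/-- The best candidate below `j`: the first `r` of minimal cost among those that are alive, and
`d` if there is none. -/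
noncomputable def bestIdx (alive : ℕ → Prop) (cost : ℕ → ℝ≥0) (d : ℕ) : ℕ → ℕ
  | 0 => d
  | j + 1 => open Classical in
    if alive j ∧ (bestIdx alive cost d j = d ∨ cost j < cost (bestIdx alive cost d j)) then j
    else bestIdx alive cost d j

theorem bestIdx_spec {alive : ℕ → Prop} {cost : ℕ → ℝ≥0} {n : ℕ} (j : ℕ) (hj : j ≤ n) :
    (bestIdx alive cost n j = n ∧ ∀ r < j, ¬ alive r) ∨
      (bestIdx alive cost n j < j ∧ alive (bestIdx alive cost n j) ∧
        ∀ r < j, alive r → cost (bestIdx alive cost n j) ≤ cost r) := by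
  induction j with
  | zero => simp [bestIdx]
  | succ j ih =>
    unfold bestIdx
    rcases ih (by omega) with ⟨h1, h2⟩ | ⟨h1, h2, h3⟩
    · by_cases ha : alive j
      · rw [if_pos ⟨ha, .inl h1⟩]
        refine .inr ⟨Nat.lt_succ_self j, ha, fun r hr har => ?_⟩
        rcases Nat.lt_succ_iff_lt_or_eq.1 hr with h | rfl
        · exact absurd har (h2 r h)
        · exact le_rfl
      · rw [if_neg (fun h => ha h.1)]
        refine .inl ⟨h1, fun r hr => ?_⟩
        rcases Nat.lt_succ_iff_lt_or_eq.1 hr with h | rfl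
        · exact h2 r h
        · exact ha
    · right
      split_ifs with hc
      · refine ⟨Nat.lt_succ_self j, hc.1, fun r hr har => ?_⟩
        have hlt := hc.2.resolve_left (by omega)
        rcases Nat.lt_succ_iff_lt_or_eq.1 hr with h | rfl
        · exact hlt.le.trans (h3 r h har)
        · exact le_rfl
      · refine ⟨by omega, h2, fun r hr har => ?_⟩
        rcases Nat.lt_succ_iff_lt_or_eq.1 hr with h | rfl
        · exact h3 r h har
        · exact not_lt.1 fun h => hc ⟨har, .inr h⟩

/-- One exploration: the explored vertices are stamped in the order of their discovery. -/
structure Walk where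
  /-- the stamps; `0` for a vertex that is not explored -/
  stamp : ℕ → ℕ
  /-- the number of explored vertices -/
  size : ℕ
  /-- the stamp of the vertex whose neighbours are being examined -/
  cur : ℕ
  /-- the start of the current block of its sorted list of neighbours -/
  off : ℕ

/-- The state of the decoder. The row `r` belongs to the exploration with root `r`, which is dead
when `rows r r = 0`; sizes and positions are common to all explorations. -/
structure Config where
  /-- the stamps of the vertices that have been chosen for good -/
  chosen : ℕ → ℕ
  /-- the number of these vertices -/
  count : ℕ
  /-- the stamps of the exploration from each root; they extend those of `chosen` -/
  rows : ℕ → ℕ → ℕ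
  /-- see `Walk.size` -/
  size : ℕ
  /-- see `Walk.cur` -/
  cur : ℕ
  /-- see `Walk.off` -/
  off : ℕ
  /-- if not zero, the position among the newly explored vertices of the next root -/
  mark : ℕ

section Decoder

variable (W : ℕ → ℕ → ℝ≥0) (n m : ℕ) (E : Finset ℕ → ℝ≥0)

open Classical in
/-- In the exploration `f` from `r`, follow the vertex with stamp `cur` to its neighbour of rank
`p` and give it the next stamp. The exploration dies if this is not a new vertex. -/
noncomputable def growRow (r p cur size : ℕ) (f : ℕ → ℕ) : ℕ → ℕ :=
  if f r = 0 then f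
  else if lastIdx (fun i => f i = cur) n n < n ∧
      lastIdx (fun i => rank W n (lastIdx (fun i => f i = cur) n n) i = p) n n < n ∧
      f (lastIdx (fun i => rank W n (lastIdx (fun i => f i = cur) n n) i = p) n n) = 0 then
    update f (lastIdx (fun i => rank W n (lastIdx (fun i => f i = cur) n n) i = p) n n) (size + 1)
  else update f r 0

/-- The effect of a symbol on the exploration from `r`: `x < m` picks the neighbour at place `x`
of the current block, `m` goes to the next block of `m` neighbours, `m + 1` goes to the next
explored vertex. -/
noncomputable def Walk.step (r : ℕ) (w : Walk) (x : ℕ) : Walk :=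
  if x < m then ⟨growRow W n r (w.off + x) w.cur w.size w.stamp, w.size + 1, w.cur, w.off⟩
  else if x = m then { w with off := w.off + m }
  else { w with cur := w.cur + 1, off := 0 }

open Classical in
/-- Start an exploration from every root in `[lo, hi)` that is not yet chosen. -/
noncomputable def Config.start (f : ℕ → ℕ) (c lo hi : ℕ) : Config where
  chosen := f
  count := c
  rows r := if lo ≤ r ∧ r < hi ∧ f r = 0 then update f r (c + 1) else update f r 0
  size := c + 1
  cur := c + 1
  off := 0
  mark := 0

/-- The live exploration for which the explored vertices, with those chosen before, cover the
least weight. -/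
noncomputable def Config.best (σ : Config) : ℕ :=
  bestIdx (fun r => σ.rows r r ≠ 0) (fun r => E (supp n (σ.rows r))) n n

open Classical in
/-- The end of a phase: either the best exploration is chosen for good, or one of its new vertices
becomes the only root of the next phase. -/
noncomputable def Config.finish (σ : Config) : Config :=
  if σ.best n E < n then
    if σ.mark = 0 then Config.start (σ.rows (σ.best n E)) σ.size 0 n
    else Config.start σ.chosen σ.count
      (lastIdx (fun i => σ.rows (σ.best n E) i = σ.count + σ.mark) n n)
      (lastIdx (fun i => σ.rows (σ.best n E) i = σ.count + σ.mark) n n + 1)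
  else σ

/-- The effect of a symbol: the symbols up to `m + 1` act on all explorations, see `Walk.step`;
`m + 2` advances the mark, and a larger symbol ends the phase. -/
noncomputable def Config.step (σ : Config) (x : ℕ) : Config :=
  if x < m then
    { σ with rows := fun r => growRow W n r (σ.off + x) σ.cur σ.size (σ.rows r)
             size := σ.size + 1 }
  else if x = m then { σ with off := σ.off + m }
  else if x = m + 1 then { σ with cur := σ.cur + 1, off := 0 }
  else if x = m + 2 then { σ with mark := σ.mark + 1 }
  else σ.finish n E

/-- The final state of the decoder on a string of symbols. -/
noncomputable def decode (a : List ℕ) : Config :=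
  a.foldl (Config.step W n m E) (Config.start (fun _ => 0) 0 0 n)

end Decoder

section Exploration

variable {W : ℕ → ℕ → ℝ≥0} {n m : ℕ}

theorem growRow_eq {r p cur size v u : ℕ} {f : ℕ → ℕ} (hr : f r ≠ 0) (hv : v < n)
    (hcur : f v = cur) (hinj : ∀ a < n, f a = cur → a = v) (hu : u < n) (hp : rank W n v u = p)
    (hfu : f u = 0) : growRow W n r p cur size f = update f u (size + 1) := by
  have e1 : lastIdx (fun i => f i = cur) n n = v := lastIdx_eq hv hcur hinj
  have e2 : lastIdx (fun i => rank W n v i = p) n n = u :=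
    lastIdx_eq hu hp fun a ha e => rank_inj ha hu (e.trans hp.symm)
  unfold growRow
  rw [if_neg hr, e1, e2, if_pos ⟨hv, hu, hfu⟩]

/-- `w'` is the walk `w` after it has discovered the new vertices `K`. -/
structure Walk.Extends (n : ℕ) (w : Walk) (K : Finset ℕ) (w' : Walk) : Prop where
  cur_eq : w'.cur = w.cur
  size_eq : w'.size = w.size + #K
  stamped : Stamped n w'.stamp w'.size
  old : ∀ y, w.stamp y ≠ 0 → w'.stamp y = w.stamp y
  new : ∀ y ∈ K, w.size < w'.stamp y
  supp_eq : supp n w'.stamp = supp n w.stamp ∪ K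

theorem Walk.Extends.refl {w : Walk} (h : Stamped n w.stamp w.size) : w.Extends n ∅ w :=
  ⟨rfl, by simp, h, fun _ _ => rfl, by simp, by simp⟩

theorem Walk.Extends.trans {w w' w'' : Walk} {K K' : Finset ℕ} (h : w.Extends n K w')
    (h' : w'.Extends n K' w'') (hK : Disjoint K K') : w.Extends n (K ∪ K') w'' where
  cur_eq := h'.cur_eq.trans h.cur_eq
  size_eq := by rw [h'.size_eq, h.size_eq, card_union_of_disjoint hK, add_assoc]
  stamped := h'.stamped
  old y hy := by
    have := h.old y hy
    rw [h'.old y (by rw [this]; exact hy), this]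
  new y hy := by
    rcases mem_union.1 hy with hy | hy
    · have := h.new y hy
      rwa [h'.old y (by omega)]
    · have := h'.new y hy
      have := h.size_eq
      omega
  supp_eq := by rw [h'.supp_eq, h.supp_eq, union_assoc]

/-- The symbols `rank - off` pick any set of new vertices in the current block. -/
theorem exists_picks {r v : ℕ} (hv : v < n) (K : Finset ℕ) (w : Walk)
    (hst : Stamped n w.stamp w.size) (hr : w.stamp r ≠ 0) (hcur : w.stamp v = w.cur)
    (hpos : 0 < w.cur) (hKn : K ⊆ range n) (hK0 : ∀ u ∈ K, w.stamp u = 0)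
    (hKr : ∀ u ∈ K, w.off ≤ rank W n v u ∧ rank W n v u < w.off + m) :
    ∃ b : List ℕ, b.length = #K ∧ (∀ x ∈ b, x < m) ∧
      w.Extends n K (b.foldl (Walk.step W n m r) w) ∧
      (b.foldl (Walk.step W n m r) w).off = w.off := by
  classical
  induction K using Finset.induction_on with
  | empty => exact ⟨[], rfl, by simp, .refl hst, rfl⟩
  | insert u K huK ih =>
    obtain ⟨b, hb1, hb2, hb3, hb4⟩ := ih ((subset_insert _ _).trans hKn)
      (fun x hx => hK0 x (mem_insert_of_mem hx)) (fun x hx => hKr x (mem_insert_of_mem hx))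
    set w' := b.foldl (Walk.step W n m r) w with hw'
    have hu : u < n := mem_range.1 (hKn (mem_insert_self _ _))
    have hur := hKr u (mem_insert_self _ _)
    have hu0 : w'.stamp u = 0 := by
      by_contra h
      have h1 : u ∈ supp n w'.stamp := mem_supp.2 ⟨hu, h⟩
      rw [hb3.supp_eq, mem_union, mem_supp] at h1
      rcases h1 with h1 | h1
      · exact h1.2 (hK0 u (mem_insert_self _ _))
      · exact huK h1
    have hv' : w'.stamp v = w'.cur := by
      rw [hb3.cur_eq, hb3.old v (by omega), hcur]
    have hgrow : growRow W n r (rank W n v u) w'.cur w'.size w'.stamp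
        = update w'.stamp u (w'.size + 1) := by
      refine growRow_eq (v := v) ?_ hv hv' ?_ hu rfl hu0
      · rw [hb3.old r hr]; exact hr
      · intro a ha e
        have := hb3.cur_eq
        exact hb3.stamped.inj a ha v hv (e.trans hv'.symm) (by omega)
    have hstep : w'.step W n m r (rank W n v u - w.off)
        = ⟨update w'.stamp u (w'.size + 1), w'.size + 1, w'.cur, w'.off⟩ := by
      unfold Walk.step
      rw [if_pos (by omega), hb4, Nat.add_sub_cancel' hur.1, hgrow]
    refine ⟨b ++ [rank W n v u - w.off], by simp [hb1, huK], ?_, ?_, ?_⟩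
    · intro x hx
      rcases List.mem_append.1 hx with hx | hx
      · exact hb2 x hx
      · rw [List.mem_singleton.1 hx]; omega
    · rw [List.foldl_append, List.foldl_cons, List.foldl_nil, ← hw', hstep, insert_eq, union_comm]
      refine hb3.trans ⟨rfl, by simp, hb3.stamped.update hu hu0, ?_, ?_, ?_⟩
        (disjoint_singleton_right.2 huK)
      · intro y hy
        refine update_of_ne ?_ _ _
        rintro rfl; exact hy hu0
      · intro y hy
        rw [mem_singleton.1 hy]; simp
      · rw [supp_update hu (Nat.succ_ne_zero _), insert_eq, union_comm]
    · rw [List.foldl_append, List.foldl_cons, List.foldl_nil, ← hw', hstep]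
      exact hb4

/-- The members of `K` among the first `q` blocks cost one symbol each, and every block costs one
further symbol. -/
theorem exists_blocks {r v : ℕ} (hv : v < n) (K : Finset ℕ) (w : Walk)
    (hst : Stamped n w.stamp w.size) (hr : w.stamp r ≠ 0) (hcur : w.stamp v = w.cur)
    (hpos : 0 < w.cur) (hoff : w.off = 0) (hKn : K ⊆ range n) (hK0 : ∀ u ∈ K, w.stamp u = 0)
    (q : ℕ) :
    ∃ b : List ℕ, b.length = #{u ∈ K | rank W n v u < m * q} + q ∧ (∀ x ∈ b, x ≤ m) ∧
      w.Extends n {u ∈ K | rank W n v u < m * q} (b.foldl (Walk.step W n m r) w) ∧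
      (b.foldl (Walk.step W n m r) w).off = m * q := by
  classical
  induction q with
  | zero => exact ⟨[], by simp, by simp, by simpa using .refl hst, by simpa using hoff⟩
  | succ q ih =>
    obtain ⟨b, hb1, hb2, hb3, hb4⟩ := ih
    set w' := b.foldl (Walk.step W n m r) w with hw'
    set K₁ := {u ∈ K | rank W n v u < m * q}
    set K₂ := {u ∈ K | m * q ≤ rank W n v u ∧ rank W n v u < m * q + m} with hK₂
    have hdisj : Disjoint K₁ K₂ := by
      rw [disjoint_left]
      intro u h1 h2
      have := (mem_filter.1 h1).2
      have := (mem_filter.1 h2).2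
      omega
    have hunion : {u ∈ K | rank W n v u < m * (q + 1)} = K₁ ∪ K₂ := by
      ext u
      simp only [K₁, K₂, mem_filter, mem_union, ← and_or_left, mul_add, mul_one]
      refine and_congr_right fun _ => ?_
      omega
    have hK₂0 : ∀ u ∈ K₂, w'.stamp u = 0 := by
      intro u hu
      by_contra h
      have hun : u < n := mem_range.1 (hKn (mem_filter.1 hu).1)
      have h1 : u ∈ supp n w'.stamp := mem_supp.2 ⟨hun, h⟩
      rw [hb3.supp_eq, mem_union, mem_supp] at h1
      rcases h1 with h1 | h1
      · exact h1.2 (hK0 u (mem_filter.1 hu).1)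
      · exact disjoint_left.1 hdisj h1 hu
    obtain ⟨b', hb1', hb2', hb3', hb4'⟩ := exists_picks (W := W) (m := m) (r := r) hv K₂ w'
      hb3.stamped (by rw [hb3.old r hr]; exact hr)
      (by rw [hb3.cur_eq, hb3.old v (by omega), hcur]) (by rw [hb3.cur_eq]; exact hpos)
      ((filter_subset _ _).trans hKn) hK₂0
      (fun u hu => by rw [hb4]; exact (mem_filter.1 hu).2)
    set w'' := b'.foldl (Walk.step W n m r) w' with hw''
    have hstep : w''.step W n m r m = { w'' with off := w''.off + m } := by
      simp [Walk.step]
    have hfold : (b ++ b' ++ [m]).foldl (Walk.step W n m r) w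
        = { w'' with off := w''.off + m } := by
      rw [List.foldl_append, List.foldl_append, ← hw', ← hw'', List.foldl_cons, List.foldl_nil,
        hstep]
    refine ⟨b ++ b' ++ [m], ?_, ?_, ?_, ?_⟩
    · rw [hunion, card_union_of_disjoint hdisj]
      simp only [List.length_append, List.length_singleton, hb1, hb1']
      omega
    · intro x hx
      simp only [List.mem_append, List.mem_singleton] at hx
      rcases hx with (hx | hx) | hx
      · exact hb2 x hx
      · exact (hb2' x hx).le
      · exact hx.le
    · rw [hfold, hunion]
      have h := hb3.trans hb3' hdisj
      exact ⟨h.1, h.2, h.3, h.4, h.5, h.6⟩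
    · rw [hfold, hb4', hb4, mul_add, mul_one]

/-- From any state of an exploration inside `R` there is a continuation that explores a set `C`
almost without edges to the rest of `R`. Each of the vertices still to be examined costs one symbol,
each of those still to be discovered costs two: one picks it, and one pays for a block of the list
that it was found in. The vertices chosen before are `T`, the new ones so far are `X`, and the new
vertices with stamps below `w.cur` have been examined. -/
theorem exists_walk (hm : 0 < m) {r c : ℕ} {R T : Finset ℕ} (hRn : R ⊆ range n)
    (hRT : Disjoint T R) (N : ℕ) (w : Walk) (X : Finset ℕ) (hXR : X ⊆ R)
    (hst : Stamped n w.stamp w.size) (hr : w.stamp r ≠ 0) (hoff : w.off = 0)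
    (hsupp : supp n w.stamp = T ∪ X) (hsize : w.size = c + #X)
    (hpos : 0 < w.cur) (hle : w.cur ≤ w.size + 1) (hN : c + #R + 1 ≤ N + w.cur)
    (hdone : ∀ v ∈ X, w.stamp v < w.cur →
      m * ∑ u ∈ R \ X, W v u ≤ ∑ u ∈ range n, W v u) :
    ∃ (b : List ℕ) (C : Finset ℕ), X ⊆ C ∧ C ⊆ R ∧
      b.length + 2 * #X + w.cur ≤ 2 * #C + c + #C + 1 ∧ (∀ x ∈ b, x ≤ m + 1) ∧
      supp n (b.foldl (Walk.step W n m r) w).stamp = T ∪ C ∧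
      (b.foldl (Walk.step W n m r) w).stamp r ≠ 0 ∧
      ∀ v ∈ C, m * ∑ u ∈ R \ C, W v u ≤ ∑ u ∈ range n, W v u := by
  classical
  induction N generalizing w X with
  | zero =>
    have hXc := card_le_card hXR
    refine ⟨[], X, subset_rfl, hXR, by simp; omega, by simp, hsupp, hr, fun v hv => ?_⟩
    refine hdone v hv ?_
    have := hst.le v (mem_range.1 (hRn (hXR hv)))
    omega
  | succ N ih =>
    have hXc := card_le_card hXR
    rcases hle.eq_or_lt with heq | hlt
    · refine ⟨[], X, subset_rfl, hXR, by simp; omega, by simp, hsupp, hr, fun v hv => ?_⟩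
      refine hdone v hv ?_
      have := hst.le v (mem_range.1 (hRn (hXR hv)))
      omega
    · obtain ⟨v, hv, hcur⟩ := hst.surj w.cur hpos (by omega)
      obtain ⟨K, hKA, hKr, hKw⟩ := exists_kept (W := W) (n := n) hm v
        (A := R \ X) (sdiff_subset.trans hRn)
      have hKR : K ⊆ R := hKA.trans sdiff_subset
      have hKX : Disjoint X K := disjoint_of_subset_right hKA disjoint_sdiff
      have hK0 : ∀ u ∈ K, w.stamp u = 0 := by
        intro u hu
        by_contra h
        have h1 : u ∈ supp n w.stamp := mem_supp.2 ⟨mem_range.1 (hRn (hKR hu)), h⟩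
        rw [hsupp, mem_union] at h1
        rcases h1 with h1 | h1
        · exact disjoint_left.1 hRT h1 (hKR hu)
        · exact disjoint_left.1 hKX h1 hu
      obtain ⟨b, hb1, hb2, hb3, hb4⟩ := exists_blocks (W := W) (m := m) (r := r) hv K w hst hr hcur
        hpos hoff (hKR.trans hRn) hK0 #K
      rw [filter_true_of_mem hKr] at hb1 hb3
      set w' := b.foldl (Walk.step W n m r) w with hw'
      have hstep : w'.step W n m r (m + 1) = { w' with cur := w'.cur + 1, off := 0 } := by
        simp [Walk.step]
      have hfold : (b ++ [m + 1]).foldl (Walk.step W n m r) w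
          = { w' with cur := w'.cur + 1, off := 0 } := by
        rw [List.foldl_append, ← hw', List.foldl_cons, List.foldl_nil, hstep]
      have hcardX : #(X ∪ K) = #X + #K := card_union_of_disjoint hKX
      have hc := hb3.cur_eq
      have hs := hb3.size_eq
      obtain ⟨b', C, h1, h2, h3, h4, h5, h6, h7⟩ := ih { w' with cur := w'.cur + 1, off := 0 }
        (X ∪ K) (union_subset hXR hKR) hb3.stamped (by simpa [hb3.old r hr] using hr) rfl
        (by simpa [hsupp, union_assoc] using hb3.supp_eq)
        (by simp only; omega) (by simp) (by simp only; omega) (by simp only; omega) (by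
          intro y hy hylt
          simp only at hylt
          have hanti : R \ (X ∪ K) ⊆ R \ X := sdiff_subset_sdiff subset_rfl subset_union_left
          by_cases hyv : y = v
          · subst hyv
            refine le_trans ?_ hKw
            rw [sdiff_sdiff_left, sup_eq_union]
          · rcases mem_union.1 hy with hyX | hyK
            · have hy0 : w.stamp y ≠ 0 := by
                have : y ∈ supp n w.stamp := by rw [hsupp]; exact mem_union_right _ hyX
                exact (mem_supp.1 this).2
              have hyn : y < n := mem_range.1 (hRn (hXR hyX))
              rw [hb3.old y hy0] at hylt
              have hne : w.stamp y ≠ w.cur := fun e =>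
                hyv (hst.inj y hyn v hv (e.trans hcur.symm) hy0)
              refine le_trans ?_ (hdone y hyX (by omega))
              gcongr
            · have := hb3.new y hyK
              omega)
      have hfold' : (b ++ [m + 1] ++ b').foldl (Walk.step W n m r) w
          = b'.foldl (Walk.step W n m r) { w' with cur := w'.cur + 1, off := 0 } := by
        rw [List.foldl_append, hfold]
      refine ⟨b ++ [m + 1] ++ b', C, subset_union_left.trans h1, h2, ?_, ?_, ?_, ?_, h7⟩
      · simp only [List.length_append, List.length_singleton]
        simp only at h3
        omega
      · intro x hx
        simp only [List.mem_append, List.mem_singleton] at hx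
        rcases hx with (hx | hx) | hx
        · exact (hb2 x hx).trans (Nat.le_succ m)
        · exact hx.le
        · exact h4 x hx
      · rw [hfold']; exact h5
      · rw [hfold']; exact h6

end Exploration

end MinKVC

/-! ### Strings for near-optimal sets -/

namespace MinKVC

open Finset Function

section Phase

variable {W : ℕ → ℕ → ℝ≥0} {n m : ℕ} {E : Finset ℕ → ℝ≥0}

/-- The exploration from `r`. -/
def Config.walk (σ : Config) (r : ℕ) : Walk := ⟨σ.rows r, σ.size, σ.cur, σ.off⟩

theorem foldl_step_walk (b : List ℕ) (hb : ∀ x ∈ b, x ≤ m + 1) (σ : Config) :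
    (∀ r, (b.foldl (Config.step W n m E) σ).walk r
      = b.foldl (Walk.step W n m r) (σ.walk r)) ∧
    (b.foldl (Config.step W n m E) σ).chosen = σ.chosen ∧
    (b.foldl (Config.step W n m E) σ).count = σ.count ∧
    (b.foldl (Config.step W n m E) σ).mark = σ.mark := by
  induction b generalizing σ with
  | nil => exact ⟨fun _ => rfl, rfl, rfl, rfl⟩
  | cons x b ih =>
    have hx := hb x (by simp)
    obtain ⟨h1, h2, h3, h4⟩ := ih (fun y hy => hb y (by simp [hy])) (σ.step W n m E x)
    simp only [List.foldl_cons]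
    have key : (∀ r, (σ.step W n m E x).walk r = (σ.walk r).step W n m r x) ∧
        (σ.step W n m E x).chosen = σ.chosen ∧ (σ.step W n m E x).count = σ.count ∧
        (σ.step W n m E x).mark = σ.mark := by
      unfold Config.step Walk.step
      by_cases hxm : x < m
      · simp [hxm, Config.walk]
      · by_cases hxm' : x = m
        · simp [hxm', Config.walk]
        · have : x = m + 1 := by omega
          simp [this, Config.walk]
    refine ⟨fun r => ?_, h2.trans key.2.1, h3.trans key.2.2.1, h4.trans key.2.2.2⟩
    rw [h1, key.1]

theorem foldl_mark (i : ℕ) (σ : Config) :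
    (List.replicate i (m + 2)).foldl (Config.step W n m E) σ = { σ with mark := σ.mark + i } := by
  induction i generalizing σ with
  | zero => rfl
  | succ i ih =>
    rw [List.replicate_succ, List.foldl_cons, ih]
    simp [Config.step, Nat.add_assoc, Nat.add_comm 1]

/-- What is known about every live exploration from `r`, whatever the symbols were: its root is
admissible, and its stamps extend `f`. -/
def Walk.Sound (n : ℕ) (f : ℕ → ℕ) (lo hi r : ℕ) (w : Walk) : Prop :=
  w.stamp r ≠ 0 → (lo ≤ r ∧ r < hi) ∧ Stamped n w.stamp w.size ∧
    (∀ y < n, f y ≠ 0 → w.stamp y = f y)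

theorem Walk.Sound.step {f : ℕ → ℕ} {lo hi r : ℕ} {w : Walk} (h : w.Sound n f lo hi r)
    (x : ℕ) : (w.step W n m r x).Sound n f lo hi r := by
  unfold Walk.step
  split_ifs with h1 h2
  · simp only [Sound, growRow]
    split_ifs with h3 h4
    · exact fun h' => absurd h3 h'
    · intro _
      obtain ⟨h5, h6, h7⟩ := h h3
      refine ⟨h5, h6.update h4.2.1 h4.2.2, fun y hy hfy => ?_⟩
      rw [update_of_ne]
      · exact h7 y hy hfy
      · intro e
        exact hfy ((h7 y hy hfy).symm.trans (by rw [e]; exact h4.2.2))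
    · simp
  · exact h
  · exact h

theorem Walk.Sound.foldl {f : ℕ → ℕ} {lo hi r : ℕ} (b : List ℕ) {w : Walk}
    (h : w.Sound n f lo hi r) : (b.foldl (Walk.step W n m r) w).Sound n f lo hi r := by
  induction b generalizing w with
  | nil => exact h
  | cons x b ih => exact ih (h.step x)

theorem start_sound {f : ℕ → ℕ} {c lo hi r : ℕ} (hf : Stamped n f c) (hr : r < n) :
    ((Config.start f c lo hi).walk r).Sound n f lo hi r := by
  simp only [Walk.Sound, Config.walk, Config.start]
  split_ifs with h
  · intro _
    refine ⟨⟨h.1, h.2.1⟩, hf.update hr h.2.2, fun y _ hy => ?_⟩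
    rw [update_of_ne]
    rintro rfl; exact hy h.2.2
  · simp

/-- The exploration guaranteed by `exists_walk`, from the start of a phase. -/
theorem exists_phase (hm : 0 < m) {f : ℕ → ℕ} {c r : ℕ} {R : Finset ℕ} (hf : Stamped n f c)
    (hRn : R ⊆ range n) (hfR : Disjoint (supp n f) R) (hrR : r ∈ R) :
    ∃ (b : List ℕ) (C : Finset ℕ), r ∈ C ∧ C ⊆ R ∧ b.length ≤ 3 * #C ∧ (∀ x ∈ b, x ≤ m + 1) ∧
      (∀ lo hi, lo ≤ r → r < hi →
        supp n ((b.foldl (Config.step W n m E) (Config.start f c lo hi)).rows r) = supp n f ∪ C ∧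
        (b.foldl (Config.step W n m E) (Config.start f c lo hi)).rows r r ≠ 0) ∧
      ∀ v ∈ C, m * ∑ u ∈ R \ C, W v u ≤ ∑ u ∈ range n, W v u := by
  have hr : r < n := mem_range.1 (hRn hrR)
  have hfr : f r = 0 := by
    by_contra h
    exact disjoint_left.1 hfR (mem_supp.2 ⟨hr, h⟩) hrR
  obtain ⟨b, C, h1, h2, h3, h4, h5, h6, h7⟩ := exists_walk (W := W) hm (r := r) (c := c) hRn hfR
    (#R + 1) ⟨update f r (c + 1), c + 1, c + 1, 0⟩ {r} (singleton_subset_iff.2 hrR)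
    (hf.update hr hfr) (by simp) rfl
    (by rw [supp_update hr (Nat.succ_ne_zero c), insert_eq, union_comm])
    (by simp) (by simp) (by simp)
    (by simp only; omega) (by simp)
  refine ⟨b, C, h1 (mem_singleton_self r), h2, ?_, h4, ?_, h7⟩
  · simp only [card_singleton] at h3; omega
  · intro lo hi hlo hhi
    have hstart : (Config.start f c lo hi).walk r = ⟨update f r (c + 1), c + 1, c + 1, 0⟩ := by
      simp [Config.start, Config.walk, hlo, hhi, hfr]
    have h := (foldl_step_walk (W := W) (n := n) (E := E) b h4 (Config.start f c lo hi)).1 r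
    rw [hstart] at h
    rw [← h] at h5 h6
    exact ⟨h5, h6⟩

/-- At the end of a phase the best exploration has the size of the one from `r` and is at least
as good. -/
theorem best_spec {f : ℕ → ℕ} {c lo hi r : ℕ} {C : Finset ℕ} {b : List ℕ} {σ : Config}
    (hf : Stamped n f c) (hr : r < n) (hb : ∀ x ∈ b, x ≤ m + 1)
    (hσ : b.foldl (Config.step W n m E) (Config.start f c lo hi) = σ)
    (hsupp : supp n (σ.rows r) = supp n f ∪ C) (halive : σ.rows r r ≠ 0)
    (hC : Disjoint (supp n f) C) :
    σ.best n E < n ∧ (lo ≤ σ.best n E ∧ σ.best n E < hi) ∧ σ.size = c + #C ∧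
      Stamped n (σ.rows (σ.best n E)) σ.size ∧
      (∀ y < n, f y ≠ 0 → σ.rows (σ.best n E) y = f y) ∧
      E (supp n (σ.rows (σ.best n E))) ≤ E (supp n f ∪ C) := by
  have hsound : ∀ q < n, (σ.walk q).Sound n f lo hi q := by
    intro q hq
    rw [← hσ, (foldl_step_walk (E := E) b hb _).1 q]
    exact (start_sound hf hq).foldl b
  rcases bestIdx_spec (alive := fun r => σ.rows r r ≠ 0)
    (cost := fun r => E (supp n (σ.rows r))) n le_rfl with ⟨_, h⟩ | ⟨h1, h2, h3⟩
  · exact absurd halive (h r hr)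
  · obtain ⟨h4, h5, h6⟩ := hsound _ h1 h2
    refine ⟨h1, h4, ?_, h5, h6, ?_⟩
    · have := (hsound r hr halive).2.1.card
      simp only [Config.walk] at this
      rw [← this, hsupp, card_union_of_disjoint hC, hf.card]
    · exact (h3 r hr halive).trans_eq (by simp only [hsupp])

/-- Some string makes the decoder add `#R` vertices, at the price of `R` and of a `1 / m` fraction
of the weighted degrees in `R`.

Let `C ⊆ R` be the smallest set that is explored from a root in `R`. The decoder, which does not
know the root, finds an exploration of the same size that is at least as good. If it avoids `R`, it
can replace `C`, and `R \ C` remains. Otherwise it contains some `v ∈ R`, which the string tells by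
its position; the exploration from `v` inside `R` is then the only candidate, and it is no smaller
than `C`, so that its size pays for the symbols spent on the first one. -/
theorem exists_string (hm : 0 < m)
    (hEunion : ∀ A ⊆ range n, ∀ B ⊆ range n, E (A ∪ B) ≤ E A + E B)
    (hEdisj : ∀ A ⊆ range n, ∀ B ⊆ range n, Disjoint A B →
      E A + E B ≤ E (A ∪ B) + ∑ a ∈ A, ∑ b ∈ B, W a b)
    (N : ℕ) (R : Finset ℕ) (f : ℕ → ℕ) (c : ℕ) (hN : #R ≤ N) (hf : Stamped n f c)
    (hRn : R ⊆ range n) (hfR : Disjoint (supp n f) R) :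
    ∃ (a : List ℕ) (f' : ℕ → ℕ) (c' : ℕ), a.length ≤ 9 * #R ∧ (∀ x ∈ a, x < m + 4) ∧
      a.foldl (Config.step W n m E) (Config.start f c 0 n) = Config.start f' c' 0 n ∧
      Stamped n f' c' ∧ c' = c + #R ∧
      m * E (supp n f') ≤ m * (E (supp n f) + E R) + ∑ v ∈ R, ∑ u ∈ range n, W v u := by
  classical
  induction N generalizing R f c with
  | zero =>
    have hR : R = ∅ := card_eq_zero.1 (by omega)
    subst hR
    exact ⟨[], f, c, by simp, by simp, rfl, hf, by simp, by simp [mul_add]⟩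
  | succ N ih =>
    rcases R.eq_empty_or_nonempty with rfl | hne
    · exact ⟨[], f, c, by simp, by simp, rfl, hf, by simp, by simp [mul_add]⟩
    have hfn : supp n f ⊆ range n := filter_subset _ _
    -- It suffices to fix a set `C` that is almost separated from the rest of `R`, to add `#C`
    -- vertices outside `R \ C` at no more than the price of `C`, and to recurse on `R \ C`.
    have recurse : ∀ (C : Finset ℕ) (a₁ : List ℕ) (g : ℕ → ℕ), C ⊆ R → C.Nonempty →
        (∀ v ∈ C, m * ∑ u ∈ R \ C, W v u ≤ ∑ u ∈ range n, W v u) →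
        a₁.length ≤ 9 * #C → (∀ x ∈ a₁, x < m + 4) →
        a₁.foldl (Config.step W n m E) (Config.start f c 0 n) = Config.start g (c + #C) 0 n →
        Stamped n g (c + #C) → Disjoint (supp n g) (R \ C) →
        E (supp n g) ≤ E (supp n f ∪ C) →
        ∃ (a : List ℕ) (f' : ℕ → ℕ) (c' : ℕ), a.length ≤ 9 * #R ∧ (∀ x ∈ a, x < m + 4) ∧
          a.foldl (Config.step W n m E) (Config.start f c 0 n) = Config.start f' c' 0 n ∧
          Stamped n f' c' ∧ c' = c + #R ∧
          m * E (supp n f') ≤ m * (E (supp n f) + E R) + ∑ v ∈ R, ∑ u ∈ range n, W v u := by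
      intro C a₁ g hCR hCne hsep hlen hchar hfold hg hdisj hcost
      have hcard : #(R \ C) + #C = #R := card_sdiff_add_card_eq_card hCR
      have hCpos := hCne.card_pos
      obtain ⟨a₂, f', c', h1, h2, h3, h4, h5, h6⟩ := ih (R \ C) g (c + #C) (by omega) hg
        (sdiff_subset.trans hRn) hdisj
      refine ⟨a₁ ++ a₂, f', c', ?_, ?_, ?_, h4, by omega, ?_⟩
      · rw [List.length_append]; omega
      · intro x hx
        rcases List.mem_append.1 hx with hx | hx
        · exact hchar x hx
        · exact h2 x hx
      · rw [List.foldl_append, hfold, h3]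
      · have hsplit : ∑ v ∈ R, ∑ u ∈ range n, W v u
            = ∑ v ∈ R \ C, ∑ u ∈ range n, W v u + ∑ v ∈ C, ∑ u ∈ range n, W v u :=
          (sum_sdiff hCR).symm
        have hloss : m * ∑ v ∈ C, ∑ u ∈ R \ C, W v u ≤ ∑ v ∈ C, ∑ u ∈ range n, W v u := by
          rw [mul_sum]
          exact sum_le_sum hsep
        have e1 := hEunion (supp n f) hfn C (hCR.trans hRn)
        have e2 := hEdisj C (hCR.trans hRn) (R \ C) (sdiff_subset.trans hRn) disjoint_sdiff
        rw [union_sdiff_of_subset hCR] at e2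
        calc m * E (supp n f')
            ≤ m * (E (supp n g) + E (R \ C)) + ∑ v ∈ R \ C, ∑ u ∈ range n, W v u := h6
          _ ≤ m * (E (supp n f) + (E C + E (R \ C))) + ∑ v ∈ R \ C, ∑ u ∈ range n, W v u := by
              rw [← add_assoc]; gcongr; exact hcost.trans e1
          _ ≤ m * (E (supp n f) + (E R + ∑ v ∈ C, ∑ u ∈ R \ C, W v u))
                + ∑ v ∈ R \ C, ∑ u ∈ range n, W v u := by gcongr
          _ = m * (E (supp n f) + E R) + (∑ v ∈ R \ C, ∑ u ∈ range n, W v u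
                + m * ∑ v ∈ C, ∑ u ∈ R \ C, W v u) := by ring
          _ ≤ _ := by rw [hsplit]; gcongr
    -- Among all roots in `R`, take one whose exploration is smallest.
    let P : ℕ → Prop := fun s => ∃ r ∈ R, ∃ (b : List ℕ) (C : Finset ℕ), #C = s ∧
      r ∈ C ∧ C ⊆ R ∧ b.length ≤ 3 * #C ∧ (∀ x ∈ b, x ≤ m + 1) ∧
      (∀ lo hi, lo ≤ r → r < hi →
        supp n ((b.foldl (Config.step W n m E) (Config.start f c lo hi)).rows r) = supp n f ∪ C ∧
        (b.foldl (Config.step W n m E) (Config.start f c lo hi)).rows r r ≠ 0) ∧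
      ∀ v ∈ C, m * ∑ u ∈ R \ C, W v u ≤ ∑ u ∈ range n, W v u
    have hP : ∃ s, P s := by
      obtain ⟨r, hr⟩ := hne
      obtain ⟨b, C, h⟩ := exists_phase (W := W) (E := E) hm hf hRn hfR hr
      exact ⟨#C, r, hr, b, C, rfl, h⟩
    obtain ⟨r, hrR, b, C, hCs, hrC, hCR, hblen, hbx, hrow, hsep⟩ := Nat.find_spec hP
    have hmin : ∀ s, P s → #C ≤ s := fun s hs => by rw [hCs]; exact Nat.find_min' hP hs
    have hrn : r < n := mem_range.1 (hRn hrR)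
    obtain ⟨hr1, hr2⟩ := hrow 0 n (Nat.zero_le r) hrn
    have hwalk := foldl_step_walk (W := W) (n := n) (E := E) b hbx (Config.start f c 0 n)
    generalize hσ : b.foldl (Config.step W n m E) (Config.start f c 0 n) = σ at hr1 hr2 hwalk
    obtain ⟨-, hchosen, hcount, hmark⟩ := hwalk
    replace hchosen : σ.chosen = f := hchosen
    replace hcount : σ.count = c := hcount
    replace hmark : σ.mark = 0 := hmark
    obtain ⟨hp, -, hsize, hpst, hpf, hpE⟩ := best_spec hf hrn hbx hσ hr1 hr2
      (disjoint_of_subset_right hCR hfR)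
    set p := σ.best n E with hpdef
    have hCpos : 0 < #C := card_pos.2 ⟨r, hrC⟩
    by_cases hdisj : Disjoint (supp n (σ.rows p)) R
    · refine recurse C (b ++ [m + 3]) (σ.rows p) hCR ⟨r, hrC⟩ hsep ?_ ?_ ?_ (hsize ▸ hpst)
        (disjoint_of_subset_right sdiff_subset hdisj) hpE
      · rw [List.length_append, List.length_singleton]; omega
      · intro x hx
        rcases List.mem_append.1 hx with hx | hx
        · have := hbx x hx; omega
        · rw [List.mem_singleton.1 hx]; omega
      · rw [List.foldl_append, hσ, List.foldl_cons, List.foldl_nil]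
        simp only [Config.step, Config.finish]
        rw [if_neg (by omega), if_neg (by omega), if_neg (by omega), if_neg (by omega), ← hpdef,
          if_pos hp, if_pos hmark, hsize]
    · -- The best exploration meets `R` in a vertex `v`, from which it is explored anew.
      rw [not_disjoint_iff] at hdisj
      obtain ⟨v, hv, hvR⟩ := hdisj
      rw [mem_supp] at hv
      have hvc : c < σ.rows p v := by
        by_contra hle
        -- A vertex with an old stamp would have to be an old vertex.
        obtain ⟨y, hy, e⟩ := hf.surj _ (Nat.pos_of_ne_zero hv.2) (not_lt.1 hle)
        have hfy : f y ≠ 0 := by rw [e]; exact hv.2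
        have e' := hpf y hy hfy
        have := hpst.inj y hy v hv.1 (e'.trans e) (by rw [e']; exact hfy)
        subst this
        exact disjoint_left.1 hfR (mem_supp.2 ⟨hy, hfy⟩) hvR
      obtain ⟨b₂, C₂, hvC₂, hC₂R, hb₂len, hb₂x, hrow₂, hsep₂⟩ :=
        exists_phase (W := W) (E := E) hm hf hRn hfR hvR
      have hC₂ : #C ≤ #C₂ := hmin _ ⟨v, hvR, b₂, C₂, rfl, hvC₂, hC₂R, hb₂len, hb₂x, hrow₂, hsep₂⟩
      obtain ⟨hv1, hv2⟩ := hrow₂ v (v + 1) le_rfl (Nat.lt_succ_self v)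
      have hwalk₂ := foldl_step_walk (W := W) (n := n) (E := E) b₂ hb₂x
        (Config.start f c v (v + 1))
      generalize hσ₂ : b₂.foldl (Config.step W n m E) (Config.start f c v (v + 1)) = σ₂
        at hv1 hv2 hwalk₂
      obtain ⟨-, -, -, hmark₂⟩ := hwalk₂
      replace hmark₂ : σ₂.mark = 0 := hmark₂
      obtain ⟨hp₂, hpv, hsize₂, hpst₂, -, hpE₂⟩ := best_spec hf hv.1 hb₂x hσ₂ hv1 hv2
        (disjoint_of_subset_right hC₂R hfR)
      have hpv' : σ₂.best n E = v := by omega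
      rw [hpv'] at hpst₂ hpE₂
      set i := σ.rows p v - c with hi
      have hile : i ≤ #C := by
        have := hpst.le v hv.1
        omega
      have hroot : lastIdx (fun y => σ.rows p y = c + i) n n = v := by
        refine lastIdx_eq hv.1 (by omega) fun y hy e => ?_
        exact hpst.inj y hy v hv.1 (by omega) (by omega)
      -- The string has length at most `3 * #C + #C + 1 + 3 * #C₂ + 1`, where `1 ≤ #C ≤ #C₂`.
      refine recurse C₂ (b ++ List.replicate i (m + 2) ++ [m + 3] ++ b₂ ++ [m + 3]) (σ₂.rows v)
        hC₂R ⟨v, hvC₂⟩ hsep₂ ?_ ?_ ?_ (hsize₂ ▸ hpst₂) ?_ hpE₂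
      · simp only [List.length_append, List.length_singleton, List.length_replicate]
        omega
      · intro x hx
        simp only [List.mem_append, List.mem_singleton, List.mem_replicate] at hx
        rcases hx with (((hx | hx) | hx) | hx) | hx
        · have := hbx x hx; omega
        · omega
        · omega
        · have := hb₂x x hx; omega
        · omega
      · have hfin : (Config.step W n m E { σ with mark := σ.mark + i } (m + 3))
            = Config.start f c v (v + 1) := by
          have hb' : Config.best n E { σ with mark := σ.mark + i } = p := rfl
          have hmi : σ.mark + i ≠ 0 := by omega
          have hmi' : σ.mark + i = i := by
            rw [hmark]; exact Nat.zero_add i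
          simp only [Config.step, Config.finish]
          rw [if_neg (by omega), if_neg (by omega), if_neg (by omega), if_neg (by omega), hb',
            if_pos hp, if_neg hmi, hcount, hchosen, hmi',
            hroot]
        have hfin₂ : σ₂.step W n m E (m + 3) = Config.start (σ₂.rows v) (c + #C₂) 0 n := by
          simp only [Config.step, Config.finish]
          rw [if_neg (by omega), if_neg (by omega), if_neg (by omega), if_neg (by omega),
            if_pos hp₂, if_pos hmark₂, hpv', hsize₂]
        rw [List.foldl_append, List.foldl_append, List.foldl_append, List.foldl_append, hσ,
          foldl_mark]
        simp only [List.foldl_cons, List.foldl_nil]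
        rw [hfin, hσ₂, hfin₂]
      · rw [hv1, disjoint_union_left]
        exact ⟨disjoint_of_subset_right sdiff_subset hfR, disjoint_sdiff⟩

end Phase

end MinKVC

/-! ### Covered weights in matrix form -/

namespace MinKVC

open Finset Function

section Cover

open Classical in
/-- The weight covered by `X`, as a sum over the pairs `i ≤ j < n`. -/
noncomputable def pairCover (W : ℕ → ℕ → ℝ≥0) (n : ℕ) (X : Finset ℕ) : ℝ≥0 :=
  ∑ i ∈ range n, ∑ j ∈ range n, if ¬ j < i ∧ (i ∈ X ∨ j ∈ X) then W i j else 0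

variable {n : ℕ}

/-- The weights as a matrix, extended by zero. -/
noncomputable def edgeWeight (w : Sym2 (Fin n) → ℝ≥0) (i j : ℕ) : ℝ≥0 :=
  if h : i < n ∧ j < n then w s(⟨i, h.1⟩, ⟨j, h.2⟩) else 0

theorem edgeWeight_coe (w : Sym2 (Fin n) → ℝ≥0) (i j : Fin n) :
    edgeWeight w i j = w s(i, j) := by
  simp [edgeWeight]

open Classical in
/-- The vertices whose index lies in `X`. -/
noncomputable def toVertices (n : ℕ) (X : Finset ℕ) : Finset (Fin n) :=
  univ.filter fun v => (v : ℕ) ∈ X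

theorem mem_toVertices {X : Finset ℕ} {v : Fin n} : v ∈ toVertices n X ↔ (v : ℕ) ∈ X := by
  simp [toVertices]

theorem toVertices_map (S : Finset (Fin n)) : toVertices n (S.map Fin.valEmbedding) = S := by
  ext v
  rw [mem_toVertices, mem_map]
  constructor
  · rintro ⟨u, hu, e⟩
    rwa [← Fin.ext (a := u) (b := v) e]
  · exact fun h => ⟨v, h, rfl⟩

theorem map_toVertices {X : Finset ℕ} (hX : X ⊆ range n) :
    (toVertices n X).map Fin.valEmbedding = X := by
  ext v
  rw [mem_map]
  constructor
  · rintro ⟨u, hu, rfl⟩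
    exact mem_toVertices.1 hu
  · exact fun h => ⟨⟨v, mem_range.1 (hX h)⟩, mem_toVertices.2 h, rfl⟩

theorem pairCover_eq (w : Sym2 (Fin n) → ℝ≥0) (X : Finset ℕ) :
    pairCover (edgeWeight w) n X = coverWeight w (toVertices n X) := by
  classical
  unfold pairCover coverWeight
  rw [sum_filter, ← Equiv.sum_comp (Sym2.sortEquiv (α := Fin n)).symm]
  refine Eq.trans ?_ ((Finset.sum_subtype (p := fun p : Fin n × Fin n => p.1 ≤ p.2)
    (univ.filter fun p : Fin n × Fin n => p.1 ≤ p.2) (by simp)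
    (fun p : Fin n × Fin n =>
      if ∃ v ∈ toVertices n X, v ∈ s(p.1, p.2) then w s(p.1, p.2) else 0)).trans
    (sum_congr rfl fun p _ => by congr))
  rw [sum_filter, ← univ_product_univ, sum_product, sum_range]
  refine sum_congr rfl fun i _ => ?_
  rw [sum_range]
  refine sum_congr rfl fun j _ => ?_
  have : (∃ v ∈ toVertices n X, v ∈ s(i, j)) ↔ (i : ℕ) ∈ X ∨ (j : ℕ) ∈ X := by
    simp only [mem_toVertices, Sym2.mem_iff]
    constructor
    · rintro ⟨v, hv, rfl | rfl⟩
      · exact .inl hv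
      · exact .inr hv
    · rintro (h | h)
      · exact ⟨i, h, .inl rfl⟩
      · exact ⟨j, h, .inr rfl⟩
  simp only [this, edgeWeight_coe, not_lt, Fin.val_fin_le, ite_and]

section Graph

variable {V : Type*} [Fintype V] [DecidableEq V] (w : Sym2 V → ℝ≥0)

theorem coverWeight_union_le (A B : Finset V) :
    coverWeight w (A ∪ B) ≤ coverWeight w A + coverWeight w B := by
  unfold coverWeight
  rw [← sum_union_inter]
  refine le_add_right (sum_le_sum_of_subset ?_)
  intro e he
  simp only [mem_filter, mem_univ, true_and, mem_union] at he ⊢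
  obtain ⟨v, hv | hv, hve⟩ := he
  · exact .inl ⟨v, hv, hve⟩
  · exact .inr ⟨v, hv, hve⟩

/-- The edges that are covered by both sets run between them. -/
theorem coverWeight_add_le {A B : Finset V} (hAB : Disjoint A B) :
    coverWeight w A + coverWeight w B ≤
      coverWeight w (A ∪ B) + ∑ a ∈ A, ∑ b ∈ B, w s(a, b) := by
  unfold coverWeight
  rw [← sum_union_inter]
  refine add_le_add (sum_le_sum_of_subset ?_) ?_
  · intro e he
    simp only [mem_filter, mem_univ, true_and, mem_union] at he ⊢
    rcases he with ⟨v, hv, hve⟩ | ⟨v, hv, hve⟩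
    · exact ⟨v, .inl hv, hve⟩
    · exact ⟨v, .inr hv, hve⟩
  · rw [← sum_product', ← Finset.sum_fiberwise_of_maps_to
      (s := A ×ˢ B) (t := univ) (g := fun p => s(p.1, p.2)) (fun _ _ => mem_univ _)]
    rw [← sum_subset (subset_univ (({e | ∃ v ∈ A, v ∈ e} : Finset (Sym2 V)) ∩
      ({e | ∃ v ∈ B, v ∈ e} : Finset (Sym2 V))))]
    · apply sum_le_sum
      intro e he
      simp only [mem_inter, mem_filter, mem_univ, true_and] at he
      obtain ⟨⟨a, ha, hae⟩, b, hb, hbe⟩ := he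
      have hne : a ≠ b := fun e => disjoint_left.1 hAB ha (e ▸ hb)
      have hes : e = s(a, b) := (Sym2.mem_and_mem_iff hne).1 ⟨hae, hbe⟩
      subst hes
      have hab : (a, b) ∈ {p ∈ A ×ˢ B | s(p.1, p.2) = s(a, b)} :=
        mem_filter.2 ⟨mem_product.2 ⟨ha, hb⟩, rfl⟩
      exact single_le_sum (f := fun p : V × V => w s(p.1, p.2)) (fun _ _ => zero_le) hab
    · intro e _ he
      rw [sum_eq_zero]
      intro p hp
      rw [mem_filter, mem_product] at hp
      refine absurd ?_ he
      simp only [mem_inter, mem_filter, mem_univ, true_and]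
      rw [← hp.2]
      exact ⟨⟨p.1, hp.1.1, Sym2.mem_mk_left _ _⟩, p.2, hp.1.2, Sym2.mem_mk_right _ _⟩

/-- Every covered edge is counted by at most two of its endpoints. -/
theorem sum_degree_le (S : Finset V) :
    ∑ v ∈ S, ∑ u, w s(v, u) ≤ 2 * coverWeight w S := by
  unfold coverWeight
  rw [← sum_product', ← Finset.sum_fiberwise_of_maps_to
      (s := S ×ˢ univ) (t := ({e | ∃ v ∈ S, v ∈ e} : Finset (Sym2 V)))
      (g := fun p => s(p.1, p.2)), mul_sum]
  · apply sum_le_sum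
    intro e _
    have h1 : ∑ p ∈ S ×ˢ (univ : Finset V) with s(p.1, p.2) = e, w s(p.1, p.2)
        = #{p ∈ S ×ˢ (univ : Finset V) | s(p.1, p.2) = e} * w e := by
      rw [← nsmul_eq_mul, ← sum_const]
      exact sum_congr rfl fun p hp => by rw [(mem_filter.1 hp).2]
    rw [h1]
    gcongr
    induction e using Sym2.ind with
    | _ a b =>
      have : {p ∈ S ×ˢ (univ : Finset V) | s(p.1, p.2) = s(a, b)}
          ⊆ ({(a, b), (b, a)} : Finset _) := by
        intro p hp
        have := (mem_filter.1 hp).2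
        rw [Sym2.eq_iff] at this
        simp only [mem_insert, mem_singleton]
        rcases this with ⟨h, h'⟩ | ⟨h, h'⟩
        · exact .inl (Prod.ext h h')
        · exact .inr (Prod.ext h h')
      exact_mod_cast (card_le_card this).trans card_le_two
  · intro p hp
    rw [mem_product] at hp
    simp only [mem_filter, mem_univ, true_and]
    exact ⟨p.1, hp.1, Sym2.mem_mk_left _ _⟩

end Graph

variable (w : Sym2 (Fin n) → ℝ≥0)

theorem toVertices_union (A B : Finset ℕ) :
    toVertices n (A ∪ B) = toVertices n A ∪ toVertices n B := by
  ext v; simp [mem_toVertices]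

theorem sum_toVertices {M : Type*} [AddCommMonoid M] {A : Finset ℕ} (hA : A ⊆ range n)
    (g : ℕ → M) : ∑ a ∈ A, g a = ∑ v ∈ toVertices n A, g v := by
  conv_lhs => rw [← map_toVertices hA]
  rw [sum_map]; rfl

/-- Some string of length at most `9 * #S` decodes to a set of `#S` vertices whose cost exceeds that
of `S` by a factor of at most `1 + 2 / m`. -/
theorem exists_decode {m : ℕ} (hm : 0 < m) (S : Finset (Fin n)) :
    ∃ a : List ℕ, a.length ≤ 9 * #S ∧ (∀ x ∈ a, x < m + 4) ∧ ∃ f c,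
      decode (edgeWeight w) n m (pairCover (edgeWeight w) n) a = Config.start f c 0 n ∧
      #(supp n f) = #S ∧
      m * pairCover (edgeWeight w) n (supp n f) ≤ (m + 2) * coverWeight w S := by
  classical
  have hR : S.map Fin.valEmbedding ⊆ range n := by
    intro x hx
    obtain ⟨v, _, rfl⟩ := mem_map.1 hx
    exact mem_range.2 v.2
  have h0 : supp n (fun _ => 0) = ∅ := by simp [supp]
  obtain ⟨a, f, c, h1, h2, h3, h4, h5, h6⟩ := exists_string (W := edgeWeight w) (m := m) (n := n)
    (E := pairCover (edgeWeight w) n) hm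
    (by
      intro A _ B _
      simp only [pairCover_eq, toVertices_union]
      exact coverWeight_union_le w _ _)
    (by
      intro A hA B hB hAB
      simp only [pairCover_eq, toVertices_union]
      rw [sum_toVertices hA]
      have hdisj : Disjoint (toVertices n A) (toVertices n B) := by
        rw [disjoint_left] at hAB ⊢
        intro v hv hv'
        exact hAB (mem_toVertices.1 hv) (mem_toVertices.1 hv')
      refine (coverWeight_add_le w hdisj).trans_eq ?_
      congr 1
      refine sum_congr rfl fun v _ => ?_
      rw [sum_toVertices hB]
      exact sum_congr rfl fun u _ => (edgeWeight_coe w v u).symm)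
    (#S) (S.map Fin.valEmbedding) (fun _ => 0) 0 (by simp)
    ⟨by simp, fun i hi hi' => by omega, by simp⟩ hR (by simp [h0])
  rw [card_map] at h1 h5
  refine ⟨a, h1, h2, f, c, h3, by rw [h4.card, h5, zero_add], h6.trans ?_⟩
  rw [h0, pairCover_eq _ (S.map _), toVertices_map, sum_map, add_mul]
  have e1 : pairCover (edgeWeight w) n ∅ = 0 := by simp [pairCover]
  rw [e1, zero_add]
  gcongr
  refine le_trans (le_of_eq ?_) (sum_degree_le w S)
  refine sum_congr rfl fun v _ => ?_
  rw [sum_range]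
  exact sum_congr rfl fun u _ => edgeWeight_coe w v u

end Cover

end MinKVC

/-! ### Total correctness of programs, with time bounds -/

namespace RAM

open Function

/-- Total correctness with a time bound: started in `s`, the program halts within `B` steps in a
state that satisfies `Q`. -/
def Tot (P : Program) (s : State) (B : ℕ) (Q : State → Prop) : Prop :=
  ∃ t s', Runs P s t s' ∧ t ≤ B ∧ Q s'

namespace State

/-- Write a register. -/
def set (s : State) (i x : ℕ) : State := { s with reg := update s.reg i x }

/-- Write a cell of the integer memory. -/
def setMem (s : State) (a x : ℕ) : State := { s with mem := update s.mem a x }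

/-- Write a cell of the weight memory. -/
noncomputable def setWt (s : State) (a : ℕ) (x : ℝ≥0) : State := { s with wt := update s.wt a x }

@[simp] theorem set_reg (s : State) (i x j : ℕ) :
    (s.set i x).reg j = if j = i then x else s.reg j := by
  simp [set, update_apply]
@[simp] theorem set_mem (s : State) (i x : ℕ) : (s.set i x).mem = s.mem := rfl
@[simp] theorem set_wt (s : State) (i x : ℕ) : (s.set i x).wt = s.wt := rfl
@[simp] theorem setMem_reg (s : State) (a x : ℕ) : (s.setMem a x).reg = s.reg := rfl
@[simp] theorem setMem_mem (s : State) (a x : ℕ) : (s.setMem a x).mem = update s.mem a x := rfl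
@[simp] theorem setMem_wt (s : State) (a x : ℕ) : (s.setMem a x).wt = s.wt := rfl
@[simp] theorem setWt_reg (s : State) (a : ℕ) (x : ℝ≥0) : (s.setWt a x).reg = s.reg := rfl
@[simp] theorem setWt_mem (s : State) (a : ℕ) (x : ℝ≥0) : (s.setWt a x).mem = s.mem := rfl
@[simp] theorem setWt_wt (s : State) (a : ℕ) (x : ℝ≥0) :
    (s.setWt a x).wt = update s.wt a x := rfl

end State

section Exec

variable (s : State)

@[simp] theorem exec_const (i c : ℕ) : (Instr.const i c).exec s = s.set i c := rfl
@[simp] theorem exec_move (i j : ℕ) : (Instr.move i j).exec s = s.set i (s.reg j) := rfl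
@[simp] theorem exec_add (i j l : ℕ) :
    (Instr.add i j l).exec s = s.set i (s.reg j + s.reg l) := rfl
@[simp] theorem exec_load (i j : ℕ) :
    (Instr.load i j).exec s = s.set i (s.mem (s.reg j)) := rfl
@[simp] theorem exec_store (i j : ℕ) :
    (Instr.store i j).exec s = s.setMem (s.reg i) (s.reg j) := rfl
@[simp] theorem exec_wmove (i j : ℕ) :
    (Instr.wmove i j).exec s = s.setWt (s.reg i) (s.wt (s.reg j)) := rfl
@[simp] theorem exec_wadd (i j l : ℕ) :
    (Instr.wadd i j l).exec s = s.setWt (s.reg i) (s.wt (s.reg j) + s.wt (s.reg l)) := rfl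

end Exec

/-- The registers below `b` agree. -/
def Keep (b : ℕ) (s t : State) : Prop := ∀ q < b, t.reg q = s.reg q

theorem Keep.trans {b : ℕ} {s t u : State} (h : Keep b s t) (h' : Keep b t u) : Keep b s u :=
  fun q hq => (h' q hq).trans (h q hq)

theorem Keep.mono {b b' : ℕ} {s t : State} (h : Keep b s t) (hb : b' ≤ b) : Keep b' s t :=
  fun q hq => h q (hq.trans_le hb)

@[simp] theorem keep_set {b i x : ℕ} {s t : State} (h : b ≤ i) :
    Keep b s (t.set i x) ↔ Keep b s t := by
  refine forall₂_congr fun q hq => ?_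
  rw [State.set_reg, if_neg (by omega)]

@[simp] theorem keep_set_left {b i x : ℕ} {s t : State} (h : b ≤ i) :
    Keep b (s.set i x) t ↔ Keep b s t := by
  refine forall₂_congr fun q hq => ?_
  rw [State.set_reg, if_neg (by omega)]

@[simp] theorem keep_setMem {b a x : ℕ} {s t : State} :
    Keep b s (t.setMem a x) ↔ Keep b s t := Iff.rfl

@[simp] theorem keep_setWt {b a : ℕ} {x : ℝ≥0} {s t : State} :
    Keep b s (t.setWt a x) ↔ Keep b s t := Iff.rfl

@[simp] theorem keep_setWt_left {b a : ℕ} {x : ℝ≥0} {s t : State} :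
    Keep b (s.setWt a x) t ↔ Keep b s t := Iff.rfl

@[simp] theorem keep_refl {b : ℕ} {s : State} : Keep b s s := fun _ _ => rfl

namespace Program

/-- Sequential composition. -/
scoped infixr:55 " ;; " => Program.seq

/-- The instruction `Instr.const` as a program. -/
abbrev const (i c : ℕ) : Program := .instr (.const i c)
/-- The instruction `Instr.move` as a program. -/
abbrev move (i j : ℕ) : Program := .instr (.move i j)
/-- The instruction `Instr.add` as a program. -/
abbrev add (i j l : ℕ) : Program := .instr (.add i j l)
/-- The instruction `Instr.load` as a program. -/
abbrev load (i j : ℕ) : Program := .instr (.load i j)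
/-- The instruction `Instr.store` as a program. -/
abbrev store (i j : ℕ) : Program := .instr (.store i j)
/-- The instruction `Instr.wmove` as a program. -/
abbrev wmove (i j : ℕ) : Program := .instr (.wmove i j)
/-- The instruction `Instr.wadd` as a program. -/
abbrev wadd (i j l : ℕ) : Program := .instr (.wadd i j l)

/-- Do nothing. -/
abbrev nop : Program := .move 0 0

/-- `for reg[i] in 0, …, reg[r] - 1 do P`; register `2` has to hold the constant `1`. -/
def forLoop (i r : ℕ) (P : Program) : Program :=
  .const i 0 ;; .loop (.lt i r) (P ;; .add i i 2)

end Program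

open Program

namespace Tot

variable {P P' : Program} {s : State} {B : ℕ} {Q R : State → Prop}

theorem mono (h : Tot P s B Q) {B' : ℕ} (hB : B ≤ B') (hQ : ∀ t, Q t → R t) : Tot P s B' R := by
  obtain ⟨t, s', h1, h2, h3⟩ := h
  exact ⟨t, s', h1, h2.trans hB, hQ _ h3⟩

theorem instr {a : Instr} (hB : 1 ≤ B) (h : Q (a.exec s)) : Tot (.instr a) s B Q :=
  ⟨1, _, .instr a s, hB, h⟩

theorem seq {B₁ : ℕ} (h : Tot P s B₁ Q) (hB : B₁ ≤ B) (h' : ∀ t, Q t → Tot P' t (B - B₁) R) :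
    Tot (P ;; P') s B R := by
  obtain ⟨t, s', h1, h2, h3⟩ := h
  obtain ⟨t', s'', h1', h2', h3'⟩ := h' _ h3
  exact ⟨_, _, .seq h1 h1', by omega, h3'⟩

theorem instr_seq {a : Instr} (hB : 1 ≤ B) (h : Tot P (a.exec s) (B - 1) Q) :
    Tot (.instr a ;; P) s B Q :=
  seq (instr le_rfl (Q := fun t => t = a.exec s) rfl) hB (by rintro _ rfl; exact h)

theorem nop (hB : 1 ≤ B) (h : Q s) : Tot .nop s B Q := by
  refine instr hB ?_
  have : (Instr.move 0 0).exec s = s := by simp [Instr.exec]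
  rwa [this]

theorem ite {b : Test} (hB : 1 ≤ B) (h : b.Holds s → Tot P s (B - 1) Q)
    (h' : ¬ b.Holds s → Tot P' s (B - 1) Q) : Tot (.ite b P P') s B Q := by
  by_cases hb : b.Holds s
  · obtain ⟨t, s', h1, h2, h3⟩ := h hb
    exact ⟨_, _, .ite_true hb h1, by omega, h3⟩
  · obtain ⟨t, s', h1, h2, h3⟩ := h' hb
    exact ⟨_, _, .ite_false hb h1, by omega, h3⟩

/-- A loop that is run exactly `N` times. -/
theorem loop {b : Test} {N T : ℕ} (Inv : ℕ → State → Prop) (h0 : Inv 0 s)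
    (hN : ∀ t, Inv N t → ¬ b.Holds t)
    (hstep : ∀ j < N, ∀ t, Inv j t → b.Holds t ∧ Tot P t T (Inv (j + 1)))
    (hB : N * (T + 1) + 1 ≤ B) : Tot (.loop b P) s B (Inv N) := by
  have key : ∀ d j t, j + d = N → Inv j t → Tot (.loop b P) t (d * (T + 1) + 1) (Inv N) := by
    intro d
    induction d with
    | zero =>
      intro j t hj ht
      obtain rfl : j = N := by omega
      exact ⟨1, t, .loop_false (hN t ht), by simp, ht⟩
    | succ d ih =>
      intro j t hj ht
      obtain ⟨hb, t₁, s₁, h1, h2, h3⟩ := hstep j (by omega) t ht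
      obtain ⟨t₂, s₂, h4, h5, h6⟩ := ih (j + 1) s₁ (by omega) h3
      refine ⟨_, _, .loop_true hb h1 h4, ?_, h6⟩
      rw [add_mul]; omega
  exact (key N 0 s (by omega) h0).mono hB fun _ h => h

/-- A loop over `0, …, N - 1`. The bound `T` for one iteration includes the test and the increment of
the loop variable. -/
theorem forLoop {i r N T : ℕ} (Inv : ℕ → State → Prop) (h0 : Inv 0 (s.set i 0))
    (hreg : ∀ j t, Inv j t → t.reg i = j ∧ t.reg r = N)
    (hstep : ∀ j < N, ∀ t, Inv j t →
      Tot P t (T - 2) fun t' => Inv (j + 1) (t'.set i (t'.reg i + t'.reg 2)))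
    (hB : N * T + 2 ≤ B) (hT : 2 ≤ T := by omega) : Tot (.forLoop i r P) s B (Inv N) := by
  unfold Program.forLoop
  refine instr_seq (by omega) ?_
  refine loop (T := T - 1) Inv h0 ?_ ?_ (by rw [show T - 1 + 1 = T by omega]; omega)
  · intro t ht
    obtain ⟨h1, h2⟩ := hreg N t ht
    simp [Test.Holds, h1, h2]
  · intro j hj t ht
    obtain ⟨h1, h2⟩ := hreg j t ht
    refine ⟨by simpa [Test.Holds, h1, h2] using hj, ?_⟩
    exact seq (hstep j hj t ht) (by omega) fun t' ht' => instr (by omega) ht'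

end Tot

end RAM

/-! ### Search, and the sorted lists -/

namespace MinKVC

open RAM RAM.Program Finset

/-- Put into register `52` the last `i < n` such that the cell `reg[50] + i` holds `reg[51]`, and
`n` if there is none. -/
def searchProg : Program :=
  .move 52 0 ;; .forLoop 53 0 (.add 54 50 53 ;; .load 55 54 ;;
    .ite (.lt 55 51) .nop (.ite (.lt 51 55) .nop (.move 52 53)))

theorem searchProg_spec {n B : ℕ} {s : State} {f : ℕ → ℕ} (h0 : s.reg 0 = n) (h2 : s.reg 2 = 1)
    (hf : ∀ v < n, s.mem (s.reg 50 + v) = f v) (hB : n * 7 + 3 ≤ B) :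
    Tot searchProg s B fun t => Keep 52 s t ∧ t.mem = s.mem ∧ t.wt = s.wt ∧
      t.reg 52 = lastIdx (fun i => f i = s.reg 51) n n := by
  unfold searchProg
  refine .instr_seq (by omega) ?_
  refine (Tot.forLoop (N := n) (T := 7) (fun j t => Keep 52 s t ∧ t.mem = s.mem ∧ t.wt = s.wt ∧
    t.reg 53 = j ∧ t.reg 52 = lastIdx (fun i => f i = s.reg 51) n j) ?_ ?_ ?_ (by omega)).mono
    le_rfl fun t ht => ⟨ht.1, ht.2.1, ht.2.2.1, ht.2.2.2.2⟩
  · simp [lastIdx, h0]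
  · intro j t ht
    exact ⟨ht.2.2.2.1, (ht.1 0 (by norm_num)).trans h0⟩
  · intro j hj t ⟨hk, hm, hw, hi, hr⟩
    have k2 := hk 2 (by norm_num)
    have k50 := hk 50 (by norm_num)
    have k51 := hk 51 (by norm_num)
    have hfj := hf j hj
    refine .instr_seq (by omega) (.instr_seq (by omega) (.ite (by omega)
      (fun h1 => .nop (by omega) ?_) fun h1 => .ite (by omega) (fun h2 => .nop (by omega) ?_) fun h2 => .instr (by omega) ?_))
    · have : f j ≠ s.reg 51 := by
        simp [Test.Holds, k50, k51, hm, hi, hfj] at h1; omega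
      simp [lastIdx, *]
    · have : f j ≠ s.reg 51 := by
        simp [Test.Holds, k50, k51, hm, hi, hfj] at h2; omega
      simp [lastIdx, *]
    · have : f j = s.reg 51 := by
        simp [Test.Holds, k50, k51, hm, hi, hfj] at h1 h2; omega
      simp [lastIdx, *]

/-- The registers with fixed contents, and the weights. The cells of the integer memory are used as
follows: the best solution in `[0, n)`, the chosen vertices in `[n, 2n)`, the string of symbols in
`[2n, 11n)`, and row `r` of the explorations in `[11n + rn, 11n + rn + n)`. Of the weight memory
beyond the input, cell `n²` holds zero, and the next three hold the last cost that was computed, the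
cost of the best exploration and the cost of the best solution. Of the other registers, `17` tells
whether there is a best solution, `18` whether all strings have been tried, `19` and `20` hold the
position in the string and its symbol, `21` to `25` represent the state of the decoder, and the
rest is scratch space. -/
structure Env (n k m : ℕ) (W : ℕ → ℕ → ℝ≥0) (s : State) : Prop where
  r0 : s.reg 0 = n
  r1 : s.reg 1 = k
  r2 : s.reg 2 = 1
  r3 : s.reg 3 = m
  r4 : s.reg 4 = m + 4
  r5 : s.reg 5 = 9 * k
  r6 : s.reg 6 = n
  r7 : s.reg 7 = 2 * n
  r8 : s.reg 8 = 11 * n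
  r9 : s.reg 9 = n * n
  r10 : s.reg 10 = n * n + 1
  r11 : s.reg 11 = n * n + 2
  r12 : s.reg 12 = n * n + 3
  r13 : s.reg 13 = 0
  r14 : s.reg 14 = m + 1
  r15 : s.reg 15 = m + 2
  r16 : s.reg 16 = m + 3
  weight : ∀ i < n, ∀ j < n, s.wt (i * n + j) = W i j
  zero : s.wt (n * n) = 0

theorem pair_lt {n i j : ℕ} (hi : i < n) (hj : j < n) : i * n + j < n * n := by
  have := Nat.mul_le_mul_right n (Nat.succ_le_of_lt hi)
  rw [Nat.succ_mul] at this
  omega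

variable {n k m B : ℕ} {W : ℕ → ℕ → ℝ≥0} {s t : State}

theorem Env.keep (h : Env n k m W s) {b : ℕ} (hb : 17 ≤ b) (hk : Keep b s t)
    (hw : ∀ a ≤ n * n, t.wt a = s.wt a) : Env n k m W t where
  r0 := (hk 0 (by omega)).trans h.r0
  r1 := (hk 1 (by omega)).trans h.r1
  r2 := (hk 2 (by omega)).trans h.r2
  r3 := (hk 3 (by omega)).trans h.r3
  r4 := (hk 4 (by omega)).trans h.r4
  r5 := (hk 5 (by omega)).trans h.r5
  r6 := (hk 6 (by omega)).trans h.r6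
  r7 := (hk 7 (by omega)).trans h.r7
  r8 := (hk 8 (by omega)).trans h.r8
  r9 := (hk 9 (by omega)).trans h.r9
  r10 := (hk 10 (by omega)).trans h.r10
  r11 := (hk 11 (by omega)).trans h.r11
  r12 := (hk 12 (by omega)).trans h.r12
  r13 := (hk 13 (by omega)).trans h.r13
  r14 := (hk 14 (by omega)).trans h.r14
  r15 := (hk 15 (by omega)).trans h.r15
  r16 := (hk 16 (by omega)).trans h.r16
  weight i hi j hj := by rw [hw _ (pair_lt hi hj).le, h.weight i hi j hj]
  zero := by rw [hw _ le_rfl, h.zero]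

theorem card_filter_range_succ (P : ℕ → Prop) [DecidablePred P] (j : ℕ) :
    #{a ∈ range (j + 1) | P a} = #{a ∈ range j | P a} + if P j then 1 else 0 := by
  rw [range_add_one, filter_insert]
  split_ifs with h
  · rw [card_insert_of_notMem (by simp)]
  · rfl

/-- Put into register `62` the vertex of rank `reg[61]` among the neighbours of `reg[60]`, and `n`
if there is none. -/
def rankProg : Program :=
  .const 64 0 ;; .forLoop 63 60 (.add 64 64 0) ;; .move 62 0 ;;
  .forLoop 63 0 (.add 65 64 63 ;; .const 66 0 ;;
    .forLoop 67 0 (.add 68 64 67 ;;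
      .ite (.wlt 65 68) (.add 66 66 2)
        (.ite (.wlt 68 65) .nop (.ite (.lt 67 63) (.add 66 66 2) .nop))) ;;
    .ite (.lt 66 61) .nop (.ite (.lt 61 66) .nop (.move 62 63)))

theorem rankProg_spec {v p : ℕ} (h : Env n k m W s) (hsv : s.reg 60 = v) (hsp : s.reg 61 = p)
    (hv : v < n)
    (hB : n * 3 + n * (n * 7 + 9) + 6 ≤ B) :
    Tot rankProg s B fun t => Keep 62 s t ∧ t.mem = s.mem ∧ t.wt = s.wt ∧
      t.reg 62 = lastIdx (fun i => rank W n v i = p) n n := by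
  classical
  have h0 := h.r0
  have h2 := h.r2
  have hvn : v * 3 ≤ n * 3 := by omega
  unfold rankProg
  refine .instr_seq (by omega) (.seq (Tot.forLoop (N := v) (T := 3)
    (fun j t => Keep 62 s t ∧ t.mem = s.mem ∧ t.wt = s.wt ∧ t.reg 63 = j ∧ t.reg 64 = j * n)
    ?_ ?_ ?_ le_rfl) (by omega) ?_)
  · simp
  · intro j t ht
    exact ⟨ht.2.2.2.1, (ht.1 60 (by norm_num)).trans hsv⟩
  · intro j hj t ⟨hk, hm, hw, hi, hr⟩
    have k0 := hk 0 (by norm_num)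
    have k2 := hk 2 (by norm_num)
    refine .instr (by omega) ?_
    simp [add_mul, *]
  intro t₁ ⟨hk₁, hm₁, hw₁, hi₁, hr₁⟩
  refine .instr_seq (by omega) ?_
  refine (Tot.forLoop (N := n) (T := n * 7 + 9) (fun j t => Keep 62 s t ∧ t.mem = s.mem ∧
    t.wt = s.wt ∧ t.reg 63 = j ∧ t.reg 64 = v * n ∧
    t.reg 62 = lastIdx (fun i => rank W n v i = p) n j) ?_ ?_ ?_ (by omega)).mono
    le_rfl fun t ht => ⟨ht.1, ht.2.1, ht.2.2.1, ht.2.2.2.2.2⟩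
  · have k0 := hk₁ 0 (by norm_num)
    simp [lastIdx, *]
  · intro j t ht
    exact ⟨ht.2.2.2.1, (ht.1 0 (by norm_num)).trans h0⟩
  · intro u hu t ⟨hk, hm, hw, hi, hvn, hr⟩
    refine .instr_seq (by omega) (.instr_seq (by omega) (.seq (Tot.forLoop (N := n) (T := 7)
      (fun j t' => Keep 62 s t' ∧ t'.mem = s.mem ∧ t'.wt = s.wt ∧ t'.reg 62 = t.reg 62 ∧
        t'.reg 63 = u ∧ t'.reg 64 = v * n ∧ t'.reg 65 = v * n + u ∧ t'.reg 67 = j ∧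
        t'.reg 66 = #{a ∈ range j | Precedes W v a u}) ?_ ?_ ?_ le_rfl) (by omega) ?_))
    · simp [*]
    · intro j t' ht'
      exact ⟨ht'.2.2.2.2.2.2.2.1, (ht'.1 0 (by norm_num)).trans h0⟩
    · intro j hj t' ⟨hk', hm', hw', g62, g63, g64, g65, g67, g66⟩
      have k2 := hk' 2 (by norm_num)
      have w1 := h.weight v hv u hu
      have w2 := h.weight v hv j hj
      refine .instr_seq (by omega) (.ite (by omega) (fun c1 => .instr (by omega) ?_) fun c1 =>
        .ite (by omega) (fun c2 => .nop (by omega) ?_) fun c2 =>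
        .ite (by omega) (fun c3 => .instr (by omega) ?_) fun c3 => .nop (by omega) ?_)
      · have hp : Precedes W v j u := by
          simp [Test.Holds, *] at c1
          exact .inl c1
        simp [card_filter_range_succ, *]
      · have hp : ¬ Precedes W v j u := by
          simp [Test.Holds, *] at c1 c2
          rintro (h | h)
          · exact absurd h (not_lt.2 c1)
          · exact h.1 c2
        simp [card_filter_range_succ, *]
      · have hp : Precedes W v j u := by
          simp [Test.Holds, *] at c1 c2 c3
          exact .inr ⟨not_lt.2 c2, c3⟩
        simp [card_filter_range_succ, *]
      · have hp : ¬ Precedes W v j u := by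
          simp [Test.Holds, *] at c1 c2 c3
          rintro (h | h)
          · exact absurd h (not_lt.2 c1)
          · exact absurd h.2 (not_lt.2 c3)
        simp [card_filter_range_succ, *]
    · intro t' ⟨hk', hm', hw', g62, g63, g64, g65, g67, g66⟩
      have k2 := hk' 2 (by norm_num)
      have k61 := hk' 61 (by norm_num)
      replace g66 : t'.reg 66 = rank W n v u := g66
      refine .ite (by omega) (fun c1 => .nop (by omega) ?_) fun c1 =>
        .ite (by omega) (fun c2 => .nop (by omega) ?_) fun c2 => .instr (by omega) ?_
      · have : rank W n v u ≠ p := by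
          simp [Test.Holds, *] at c1; omega
        simp [lastIdx, *]
      · have : rank W n v u ≠ p := by
          simp [Test.Holds, *] at c2; omega
        simp [lastIdx, *]
      · have : rank W n v u = p := by
          simp [Test.Holds, *] at c1 c2; omega
        simp [lastIdx, *]

end MinKVC

/-! ### Costs, and one step of an exploration -/

namespace MinKVC

open RAM RAM.Program Finset

variable {n k m B : ℕ} {W : ℕ → ℕ → ℝ≥0} {s t : State}

/-- Copy `n` cells from address `reg[50]` to address `reg[51]`. -/
def copyProg : Program :=
  .forLoop 52 0 (.add 53 50 52 ;; .load 54 53 ;; .add 55 51 52 ;; .store 55 54)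

theorem copyProg_spec {src dst : ℕ} {f : ℕ → ℕ} (h0 : s.reg 0 = n) (h2 : s.reg 2 = 1)
    (hs : s.reg 50 = src) (hd : s.reg 51 = dst) (hf : ∀ v < n, s.mem (src + v) = f v)
    (hdisj : src + n ≤ dst ∨ dst + n ≤ src) (hB : n * 6 + 2 ≤ B) :
    Tot copyProg s B fun t => Keep 52 s t ∧ t.wt = s.wt ∧ (∀ v < n, t.mem (dst + v) = f v) ∧
      ∀ a, (a < dst ∨ dst + n ≤ a) → t.mem a = s.mem a := by
  unfold copyProg
  refine (Tot.forLoop (N := n) (T := 6) (fun j t => Keep 52 s t ∧ t.wt = s.wt ∧ t.reg 52 = j ∧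
    (∀ v < j, t.mem (dst + v) = f v) ∧ ∀ a, (a < dst ∨ dst + n ≤ a) → t.mem a = s.mem a)
    ?_ ?_ ?_ hB).mono le_rfl fun t ht => ⟨ht.1, ht.2.1, ht.2.2.2⟩
  · simp
  · intro j t ht
    exact ⟨ht.2.2.1, (ht.1 0 (by norm_num)).trans h0⟩
  · intro j hj t ⟨hk, hw, hi, hc, hm⟩
    have k2 := hk 2 (by norm_num)
    have k50 := hk 50 (by norm_num)
    have k51 := hk 51 (by norm_num)
    have hfj := hf j hj
    have hmj := hm (src + j) (by omega)
    refine .instr_seq (by omega) (.instr_seq (by omega) (.instr_seq (by omega)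
      (.instr (by omega) ?_)))
    refine ⟨by simp [*], by simp [*], by simp [*], fun v hv => ?_, fun a ha => ?_⟩
    · rcases Nat.lt_succ_iff_lt_or_eq.1 hv with h | rfl
      · have : dst + v ≠ dst + j := by omega
        simp [Function.update_apply, *]
        omega
      · simp [*]
    · have : a ≠ dst + j := by omega
      simp [*]

/-- Put into cell `n² + 1` of the weight memory the weight that is covered by the stamped vertices
of the row at address `reg[50]`. -/
def costProg : Program :=
  .wmove 10 9 ;; .const 52 0 ;; .forLoop 51 0 (.add 55 50 51 ;; .load 53 55 ;;
    .forLoop 54 0 (.ite (.lt 54 51) .nop (.add 55 50 54 ;; .load 56 55 ;; .add 56 56 53 ;;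
      .ite (.lt 13 56) (.add 57 52 54 ;; .wadd 10 10 57) .nop)) ;;
    .add 52 52 0)

theorem costProg_spec {f : ℕ → ℕ} (h : Env n k m W s) (hf : ∀ v < n, s.mem (s.reg 50 + v) = f v)
    (hB : n * (n * 9 + 7) + 4 ≤ B) :
    Tot costProg s B fun t => Keep 51 s t ∧ t.mem = s.mem ∧
      (∀ a, a ≠ n * n + 1 → t.wt a = s.wt a) ∧
      t.wt (n * n + 1) = pairCover W n (supp n f) := by
  classical
  have h0 := h.r0
  have h2 := h.r2
  have h9 := h.r9
  have h10 := h.r10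
  have h13 := h.r13
  have hz := h.zero
  set g : ℕ → ℕ → ℝ≥0 := fun i j =>
    if ¬ j < i ∧ (i ∈ supp n f ∨ j ∈ supp n f) then W i j else 0 with hg
  unfold costProg
  refine .instr_seq (by omega) (.instr_seq (by omega) ?_)
  refine (Tot.forLoop (N := n) (T := n * 9 + 7) (fun i t => Keep 51 s t ∧ t.mem = s.mem ∧
    (∀ a, a ≠ n * n + 1 → t.wt a = s.wt a) ∧ t.reg 51 = i ∧ t.reg 52 = i * n ∧
    t.wt (n * n + 1) = ∑ i ∈ range i, ∑ j ∈ range n, g i j) ?_ ?_ ?_ (by omega)).mono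
    le_rfl fun t ht => ⟨ht.1, ht.2.1, ht.2.2.1, ht.2.2.2.2.2⟩
  · refine ⟨by simp, by simp, fun a ha => ?_, by simp, by simp, ?_⟩
    · simp [*]
    · simp [*]
  · intro j t ht
    exact ⟨ht.2.2.2.1, (ht.1 0 (by norm_num)).trans h0⟩
  · intro i hi t ⟨hk, hm, hw, g51, g52, hsum⟩
    have k0 := hk 0 (by norm_num)
    have k2 := hk 2 (by norm_num)
    have k50 := hk 50 (by norm_num)
    have hfi := hf i hi
    refine .instr_seq (by omega) (.instr_seq (by omega) (.seq (Tot.forLoop (N := n) (T := 9)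
      (fun j t' => Keep 51 s t' ∧ t'.mem = s.mem ∧ (∀ a, a ≠ n * n + 1 → t'.wt a = s.wt a) ∧
        t'.reg 51 = i ∧ t'.reg 52 = i * n ∧ t'.reg 53 = f i ∧ t'.reg 54 = j ∧
        t'.wt (n * n + 1) = ∑ i ∈ range i, ∑ j ∈ range n, g i j + ∑ j ∈ range j, g i j)
      ?_ ?_ ?_ le_rfl) (by omega) ?_))
    · refine ⟨by simp [*], by simp [*], fun a ha => ?_, by simp [*], by simp [*], by simp [*],
        by simp, by simp [*]⟩
      simpa using hw a ha
    · intro j t' ht'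
      exact ⟨ht'.2.2.2.2.2.2.1, (ht'.1 0 (by norm_num)).trans h0⟩
    · intro j hj t' ⟨hk', hm', hw', g51, g52, g53, g54, hsum'⟩
      have k2 := hk' 2 (by norm_num)
      have k10 := hk' 10 (by norm_num)
      have k13 := hk' 13 (by norm_num)
      have k50 := hk' 50 (by norm_num)
      have hfj := hf j hj
      have hlt := pair_lt hi hj
      have hwij := (hw' (i * n + j) (by omega)).trans (h.weight i hi j hj)
      refine .ite (by omega) (fun c1 => .nop (by omega) ?_) fun c1 => .instr_seq (by omega)
        (.instr_seq (by omega) (.instr_seq (by omega) (.ite (by omega)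
          (fun c2 => .instr_seq (by omega) (.instr (by omega) ?_))
          fun c2 => .nop (by omega) ?_)))
      · have hgij : g i j = 0 := by
          simp [Test.Holds, *] at c1
          simp [hg, c1]
        refine ⟨by simp [*], by simp [*], fun a ha => ?_, by simp [*], by simp [*], by simp [*],
          by simp [*], by rw [sum_range_succ, hgij, add_zero]; simpa using hsum'⟩
        simpa using hw' a ha
      · have hgij : g i j = W i j := by
          simp only [exec_add, exec_load, Test.Holds] at c1 c2
          simp [g51, g54, k13, h13, k50, hm', hfj, g53] at c1 c2
          simp only [hg, mem_supp]
          rw [if_pos]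
          omega
        refine ⟨by simp [*], by simp [*], fun a ha => ?_, by simp [*], by simp [*], by simp [*],
          by simp [*], ?_⟩
        · have := hw' a ha
          simp [*]
        · have : t'.wt (s.reg 10) = t'.wt (n * n + 1) := by rw [h10]
          rw [sum_range_succ, hgij, ← add_assoc, ← hsum', ← hwij]
          simp [k10, h10, g52, g54]
      · have hgij : g i j = 0 := by
          simp only [exec_add, exec_load, Test.Holds] at c1 c2
          simp [g51, g54, k13, h13, k50, hm', hfj, g53] at c1 c2
          simp [hg, mem_supp, c2]
        refine ⟨by simp [*], by simp [*], fun a ha => ?_, by simp [*], by simp [*], by simp [*],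
          by simp [*], by rw [sum_range_succ, hgij, add_zero]; simpa using hsum'⟩
        simpa using hw' a ha
    · intro t' ⟨hk', hm', hw', g51, g52, g53, g54, hsum'⟩
      have k0 := hk' 0 (by norm_num)
      have k2 := hk' 2 (by norm_num)
      refine .instr (by omega) ⟨by simp [*], by simp [*], fun a ha => ?_, by simp [*],
        by simp [add_mul, *], ?_⟩
      · simpa using hw' a ha
      · rw [sum_range_succ, ← hsum']
        simp

/-- Apply `growRow` to the row `reg[30]`, which is at address `reg[31]`, with the symbol `reg[20]`.
The size, the current stamp and the offset are in the registers `22` to `24`. -/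
def growProg : Program :=
  .add 40 31 30 ;; .load 41 40 ;;
  .ite (.lt 13 41)
    (.move 50 31 ;; .move 51 23 ;; searchProg ;;
      .ite (.lt 52 0)
        (.move 60 52 ;; .add 61 24 20 ;; rankProg ;;
          .ite (.lt 62 0)
            (.add 42 31 62 ;; .load 43 42 ;;
              .ite (.lt 13 43) (.store 40 13) (.add 44 22 2 ;; .store 42 44))
            (.store 40 13))
        (.store 40 13))
    .nop

theorem growProg_spec {f : ℕ → ℕ} {r p : ℕ} (h : Env n k m W s) (hr : r < n) (hsr : s.reg 30 = r)
    (hf : ∀ v < n, s.mem (s.reg 31 + v) = f v) (hp : s.reg 24 + s.reg 20 = p)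
    (hB : n * 10 + n * (n * 7 + 9) + 24 ≤ B) :
    Tot growProg s B fun t => Keep 40 s t ∧ t.wt = s.wt ∧
      (∀ v < n, t.mem (s.reg 31 + v) = growRow W n r p (s.reg 23) (s.reg 22) f v) ∧
      ∀ a, (a < s.reg 31 ∨ s.reg 31 + n ≤ a) → t.mem a = s.mem a := by
  classical
  have h0 := h.r0
  have h2 := h.r2
  have h13 := h.r13
  have hfr := hf r hr
  unfold growProg
  refine .instr_seq (by omega) (.instr_seq (by omega) ?_)
  set s₁ := (Instr.load 41 40).exec ((Instr.add 40 31 30).exec s) with hs₁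
  have e40 : s₁.reg 40 = s.reg 31 + r := by simp [hs₁, hsr]
  have e41 : s₁.reg 41 = f r := by simp [hs₁, hsr, hfr]
  have hk₁ : Keep 40 s s₁ := by simp [hs₁]
  have hm₁ : s₁.mem = s.mem := by simp [hs₁]
  have hw₁ : s₁.wt = s.wt := by simp [hs₁]
  clear_value s₁
  have k13 := hk₁ 13 (by norm_num)
  have k23 := hk₁ 23 (by norm_num)
  have k31 := hk₁ 31 (by norm_num)
  -- Killing the exploration overwrites the stamp of its root.
  have kill : ∀ t B', 1 ≤ B' → Keep 40 s t → t.wt = s.wt → t.mem = s.mem →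
      t.reg 40 = s.reg 31 + r → growRow W n r p (s.reg 23) (s.reg 22) f = Function.update f r 0 →
      Tot (.store 40 13) t B' fun t => Keep 40 s t ∧ t.wt = s.wt ∧
        (∀ v < n, t.mem (s.reg 31 + v) = growRow W n r p (s.reg 23) (s.reg 22) f v) ∧
        ∀ a, (a < s.reg 31 ∨ s.reg 31 + n ≤ a) → t.mem a = s.mem a := by
    intro t B' hB' hk hw hm e40 hg
    have k13 := hk 13 (by norm_num)
    refine .instr hB' ⟨by simp [*], by simp [*], fun v hv => ?_, fun a ha => ?_⟩
    · have := hf v hv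
      rw [hg]
      simp [Function.update_apply, *]
    · have : a ≠ s.reg 31 + r := by omega
      simp [*]
  refine .ite (by omega) (fun c1 => ?_) fun c1 => .nop (by omega) ?_
  · have hfr0 : f r ≠ 0 := by simp [Test.Holds, *] at c1; omega
    refine .instr_seq (by omega) (.instr_seq (by omega) (.seq
      (searchProg_spec (n := n) (f := f) ?_ ?_ ?_ le_rfl) (by omega) ?_))
    · simpa [h0] using hk₁ 0 (by norm_num)
    · simpa [h2] using hk₁ 2 (by norm_num)
    · simpa [hm₁, k31] using hf
    intro s₂ ⟨hk₂, hm₂, hw₂, e52⟩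
    have e40₂ := hk₂ 40 (by norm_num)
    simp at hk₂ hm₂ hw₂ e52 e40₂
    rw [k23] at e52
    rw [e40] at e40₂
    set v := lastIdx (fun i => f i = s.reg 23) n n with hv
    have hK₂ : Keep 40 s s₂ := by
      refine hk₁.trans fun q hq => ?_
      have := hk₂ q (by omega)
      rw [this]
      simp [show q ≠ 50 by omega, show q ≠ 51 by omega]
    have k0 := hK₂ 0 (by norm_num)
    refine .ite (by omega) (fun c2 => ?_) fun c2 =>
      kill _ _ (by omega) hK₂ (by rw [hw₂, hw₁]) (by rw [hm₂, hm₁]) e40₂ ?_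
    · have hvn : v < n := by simpa [Test.Holds, e52, k0, h0] using c2
      have hK : ∀ a ≤ n * n, s₂.wt a = s.wt a := fun a _ => by rw [hw₂, hw₁]
      refine .instr_seq (by omega) (.instr_seq (by omega) (.seq
        (rankProg_spec (n := n) (k := k) (m := m) (W := W) (v := v) (p := p)
          (h.keep (b := 40) (by norm_num) (by simpa using hK₂) (by simpa using hK))
          (by simpa using e52) ?_ hvn le_rfl) (by omega) ?_))
      · have k20 := hK₂ 20 (by norm_num)
        have k24 := hK₂ 24 (by norm_num)
        simp [k20, k24, hp]
      intro s₃ ⟨hk₃, hm₃, hw₃, e62⟩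
      have e40₃ := hk₃ 40 (by norm_num)
      simp at hk₃ hm₃ hw₃ e40₃
      rw [e40₂] at e40₃
      set u := lastIdx (fun i => rank W n v i = p) n n with hu
      have hK₃ : Keep 40 s s₃ := by
        refine hK₂.trans fun q hq => ?_
        rw [hk₃ q (by omega)]
        simp [show q ≠ 60 by omega, show q ≠ 61 by omega]
      have hM₃ : s₃.mem = s.mem := by rw [hm₃, hm₂, hm₁]
      have hW₃ : s₃.wt = s.wt := by rw [hw₃, hw₂, hw₁]
      have k0 := hK₃ 0 (by norm_num)
      have k2 := hK₃ 2 (by norm_num)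
      have k13 := hK₃ 13 (by norm_num)
      have k22 := hK₃ 22 (by norm_num)
      have k31 := hK₃ 31 (by norm_num)
      refine .ite (by omega) (fun c3 => ?_) fun c3 =>
        kill _ _ (by omega) hK₃ hW₃ hM₃ e40₃ ?_
      · have hun : u < n := by simpa [Test.Holds, e62, k0, h0] using c3
        have hfu := hf u hun
        refine .instr_seq (by omega) (.instr_seq (by omega) (.ite (by omega) (fun c4 => ?_)
          fun c4 => .instr_seq (by omega) (.instr (by omega) ?_)))
        · have hfu0 : f u ≠ 0 := by simp [Test.Holds, k13, h13, k31, hM₃, e62, hfu] at c4; omega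
          refine kill _ _ (by omega) (by simpa using hK₃) (by simpa using hW₃) (by simpa using hM₃)
            (by simpa using e40₃) ?_
          unfold growRow
          rw [if_neg hfr0, if_neg fun hc => hfu0 hc.2.2]
        · have hfu0 : f u = 0 := by simp [Test.Holds, k13, h13, k31, hM₃, e62, hfu] at c4; omega
          have hg : growRow W n r p (s.reg 23) (s.reg 22) f
              = Function.update f u (s.reg 22 + 1) := by
            unfold growRow
            rw [if_neg hfr0, if_pos ⟨hvn, hun, hfu0⟩]
          refine ⟨by simp [*], by simp [*], fun v hv => ?_, fun a ha => ?_⟩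
          · have := hf v hv
            rw [hg]
            simp [Function.update_apply, *]
          · have : a ≠ s.reg 31 + u := by omega
            simp [e62, k31, hM₃, this]
      · have hun : ¬ u < n := by simpa [Test.Holds, e62, k0, h0] using c3
        unfold growRow
        rw [if_neg hfr0, if_neg fun hc => hun hc.2.1]
    · have hvn : ¬ v < n := by simpa [Test.Holds, e52, k0, h0] using c2
      unfold growRow
      rw [if_neg hfr0, if_neg fun hc => hvn hc.1]
  · have hfr0 : f r = 0 := by simp [Test.Holds, *] at c1; omega
    have hg : growRow W n r p (s.reg 23) (s.reg 22) f = f := by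
      unfold growRow
      rw [if_pos hfr0]
    exact ⟨hk₁, hw₁, fun v hv => by rw [hm₁, hg, hf v hv], fun a _ => by rw [hm₁]⟩

end MinKVC

/-! ### The operations on all explorations -/

namespace MinKVC

open RAM RAM.Program Finset

variable {n k m B : ℕ} {W : ℕ → ℕ → ℝ≥0} {s t : State}

/-- Run `P` for every row `r`, with `r` in register `30` and the address of the row in register
`31`. -/
def forRows (P : Program) : Program :=
  .move 31 8 ;; .forLoop 30 0 (P ;; .add 31 31 0)

theorem row_le {r j : ℕ} (h : r < j) : r * n + n ≤ j * n := by
  have := Nat.mul_le_mul_right n (Nat.succ_le_of_lt h)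
  rwa [Nat.succ_mul] at this

theorem forRows_spec {P : Program} {T : ℕ} {F G : ℕ → ℕ → ℕ} (h : Env n k m W s)
    (hF : ∀ r < n, ∀ v < n, s.mem (11 * n + r * n + v) = F r v)
    (hP : ∀ r < n, ∀ t, Keep 30 s t → t.wt = s.wt → (∀ a < 11 * n, t.mem a = s.mem a) →
      t.reg 30 = r → t.reg 31 = 11 * n + r * n →
      (∀ v < n, t.mem (11 * n + r * n + v) = F r v) →
      Tot P t (T - 3) fun t' => Keep 32 t t' ∧ t'.wt = t.wt ∧
        (∀ v < n, t'.mem (11 * n + r * n + v) = G r v) ∧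
        ∀ a, (a < 11 * n + r * n ∨ 11 * n + r * n + n ≤ a) → t'.mem a = t.mem a)
    (hB : n * T + 3 ≤ B) (hT : 3 ≤ T) :
    Tot (forRows P) s B fun t => Keep 30 s t ∧ t.wt = s.wt ∧ (∀ a < 11 * n, t.mem a = s.mem a) ∧
      ∀ r < n, ∀ v < n, t.mem (11 * n + r * n + v) = G r v := by
  have h0 := h.r0
  have h2 := h.r2
  have h8 := h.r8
  unfold forRows
  refine .instr_seq (by omega) ?_
  refine (Tot.forLoop (N := n) (T := T) (fun j t => Keep 30 s t ∧ t.wt = s.wt ∧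
    (∀ a < 11 * n, t.mem a = s.mem a) ∧ t.reg 30 = j ∧ t.reg 31 = 11 * n + j * n ∧
    (∀ r < j, ∀ v < n, t.mem (11 * n + r * n + v) = G r v) ∧
    ∀ r < n, j ≤ r → ∀ v < n, t.mem (11 * n + r * n + v) = F r v) ?_ ?_ ?_ (by omega)).mono
    le_rfl fun t ht => ⟨ht.1, ht.2.1, ht.2.2.1, ht.2.2.2.2.2.1⟩
  · refine ⟨by simp, by simp, by simp, by simp, by simp [h8], by simp, fun r hr _ => ?_⟩
    simpa using hF r hr
  · intro j t ht
    exact ⟨ht.2.2.2.1, (ht.1 0 (by norm_num)).trans h0⟩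
  · intro j hj t ⟨hk, hw, hm, g30, g31, hG, hF'⟩
    refine .seq (hP j hj t hk hw hm g30 g31 (hF' j hj le_rfl)) (by omega) ?_
    intro t' ⟨hk', hw', hG', hm'⟩
    have k0 := (hk' 0 (by norm_num)).trans (hk 0 (by norm_num))
    have k2 := (hk' 2 (by norm_num)).trans (hk 2 (by norm_num))
    have k30 := hk' 30 (by norm_num)
    have k31 := hk' 31 (by norm_num)
    have hK := hk.trans (hk'.mono (show 30 ≤ 32 by norm_num))
    refine .instr (by omega) ⟨by simpa using hK, by simp [*], fun a ha => ?_, by simp [*],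
      ?_, fun r hr v hv => ?_, fun r hr hjr v hv => ?_⟩
    · have := hm' a (by omega)
      simp [*]
    · simp [add_mul, *]
      omega
    · simp only [exec_add, State.set_mem]
      rcases Nat.lt_succ_iff_lt_or_eq.1 hr with hlt | rfl
      · have := row_le (n := n) hlt
        rw [hm' _ (by omega), hG r hlt v hv]
      · exact hG' v hv
    · simp only [exec_add, State.set_mem]
      have := row_le (n := n) (show j < r by omega)
      rw [hm' _ (by omega), hF' r hr (by omega) v hv]

/-- The registers and the memory represent the state of the decoder. -/
structure Rep (n : ℕ) (σ : Config) (s : State) : Prop where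
  count : s.reg 21 = σ.count
  size : s.reg 22 = σ.size
  cur : s.reg 23 = σ.cur
  off : s.reg 24 = σ.off
  mark : s.reg 25 = σ.mark
  chosen : ∀ v < n, s.mem (n + v) = σ.chosen v
  rows : ∀ r < n, ∀ v < n, s.mem (11 * n + r * n + v) = σ.rows r v

/-- `Config.start`, with `count` in register `21` and the interval of roots in registers `26` and
`27`. -/
def startProg : Program :=
  .add 22 21 2 ;; .move 23 22 ;; .const 24 0 ;; .const 25 0 ;;
  forRows (.move 50 6 ;; .move 51 31 ;; copyProg ;; .add 40 31 30 ;; .load 41 40 ;; .store 40 13 ;;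
    .ite (.lt 30 26) .nop (.ite (.lt 30 27) (.ite (.lt 13 41) .nop (.store 40 22)) .nop))

theorem startProg_spec {f : ℕ → ℕ} {c lo hi : ℕ} (h : Env n k m W s) (hc : s.reg 21 = c)
    (hlo : s.reg 26 = lo) (hhi : s.reg 27 = hi) (hf : ∀ v < n, s.mem (n + v) = f v)
    (hB : n * (n * 6 + 14) + 7 ≤ B) :
    Tot startProg s B fun t => Keep 22 s t ∧ t.wt = s.wt ∧ (∀ a < 11 * n, t.mem a = s.mem a) ∧
      Rep n (Config.start f c lo hi) t := by
  classical
  have h2 := h.r2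
  unfold startProg
  refine .instr_seq (by omega) (.instr_seq (by omega) (.instr_seq (by omega)
    (.instr_seq (by omega) ?_)))
  set s₁ := (Instr.const 25 0).exec ((Instr.const 24 0).exec ((Instr.move 23 22).exec
    ((Instr.add 22 21 2).exec s))) with hs₁
  have e21 : s₁.reg 21 = c := by simp [hs₁, hc]
  have e22 : s₁.reg 22 = c + 1 := by simp [hs₁, hc, h2]
  have e23 : s₁.reg 23 = c + 1 := by simp [hs₁, hc, h2]
  have e24 : s₁.reg 24 = 0 := by simp [hs₁]
  have e25 : s₁.reg 25 = 0 := by simp [hs₁]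
  have e26 : s₁.reg 26 = lo := by simp [hs₁, hlo]
  have e27 : s₁.reg 27 = hi := by simp [hs₁, hhi]
  have hk₁ : Keep 22 s s₁ := by simp [hs₁]
  have hm₁ : s₁.mem = s.mem := by simp [hs₁]
  have hw₁ : s₁.wt = s.wt := by simp [hs₁]
  clear_value s₁
  have henv : Env n k m W s₁ := h.keep (by norm_num) hk₁ (fun a _ => by rw [hw₁])
  refine (forRows_spec (T := n * 6 + 14) (F := fun r v => s₁.mem (11 * n + r * n + v))
    (G := (Config.start f c lo hi).rows) henv (fun _ _ _ _ => rfl) ?_ (by omega) (by omega)).mono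
    le_rfl ?_
  · intro r hr t hk hw hm g30 g31 _
    have k0 := (hk 0 (by norm_num)).trans henv.r0
    have k2 := (hk 2 (by norm_num)).trans henv.r2
    have k6 := (hk 6 (by norm_num)).trans henv.r6
    refine .instr_seq (by omega) (.instr_seq (by omega) (.seq (copyProg_spec (n := n) (f := f)
      (src := n) (dst := 11 * n + r * n) (by simpa using k0) (by simpa using k2) (by simpa using k6)
      (by simpa using g31) ?_ (by omega) le_rfl) (by omega) ?_))
    · intro v hv
      have := hm (n + v) (by omega)
      simp [*]
    intro t₁ ⟨hk₂, hw₂, hc₂, hm₂⟩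
    simp at hk₂ hw₂ hm₂
    have hK : Keep 32 t t₁ := by
      intro q hq
      rw [hk₂ q (by omega)]
      simp [show q ≠ 50 by omega, show q ≠ 51 by omega]
    have g13 := (hK 13 (by norm_num)).trans ((hk 13 (by norm_num)).trans henv.r13)
    have g22 := (hK 22 (by norm_num)).trans ((hk 22 (by norm_num)).trans e22)
    have g26 := (hK 26 (by norm_num)).trans ((hk 26 (by norm_num)).trans e26)
    have g27 := (hK 27 (by norm_num)).trans ((hk 27 (by norm_num)).trans e27)
    have g30' := (hK 30 (by norm_num)).trans g30
    have g31' := (hK 31 (by norm_num)).trans g31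
    have hcr := hc₂ r hr
    have hdead : ¬ (lo ≤ r ∧ r < hi ∧ f r = 0) →
        (Config.start f c lo hi).rows r = Function.update f r 0 := fun hc => if_neg hc
    refine .instr_seq (by omega) (.instr_seq (by omega) (.instr_seq (by omega) (.ite (by omega)
      (fun c1 => .nop (by omega) ?_) fun c1 => .ite (by omega)
        (fun c2 => .ite (by omega) (fun c3 => .nop (by omega) ?_) fun c3 => .instr (by omega) ?_)
        fun c2 => .nop (by omega) ?_)))
    · simp [Test.Holds, g30', g26] at c1
      refine ⟨by simpa using hK, by simp [*], fun v hv => ?_, fun a ha => ?_⟩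
      · have := hc₂ v hv
        rw [hdead (by omega)]
        simp [Function.update_apply, *]
      · have h1 : a ≠ 11 * n + r * n + r := by omega
        have := hm₂ a (by omega)
        simp [*]
    · simp [Test.Holds, g13, g30', g31', hcr] at c3
      refine ⟨by simpa using hK, by simp [*], fun v hv => ?_, fun a ha => ?_⟩
      · have := hc₂ v hv
        rw [hdead (by omega)]
        simp [Function.update_apply, *]
      · have h1 : a ≠ 11 * n + r * n + r := by omega
        have := hm₂ a (by omega)
        simp [*]
    · simp [Test.Holds, g26, g27, g13, g30', g31', hcr] at c1 c2 c3
      have hlive : (Config.start f c lo hi).rows r = Function.update f r (c + 1) :=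
        if_pos ⟨c1, c2, c3⟩
      refine ⟨by simpa using hK, by simp [*], fun v hv => ?_, fun a ha => ?_⟩
      · have := hc₂ v hv
        rw [hlive]
        simp [Function.update_apply, *]
        split_ifs <;> rfl
      · have h1 : a ≠ 11 * n + r * n + r := by omega
        have := hm₂ a (by omega)
        simp [*]
    · simp [Test.Holds, g30', g27] at c2
      refine ⟨by simpa using hK, by simp [*], fun v hv => ?_, fun a ha => ?_⟩
      · have := hc₂ v hv
        rw [hdead (by omega)]
        simp [Function.update_apply, *]
      · have h1 : a ≠ 11 * n + r * n + r := by omega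
        have := hm₂ a (by omega)
        simp [*]
  · intro t ⟨hk, hw, hm, hG⟩
    refine ⟨hk₁.trans (hk.mono (by norm_num)), hw.trans hw₁, fun a ha => by rw [hm a ha, hm₁],
      ⟨(hk 21 (by norm_num)).trans e21, (hk 22 (by norm_num)).trans e22,
      (hk 23 (by norm_num)).trans e23, (hk 24 (by norm_num)).trans e24,
      (hk 25 (by norm_num)).trans e25, fun v hv => ?_, hG⟩⟩
    rw [hm _ (by omega), hm₁, hf v hv]
    rfl

/-- `Config.best`: put the best row into register `33` and its address into register `34`. -/
def bestProg : Program :=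
  .move 33 0 ;; forRows (.add 40 31 30 ;; .load 41 40 ;;
    .ite (.lt 13 41)
      (.move 50 31 ;; costProg ;;
        .ite (.lt 33 0)
          (.ite (.wlt 10 11) (.wmove 11 10 ;; .move 33 30 ;; .move 34 31) .nop)
          (.wmove 11 10 ;; .move 33 30 ;; .move 34 31))
      .nop)

theorem bestProg_spec {F : ℕ → ℕ → ℕ} (h : Env n k m W s)
    (hF : ∀ r < n, ∀ v < n, s.mem (11 * n + r * n + v) = F r v)
    (hB : n * (n * (n * 9 + 7) + 16) + 4 ≤ B) :
    Tot bestProg s B fun t => Keep 30 s t ∧ t.mem = s.mem ∧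
      (∀ a, a ≠ n * n + 1 → a ≠ n * n + 2 → t.wt a = s.wt a) ∧
      t.reg 33 = bestIdx (fun r => F r r ≠ 0) (fun r => pairCover W n (supp n (F r))) n n ∧
      (t.reg 33 < n → t.reg 34 = 11 * n + t.reg 33 * n) := by
  classical
  have h0 := h.r0
  have h2 := h.r2
  have h8 := h.r8
  have h10 := h.r10
  have h11 := h.r11
  have h13 := h.r13
  set alive : ℕ → Prop := fun r => F r r ≠ 0 with halive
  set cost : ℕ → ℝ≥0 := fun r => pairCover W n (supp n (F r)) with hcost
  unfold bestProg forRows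
  refine .instr_seq (by omega) (.instr_seq (by omega) ?_)
  refine (Tot.forLoop (N := n) (T := n * (n * 9 + 7) + 16) (fun j t => Keep 30 s t ∧
    t.mem = s.mem ∧ (∀ a, a ≠ n * n + 1 → a ≠ n * n + 2 → t.wt a = s.wt a) ∧ t.reg 30 = j ∧
    t.reg 31 = 11 * n + j * n ∧ t.reg 33 = bestIdx alive cost n j ∧
    (t.reg 33 < n → t.reg 34 = 11 * n + t.reg 33 * n ∧ t.wt (n * n + 2) = cost (t.reg 33)))
    ?_ ?_ ?_ (by omega)).mono le_rfl fun t ht =>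
      ⟨ht.1, ht.2.1, ht.2.2.1, ht.2.2.2.2.2.1, fun hlt => (ht.2.2.2.2.2.2 hlt).1⟩
  · simp [bestIdx, h0, h8]
  · intro j t ht
    exact ⟨ht.2.2.2.1, (ht.1 0 (by norm_num)).trans h0⟩
  · intro j hj t ⟨hk, hm, hw, g30, g31, g33, hbest⟩
    have k0 := (hk 0 (by norm_num)).trans h0
    have k2 := (hk 2 (by norm_num)).trans h2
    have k13 := (hk 13 (by norm_num)).trans h13
    have hFj := hF j hj j hj
    refine .seq (B₁ := n * (n * 9 + 7) + 13) (Q := fun t' => Keep 30 s t' ∧ t'.mem = s.mem ∧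
      (∀ a, a ≠ n * n + 1 → a ≠ n * n + 2 → t'.wt a = s.wt a) ∧ t'.reg 30 = j ∧
      t'.reg 31 = 11 * n + j * n ∧ t'.reg 33 = bestIdx alive cost n (j + 1) ∧
      (t'.reg 33 < n → t'.reg 34 = 11 * n + t'.reg 33 * n ∧ t'.wt (n * n + 2) = cost (t'.reg 33)))
      ?_ (by omega) ?_
    · refine .instr_seq (by omega) (.instr_seq (by omega) (.ite (by omega) (fun c1 => ?_)
        fun c1 => .nop (by omega) ?_))
      · have hal : alive j := by
          simp [Test.Holds, g30, g31, hm, hFj, k13] at c1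
          simp only [halive]; omega
        refine .instr_seq (by omega) (.seq (costProg_spec (n := n) (k := k) (m := m) (W := W)
          (f := F j) (h.keep (b := 30) (by norm_num) (by simpa using hk) ?_) ?_ le_rfl)
          (by omega) ?_)
        · intro a ha
          simpa using hw a (by omega) (by omega)
        · intro v hv
          have := hF j hj v hv
          simpa [g31, hm] using this
        intro t₁ ⟨hk₁, hm₁, hw₁, hc₁⟩
        replace hc₁ : t₁.wt (n * n + 1) = cost j := hc₁
        simp at hm₁ hw₁
        have hK : Keep 40 t t₁ := by
          intro q hq
          rw [hk₁ q (by omega)]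
          simp [show q ≠ 50 by omega, show q ≠ 40 by omega, show q ≠ 41 by omega]
        have hK30 : Keep 30 s t₁ := hk.trans (hK.mono (by norm_num))
        have l0 := (hK 0 (by norm_num)).trans k0
        have l10 := (hK30 10 (by norm_num)).trans h10
        have l11 := (hK30 11 (by norm_num)).trans h11
        have l30 := (hK 30 (by norm_num)).trans g30
        have l31 := (hK 31 (by norm_num)).trans g31
        have l33 := (hK 33 (by norm_num)).trans g33
        have l34 := hK 34 (by norm_num)
        have hM₁ : t₁.mem = s.mem := hm₁.trans hm
        have hW₁ : ∀ a, a ≠ n * n + 1 → a ≠ n * n + 2 → t₁.wt a = s.wt a := fun a ha ha' => by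
          rw [hw₁ a ha, hw a ha ha']
        have take : ∀ B', 3 ≤ B' → bestIdx alive cost n (j + 1) = j →
            Tot (.wmove 11 10 ;; .move 33 30 ;; .move 34 31) t₁ B' fun t' => Keep 30 s t' ∧
              t'.mem = s.mem ∧ (∀ a, a ≠ n * n + 1 → a ≠ n * n + 2 → t'.wt a = s.wt a) ∧
              t'.reg 30 = j ∧ t'.reg 31 = 11 * n + j * n ∧
              t'.reg 33 = bestIdx alive cost n (j + 1) ∧ (t'.reg 33 < n →
                t'.reg 34 = 11 * n + t'.reg 33 * n ∧ t'.wt (n * n + 2) = cost (t'.reg 33)) := by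
          intro B' hB' hj'
          refine .instr_seq (by omega) (.instr_seq (by omega) (.instr (by omega) ?_))
          refine ⟨by simpa using hK30, by simpa using hM₁, fun a ha ha' => ?_, by simp [l30],
            by simp [l31], by simp [l30, hj'], fun _ => ⟨by simp [l30, l31], ?_⟩⟩
          · simpa [l11, ha'] using hW₁ a ha ha'
          · simp [l10, l11, l30, hc₁]
        rw [g33] at hbest
        refine .ite (by omega) (fun c2 => .ite (by omega)
          (fun c3 => take _ (by omega) ?_) fun c3 => .nop (by omega) ?_)
          fun c2 => take _ (by omega) ?_
        · simp [Test.Holds, l0, l33] at c2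
          have hb2 := (hbest c2).2
          rw [← hw₁ _ (by omega)] at hb2
          simp [Test.Holds, l10, l11, hc₁, hb2] at c3
          simp only [bestIdx]
          rw [if_pos ⟨hal, .inr c3⟩]
        · simp [Test.Holds, l0, l33] at c2
          have hb := hbest c2
          have hb2 := hb.2
          rw [← hw₁ _ (by omega)] at hb2
          simp [Test.Holds, l10, l11, hc₁, hb2] at c3
          have hj' : bestIdx alive cost n (j + 1) = bestIdx alive cost n j := by
            conv_lhs => unfold bestIdx
            rw [if_neg]
            rintro ⟨_, h' | h'⟩
            · omega
            · exact absurd h' (not_lt.2 c3)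
          exact ⟨hK30, hM₁, hW₁, l30, l31, l33.trans hj'.symm,
            fun _ => by rw [l33, l34]; exact ⟨hb.1, hb2⟩⟩
        · simp [Test.Holds, l0, l33] at c2
          have hb : bestIdx alive cost n j = n := by
            rcases bestIdx_spec (alive := alive) (cost := cost) j hj.le with h' | h'
            · exact h'.1
            · omega
          simp only [bestIdx]
          rw [if_pos ⟨hal, .inl hb⟩]
      · have hal : ¬ alive j := by
          simp [Test.Holds, g30, g31, hm, hFj, k13] at c1
          simp only [halive]; omega
        have hj' : bestIdx alive cost n (j + 1) = bestIdx alive cost n j := by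
          conv_lhs => unfold bestIdx
          rw [if_neg fun h' => hal h'.1]
        refine ⟨by simpa using hk, by simpa using hm, by simpa using hw, by simpa using g30,
          by simpa using g31, by simpa [hj'] using g33, by simpa using hbest⟩
    · intro t' ⟨hk', hm', hw', g30', g31', g33', hbest'⟩
      have l0 := (hk' 0 (by norm_num)).trans h0
      have l2 := (hk' 2 (by norm_num)).trans h2
      refine .instr (by omega) ⟨by simpa using hk', by simpa using hm', by simpa using hw',
        by simp [g30', l2], by simp [g31', l0, add_mul, add_assoc], by simpa using g33',
        by simpa using hbest'⟩

end MinKVC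

/-! ### The decoder as a program -/

namespace MinKVC

open RAM RAM.Program Finset

variable {n k m B : ℕ} {W : ℕ → ℕ → ℝ≥0} {s t : State}

/-- What a step of the decoder leaves unchanged: the registers below `21`, the input and the cost of
the best solution, the best solution and the string of symbols. -/
structure Stable (n : ℕ) (s t : State) : Prop where
  reg : Keep 21 s t
  wt : ∀ a, a ≠ n * n + 1 → a ≠ n * n + 2 → t.wt a = s.wt a
  mem : ∀ a, (a < n ∨ (2 * n ≤ a ∧ a < 11 * n)) → t.mem a = s.mem a

theorem Stable.trans {u : State} (h : Stable n s t) (h' : Stable n t u) : Stable n s u where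
  reg := h.reg.trans h'.reg
  wt a ha ha' := (h'.wt a ha ha').trans (h.wt a ha ha')
  mem a ha := (h'.mem a ha).trans (h.mem a ha)

theorem Rep.set {σ : Config} (h : Rep n σ s) {i x : ℕ} (hi : i < 21 ∨ 25 < i) :
    Rep n σ (s.set i x) := by
  refine ⟨?_, ?_, ?_, ?_, ?_, h.chosen, h.rows⟩ <;> rw [State.set_reg, if_neg (by omega)]
  exacts [h.count, h.size, h.cur, h.off, h.mark]

/-- `Config.finish`. -/
def finishProg : Program :=
  bestProg ;;
  .ite (.lt 33 0)
    (.ite (.lt 13 25)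
      (.move 50 34 ;; .add 51 21 25 ;; searchProg ;; .move 26 52 ;; .add 27 52 2 ;; startProg)
      (.move 50 34 ;; .move 51 6 ;; copyProg ;; .move 21 22 ;; .move 26 13 ;; .move 27 0 ;;
        startProg))
    .nop

theorem finishProg_spec {σ : Config} (h : Env n k m W s) (hσ : Rep n σ s)
    (hB : n * (n * (n * 9 + 7) + 16) + n * (n * 6 + 14) + n * 7 + 21 ≤ B) :
    Tot finishProg s B fun t => Stable n s t ∧ Rep n (σ.finish n (pairCover W n)) t := by
  classical
  unfold finishProg
  refine .seq (bestProg_spec h hσ.rows le_rfl) (by omega) ?_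
  intro t ⟨hk, hm, hw, g33, g34⟩
  change _ = σ.best n (pairCover W n) at g33
  have henv : Env n k m W t := h.keep (by norm_num) hk fun a ha => hw a (by omega) (by omega)
  have k21 := (hk 21 (by norm_num)).trans hσ.count
  have k22 := (hk 22 (by norm_num)).trans hσ.size
  have k25 := (hk 25 (by norm_num)).trans hσ.mark
  have hstable : Stable n s t := ⟨hk.mono (by norm_num), hw, fun a _ => by rw [hm]⟩
  set p := σ.best n (pairCover W n) with hp
  rw [g33] at g34
  refine .ite (by omega) (fun c1 => ?_) fun c1 => .nop (by omega) ?_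
  · have hpn : p < n := by simpa [Test.Holds, g33, henv.r0] using c1
    replace g34 := g34 hpn
    have hrow : ∀ v < n, t.mem (11 * n + p * n + v) = σ.rows p v := fun v hv => by
      rw [hm]; exact hσ.rows p hpn v hv
    refine .ite (by omega) (fun c2 => ?_) fun c2 => ?_
    · have hmark : σ.mark ≠ 0 := by
        simp [Test.Holds, k25, henv.r13] at c2; omega
      have hfin : σ.finish n (pairCover W n) = Config.start σ.chosen σ.count
          (lastIdx (fun i => σ.rows p i = σ.count + σ.mark) n n)
          (lastIdx (fun i => σ.rows p i = σ.count + σ.mark) n n + 1) := by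
        unfold Config.finish
        rw [if_pos hpn, if_neg hmark]
      refine .instr_seq (by omega) (.instr_seq (by omega) (.seq (searchProg_spec (n := n)
        (f := σ.rows p) (by simpa using henv.r0) (by simpa using henv.r2) ?_ le_rfl)
        (by omega) ?_))
      · simpa [g34] using hrow
      intro t₁ ⟨hk₁, hm₁, hw₁, e52⟩
      simp [k21, k25] at hm₁ hw₁ e52
      have hK : Keep 50 t t₁ := by
        intro q hq
        rw [hk₁ q (by omega)]
        simp [show q ≠ 50 by omega, show q ≠ 51 by omega]
      have l2 := (hK 2 (by norm_num)).trans henv.r2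
      refine .instr_seq (by omega) (.instr_seq (by omega) ?_)
      refine (startProg_spec (n := n) (k := k) (m := m) (W := W) (f := σ.chosen) (c := σ.count)
        (lo := lastIdx (fun i => σ.rows p i = σ.count + σ.mark) n n)
        (hi := lastIdx (fun i => σ.rows p i = σ.count + σ.mark) n n + 1)
        (henv.keep (b := 26) (by norm_num) ?_ ?_) ?_ ?_ ?_ ?_ ?_).mono le_rfl ?_
      · simpa using hK.mono (show 26 ≤ 50 by norm_num)
      · simp [hw₁]
      · simpa using (hK 21 (by norm_num)).trans k21
      · simp [e52]
      · simp [e52, l2]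
      · intro v hv
        have := hσ.chosen v hv
        simp [hm₁, hm, this]
      · omega
      · intro u ⟨hk₂, hw₂, hm₂, hrep⟩
        refine ⟨hstable.trans ⟨?_, ?_, ?_⟩, by rw [hfin]; exact hrep⟩
        · refine (hK.mono (show 21 ≤ 50 by norm_num)).trans ?_
          simpa using hk₂.mono (show 21 ≤ 22 by norm_num)
        · intro a _ _
          simp [hw₂, hw₁]
        · intro a ha
          have := hm₂ a (by omega)
          simpa [hm₁] using this
    · have hmark : σ.mark = 0 := by
        simp [Test.Holds, k25, henv.r13] at c2; omega
      have hfin : σ.finish n (pairCover W n) = Config.start (σ.rows p) σ.size 0 n := by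
        unfold Config.finish
        rw [if_pos hpn, if_pos hmark]
      refine .instr_seq (by omega) (.instr_seq (by omega) (.seq (copyProg_spec (n := n)
        (f := σ.rows p) (src := 11 * n + p * n) (dst := n) (by simpa using henv.r0)
        (by simpa using henv.r2) (by simpa using g34) (by simpa using henv.r6) ?_ (by omega) le_rfl)
        (by omega) ?_))
      · simpa using hrow
      intro t₁ ⟨hk₁, hw₁, hc₁, hm₁⟩
      simp at hm₁ hw₁
      have hK : Keep 50 t t₁ := by
        intro q hq
        rw [hk₁ q (by omega)]
        simp [show q ≠ 50 by omega, show q ≠ 51 by omega]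
      have l0 := (hK 0 (by norm_num)).trans henv.r0
      have l13 := (hK 13 (by norm_num)).trans henv.r13
      refine .instr_seq (by omega) (.instr_seq (by omega) (.instr_seq (by omega) ?_))
      refine (startProg_spec (n := n) (k := k) (m := m) (W := W) (f := σ.rows p) (c := σ.size)
        (lo := 0) (hi := n)
        (henv.keep (b := 21) (by norm_num) ?_ ?_) ?_ ?_ ?_ ?_ ?_).mono le_rfl ?_
      · simpa using hK.mono (show 21 ≤ 50 by norm_num)
      · simp [hw₁]
      · simpa using (hK 22 (by norm_num)).trans k22
      · simp [l13]
      · simp [l0]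
      · simpa using hc₁
      · omega
      · intro u ⟨hk₂, hw₂, hm₂, hrep⟩
        refine ⟨hstable.trans ⟨?_, ?_, ?_⟩, by rw [hfin]; exact hrep⟩
        · refine (hK.mono (show 21 ≤ 50 by norm_num)).trans ?_
          simpa using hk₂.mono (show 21 ≤ 22 by norm_num)
        · intro a _ _
          simp [hw₂, hw₁]
        · intro a ha
          have h1 := hm₂ a (by omega)
          have h2 := hm₁ a (by omega)
          simpa [h2] using h1
  · have hpn : ¬ p < n := by simpa [Test.Holds, g33, henv.r0] using c1
    have hfin : σ.finish n (pairCover W n) = σ := by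
      unfold Config.finish
      rw [if_neg hpn]
    rw [hfin]
    exact ⟨hstable, k21, k22, (hk 23 (by norm_num)).trans hσ.cur,
      (hk 24 (by norm_num)).trans hσ.off, k25, by rw [hm]; exact hσ.chosen,
      by rw [hm]; exact hσ.rows⟩

/-- `Config.step`, with the symbol in register `20`. -/
def stepProg : Program :=
  .ite (.lt 20 3) (forRows growProg ;; .add 22 22 2)
    (.ite (.lt 20 14) (.add 24 24 3)
      (.ite (.lt 20 15) (.add 23 23 2 ;; .const 24 0)
        (.ite (.lt 20 16) (.add 25 25 2) finishProg)))

theorem stepProg_spec {σ : Config} {x : ℕ} (h : Env n k m W s) (hσ : Rep n σ s)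
    (hx : s.reg 20 = x)
    (hB : n * (n * 10 + n * (n * 7 + 9) + 27) + n * (n * (n * 9 + 7) + 16) + n * (n * 6 + 14)
      + n * 7 + 25 ≤ B) :
    Tot stepProg s B fun t => Stable n s t ∧ Rep n (σ.step W n m (pairCover W n) x) t := by
  have h2 := h.r2
  have h3 := h.r3
  have h14 := h.r14
  have h15 := h.r15
  have h16 := h.r16
  have hsize := hσ.size
  have hcur := hσ.cur
  have hoff := hσ.off
  have hmark := hσ.mark
  unfold stepProg Config.step
  refine .ite (by omega) (fun c1 => ?_) fun c1 => .ite (by omega) (fun c2 => ?_) fun c2 =>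
    .ite (by omega) (fun c3 => ?_) fun c3 => .ite (by omega) (fun c4 => ?_) fun c4 => ?_
  · simp [Test.Holds, hx, h3] at c1
    rw [if_pos c1]
    refine .seq (forRows_spec (T := n * 10 + n * (n * 7 + 9) + 27) h hσ.rows
      (G := fun r => growRow W n r (σ.off + x) σ.cur σ.size (σ.rows r)) ?_ le_rfl (by omega))
      (by omega) ?_
    · intro r hr t hk hw _ g30 g31 hrow
      have k20 := (hk 20 (by norm_num)).trans hx
      have k22 := (hk 22 (by norm_num)).trans hsize
      have k23 := (hk 23 (by norm_num)).trans hcur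
      have k24 := (hk 24 (by norm_num)).trans hoff
      refine (growProg_spec (n := n) (k := k) (m := m) (W := W) (f := σ.rows r) (r := r)
        (p := σ.off + x) (h.keep (by norm_num) hk fun a _ => by rw [hw]) hr g30
        (by rw [g31]; exact hrow) (by rw [k20, k24]) (by omega)).mono le_rfl ?_
      intro t' ⟨hk', hw', hg, hm⟩
      rw [g31, k22, k23] at hg
      rw [g31] at hm
      exact ⟨hk'.mono (by norm_num), hw', hg, hm⟩
    · intro t ⟨hk, hw, hm, hG⟩
      have k2 := (hk 2 (by norm_num)).trans h2
      have k21 := (hk 21 (by norm_num)).trans hσ.count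
      have k22 := (hk 22 (by norm_num)).trans hsize
      have k23 := (hk 23 (by norm_num)).trans hcur
      have k24 := (hk 24 (by norm_num)).trans hoff
      have k25 := (hk 25 (by norm_num)).trans hmark
      refine .instr (by omega) ⟨⟨?_, by simp [hw], fun a ha => ?_⟩, by simp [*], by simp [*],
        by simp [*], by simp [*], by simp [*], fun v hv => ?_, by simpa using hG⟩
      · simpa using hk.mono (show 21 ≤ 30 by norm_num)
      · simpa using hm a (by omega)
      · have := hσ.chosen v hv
        simpa [this] using hm (n + v) (by omega)
  · simp [Test.Holds, hx, h3, h14] at c1 c2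
    rw [if_neg (by omega), if_pos (by omega)]
    exact .instr (by omega) ⟨⟨by simp, by simp, by simp⟩, by simpa using hσ.count,
      by simp [*], by simp [*], by simp [*], by simp [*], hσ.chosen, hσ.rows⟩
  · simp [Test.Holds, hx, h3, h14, h15] at c1 c2 c3
    rw [if_neg (by omega), if_neg (by omega), if_pos (by omega)]
    exact .instr_seq (by omega) (.instr (by omega) ⟨⟨by simp, by simp, by simp⟩,
      by simpa using hσ.count, by simp [*], by simp [*], by simp [*], by simp [*], hσ.chosen,
      hσ.rows⟩)
  · simp [Test.Holds, hx, h3, h14, h15, h16] at c1 c2 c3 c4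
    rw [if_neg (by omega), if_neg (by omega), if_neg (by omega), if_pos (by omega)]
    exact .instr (by omega) ⟨⟨by simp, by simp, by simp⟩, by simpa using hσ.count,
      by simp [*], by simp [*], by simp [*], by simp [*], hσ.chosen, hσ.rows⟩
  · simp [Test.Holds, hx, h3, h14, h15, h16] at c1 c2 c3 c4
    rw [if_neg (by omega), if_neg (by omega), if_neg (by omega), if_neg (by omega)]
    exact finishProg_spec h hσ (by omega)

/-- `decode`, for the string of symbols in the integer memory. -/
def decodeProg : Program :=
  .forLoop 30 0 (.add 31 6 30 ;; .store 31 13) ;; .const 21 0 ;; .const 26 0 ;; .move 27 0 ;;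
  startProg ;; .forLoop 19 5 (.add 28 7 19 ;; .load 20 28 ;; stepProg)

/-- A time bound for `stepProg`, with the overhead of a loop. -/
def stepTime (n : ℕ) : ℕ :=
  n * (n * 10 + n * (n * 7 + 9) + 27) + n * (n * (n * 9 + 7) + 16) + n * (n * 6 + 14) + n * 7 + 29

theorem decodeProg_spec {D : ℕ → ℕ} (hkn : k ≤ n) (h : Env n k m W s)
    (hD : ∀ p < 9 * k, s.mem (2 * n + p) = D p)
    (hB : 9 * k * stepTime n + n * (n * 6 + 14) + n * 4 + 14 ≤ B) :
    Tot decodeProg s B fun t => Keep 19 s t ∧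
      (∀ a, a ≠ n * n + 1 → a ≠ n * n + 2 → t.wt a = s.wt a) ∧
      (∀ a, (a < n ∨ (2 * n ≤ a ∧ a < 11 * n)) → t.mem a = s.mem a) ∧
      ∀ v < n, t.mem (n + v)
        = (decode W n m (pairCover W n) ((List.range (9 * k)).map D)).chosen v := by
  have h0 := h.r0
  have h2 := h.r2
  have h6 := h.r6
  have h13 := h.r13
  unfold decodeProg
  refine .seq (Tot.forLoop (N := n) (T := 4) (fun j t => Keep 30 s t ∧ t.wt = s.wt ∧
    t.reg 30 = j ∧ (∀ v < j, t.mem (n + v) = 0) ∧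
    ∀ a, (a < n ∨ 2 * n ≤ a) → t.mem a = s.mem a) ?_ ?_ ?_ le_rfl) (by omega) ?_
  · simp
  · intro j t ht
    exact ⟨ht.2.2.1, (ht.1 0 (by norm_num)).trans h0⟩
  · intro j hj t ⟨hk, hw, g30, hz, hm⟩
    have k2 := (hk 2 (by norm_num)).trans h2
    have k6 := (hk 6 (by norm_num)).trans h6
    have k13 := (hk 13 (by norm_num)).trans h13
    refine .instr_seq (by omega) (.instr (by omega) ⟨by simpa using hk, by simp [*], by simp [*],
      fun v hv => ?_, fun a ha => ?_⟩)
    · rcases Nat.lt_succ_iff_lt_or_eq.1 hv with hlt | rfl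
      · have := hz v hlt
        simp [Function.update_apply, *]
      · simp [*]
    · have h1 : a ≠ n + j := by omega
      have := hm a ha
      simp [*]
  intro t ⟨hk, hw, _, hz, hm⟩
  have k0 := (hk 0 (by norm_num)).trans h0
  refine .instr_seq (by omega) (.instr_seq (by omega) (.instr_seq (by omega) (.seq
    (startProg_spec (n := n) (k := k) (m := m) (W := W) (f := fun _ => 0) (c := 0) (lo := 0)
      (hi := n) (h.keep (b := 19) (by norm_num) ?_ ?_) ?_ ?_ ?_ ?_ le_rfl) (by omega) ?_)))
  · simpa using hk.mono (show 19 ≤ 30 by norm_num)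
  · simp [hw]
  · simp
  · simp
  · simp [k0]
  · simpa using hz
  intro t₁ ⟨hk₁, hw₁, hm₁, hrep₁⟩
  simp at hw₁ hm₁
  have hK₁ : Keep 19 s t₁ := by
    refine (hk.mono (show 19 ≤ 30 by norm_num)).trans ?_
    simpa using hk₁.mono (show 19 ≤ 22 by norm_num)
  have hM₁ : ∀ a, (a < n ∨ (2 * n ≤ a ∧ a < 11 * n)) → t₁.mem a = s.mem a := fun a ha => by
    rw [hm₁ a (by omega), hm a (by omega)]
  refine (Tot.forLoop (N := 9 * k) (T := stepTime n) (fun j t => Keep 19 s t ∧ t.reg 19 = j ∧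
    (∀ a, a ≠ n * n + 1 → a ≠ n * n + 2 → t.wt a = s.wt a) ∧
    (∀ a, (a < n ∨ (2 * n ≤ a ∧ a < 11 * n)) → t.mem a = s.mem a) ∧
    Rep n (decode W n m (pairCover W n) ((List.range j).map D)) t) ?_ ?_ ?_ (by omega)
    (by unfold stepTime; omega)).mono
    le_rfl fun t ht => ⟨ht.1, ht.2.2.1, ht.2.2.2.1, ht.2.2.2.2.chosen⟩
  · refine ⟨by simpa using hK₁, by simp, fun a _ _ => by simp [hw₁, hw], by simpa using hM₁, ?_⟩
    exact hrep₁.set (by norm_num)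
  · intro j t ht
    exact ⟨ht.2.1, (ht.1 5 (by norm_num)).trans h.r5⟩
  · intro j hj t ⟨hk', g19, hw', hm', hrep⟩
    have k7 := (hk' 7 (by norm_num)).trans h.r7
    have hDj : t.mem (2 * n + j) = D j := by rw [hm' _ (by omega), hD j hj]
    refine .instr_seq (by unfold stepTime; omega) (.instr_seq (by unfold stepTime; omega) ?_)
    refine (stepProg_spec (n := n) (k := k) (m := m) (W := W) (x := D j)
      (σ := decode W n m (pairCover W n) ((List.range j).map D))
      (h.keep (b := 19) (by norm_num) (by simpa using hk') ?_) ?_ ?_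
      (by unfold stepTime; omega)).mono le_rfl ?_
    · intro a ha
      simpa using hw' a (by omega) (by omega)
    · exact (hrep.set (by norm_num)).set (by norm_num)
    · simp [k7, g19, hDj]
    · intro u ⟨hst, hrep'⟩
      have u19 := hst.reg 19 (by norm_num)
      have u2 := hst.reg 2 (by norm_num)
      have t2 := (hk' 2 (by norm_num)).trans h2
      simp [g19, t2] at u19 u2
      refine ⟨?_, by simp [u19, u2], fun a ha ha' => ?_, fun a ha => ?_, ?_⟩
      · rw [keep_set (by norm_num)]
        refine hk'.trans ?_
        simpa using hst.reg.mono (show 19 ≤ 21 by norm_num)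
      · have := hst.wt a ha ha'
        simpa [hw' a ha ha'] using this
      · have := hst.mem a ha
        simpa [hm' a ha] using this
      · have hdec : decode W n m (pairCover W n) ((List.range (j + 1)).map D)
            = (decode W n m (pairCover W n) ((List.range j).map D)).step W n m (pairCover W n)
              (D j) := by
          simp [decode, List.range_succ]
        rw [hdec]
        exact hrep'.set (by norm_num)

end MinKVC

/-! ### Recording the best set, and counting through the strings -/

namespace MinKVC

open RAM RAM.Program Finset

variable {n k m B : ℕ} {W : ℕ → ℕ → ℝ≥0} {s t : State}

/-- Put the number of chosen vertices into register `30`. -/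
def countProg : Program :=
  .const 30 0 ;; .forLoop 31 0 (.add 32 6 31 ;; .load 33 32 ;;
    .ite (.lt 13 33) (.add 30 30 2) .nop)

theorem countProg_spec {f : ℕ → ℕ} (h : Env n k m W s) (hf : ∀ v < n, s.mem (n + v) = f v)
    (hB : n * 6 + 3 ≤ B) :
    Tot countProg s B fun t => Keep 30 s t ∧ t.mem = s.mem ∧ t.wt = s.wt ∧
      t.reg 30 = #(supp n f) := by
  unfold countProg
  refine .instr_seq (by omega) ?_
  refine (Tot.forLoop (N := n) (T := 6) (fun j t => Keep 30 s t ∧ t.mem = s.mem ∧ t.wt = s.wt ∧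
    t.reg 31 = j ∧ t.reg 30 = #(supp j f)) ?_ ?_ ?_ (by omega)).mono
    le_rfl fun t ht => ⟨ht.1, ht.2.1, ht.2.2.1, ht.2.2.2.2⟩
  · simp [supp]
  · intro j t ht
    exact ⟨ht.2.2.2.1, (ht.1 0 (by norm_num)).trans h.r0⟩
  · intro j hj t ⟨hk, hm, hw, g31, g30⟩
    have k2 := (hk 2 (by norm_num)).trans h.r2
    have k6 := (hk 6 (by norm_num)).trans h.r6
    have k13 := (hk 13 (by norm_num)).trans h.r13
    have hfj := hf j hj
    refine .instr_seq (by omega) (.instr_seq (by omega) (.ite (by omega)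
      (fun c1 => .instr (by omega) ?_) fun c1 => .nop (by omega) ?_))
    · have hfj0 : f j ≠ 0 := by
        simp [Test.Holds, k6, k13, g31, hm, hfj] at c1; omega
      simp only [supp] at g30 ⊢
      simp [card_filter_range_succ, *]
    · have hfj0 : f j = 0 := by
        simp [Test.Holds, k6, k13, g31, hm, hfj] at c1; omega
      simp only [supp] at g30 ⊢
      simp [card_filter_range_succ, *]

/-- The memory holds the best set of `k` vertices among the candidates `f i`, `i < j`; register `17`
tells whether there has been one. -/
def BestOf (n k : ℕ) (W : ℕ → ℕ → ℝ≥0) (f : ℕ → ℕ → ℕ) (j : ℕ) (s : State) : Prop :=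
  (s.reg 17 = 0 ∧ ∀ i < j, #(supp n (f i)) ≠ k) ∨
  (s.reg 17 = 1 ∧ #(supp n s.mem) = k ∧ s.wt (n * n + 3) = pairCover W n (supp n s.mem) ∧
    ∀ i < j, #(supp n (f i)) = k → s.wt (n * n + 3) ≤ pairCover W n (supp n (f i)))

theorem supp_congr {f g : ℕ → ℕ} (h : ∀ v < n, f v = g v) : supp n f = supp n g := by
  ext v
  rw [mem_supp, mem_supp]
  exact and_congr_right fun hv => by rw [h v hv]

/-- Replace the best solution by the chosen vertices, if these are `k` vertices of smaller cost. -/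
def recordProg : Program :=
  countProg ;;
  .ite (.lt 30 1) .nop (.ite (.lt 1 30) .nop (.move 50 6 ;; costProg ;;
    .ite (.lt 13 17)
      (.ite (.wlt 10 12)
        (.wmove 12 10 ;; .move 50 6 ;; .move 51 13 ;; copyProg ;; .const 17 1) .nop)
      (.wmove 12 10 ;; .move 50 6 ;; .move 51 13 ;; copyProg ;; .const 17 1)))

theorem recordProg_spec {f : ℕ → ℕ → ℕ} {j : ℕ} (h : Env n k m W s)
    (hf : ∀ v < n, s.mem (n + v) = f j v) (hbest : BestOf n k W f j s)
    (hB : n * (n * 9 + 7) + n * 12 + 18 ≤ B) :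
    Tot recordProg s B fun t => Keep 17 s t ∧ (∀ a ≤ n * n, t.wt a = s.wt a) ∧
      (∀ a, n ≤ a → t.mem a = s.mem a) ∧ BestOf n k W f (j + 1) t := by
  unfold recordProg
  refine .seq (countProg_spec h hf le_rfl) (by omega) ?_
  intro t ⟨hk, hm, hw, g30⟩
  have henv : Env n k m W t := h.keep (by norm_num) hk fun a _ => by rw [hw]
  have k17 := hk 17 (by norm_num)
  have skip : ∀ B', 1 ≤ B' → #(supp n (f j)) ≠ k → Tot .nop t B' fun t => Keep 17 s t ∧
      (∀ a ≤ n * n, t.wt a = s.wt a) ∧ (∀ a, n ≤ a → t.mem a = s.mem a) ∧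
      BestOf n k W f (j + 1) t := by
    intro B' hB' hne
    refine .nop hB' ⟨hk.mono (by norm_num), fun a _ => by rw [hw], fun a _ => by rw [hm], ?_⟩
    unfold BestOf at hbest ⊢
    rw [k17, hm, hw]
    refine hbest.imp (fun h' => ⟨h'.1, fun i hi => ?_⟩) fun h' =>
      ⟨h'.1, h'.2.1, h'.2.2.1, fun i hi hik => ?_⟩
    · rcases Nat.lt_succ_iff_lt_or_eq.1 hi with hlt | rfl
      · exact h'.2 i hlt
      · exact hne
    · rcases Nat.lt_succ_iff_lt_or_eq.1 hi with hlt | rfl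
      · exact h'.2.2.2 i hlt hik
      · exact absurd hik hne
  refine .ite (by omega) (fun c1 => skip _ (by omega) ?_) fun c1 =>
    .ite (by omega) (fun c2 => skip _ (by omega) ?_) fun c2 => ?_
  · simp [Test.Holds, g30, henv.r1] at c1; omega
  · simp [Test.Holds, g30, henv.r1] at c2; omega
  simp [Test.Holds, g30, henv.r1] at c1 c2
  have hcard : #(supp n (f j)) = k := by omega
  refine .instr_seq (by omega) (.seq (costProg_spec (n := n) (k := k) (m := m) (W := W)
    (f := f j) (henv.keep (b := 17) (by norm_num) (by simp) (by simp)) ?_ le_rfl) (by omega) ?_)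
  · simpa [henv.r6, hm] using hf
  intro t₁ ⟨hk₁, hm₁, hw₁, hcost⟩
  simp [hm, hw] at hm₁ hw₁
  have hK : Keep 30 s t₁ := by
    refine hk.trans fun q hq => ?_
    rw [hk₁ q (by omega)]
    simp [show q ≠ 50 by omega]
  have k0 := (hK 0 (by norm_num)).trans h.r0
  have k2 := (hK 2 (by norm_num)).trans h.r2
  have k6 := (hK 6 (by norm_num)).trans h.r6
  have k10 := (hK 10 (by norm_num)).trans h.r10
  have k12 := (hK 12 (by norm_num)).trans h.r12
  have k13 := (hK 13 (by norm_num)).trans h.r13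
  have k17 := hK 17 (by norm_num)
  have save : ∀ B', n * 6 + 6 ≤ B' →
      (∀ i < j, #(supp n (f i)) = k →
        pairCover W n (supp n (f j)) ≤ pairCover W n (supp n (f i))) →
      Tot (.wmove 12 10 ;; .move 50 6 ;; .move 51 13 ;; copyProg ;; .const 17 1) t₁ B' fun t =>
        Keep 17 s t ∧ (∀ a ≤ n * n, t.wt a = s.wt a) ∧ (∀ a, n ≤ a → t.mem a = s.mem a) ∧
        BestOf n k W f (j + 1) t := by
    intro B' hB' hmin
    refine .instr_seq (by omega) (.instr_seq (by omega) (.instr_seq (by omega) (.seq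
      (copyProg_spec (n := n) (src := n) (dst := 0) (f := f j) ?_ ?_ ?_ ?_ ?_ (by omega) le_rfl)
      (by omega) ?_)))
    · simpa using k0
    · simpa using k2
    · simpa using k6
    · simpa using k13
    · simpa [hm₁] using hf
    intro t₂ ⟨hk₂, hw₂, hc₂, hm₂⟩
    simp [k10, k12] at hw₂ hc₂ hm₂
    refine .instr (by omega) ⟨?_, fun a ha => ?_, fun a ha => ?_, .inr ⟨by simp, ?_, ?_, ?_⟩⟩
    · simp only [exec_const, keep_set (le_refl 17)]
      refine (hK.mono (show 17 ≤ 30 by norm_num)).trans ?_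
      simpa using hk₂.mono (show 17 ≤ 52 by norm_num)
    · have := hw₁ a (by omega)
      simp [hw₂, show a ≠ n * n + 3 by omega, this]
    · simp [hm₂ a ha, hm₁]
    · simp only [exec_const, State.set_mem]
      rw [supp_congr hc₂, hcard]
    · simp only [exec_const, State.set_mem, State.set_wt]
      rw [supp_congr hc₂]
      simp [hw₂, hcost]
    · intro i hi hik
      have e : t₂.wt (n * n + 3) = pairCover W n (supp n (f j)) := by simp [hw₂, hcost]
      simp only [exec_const, State.set_wt, e]
      rcases Nat.lt_succ_iff_lt_or_eq.1 hi with hlt | rfl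
      · exact hmin i hlt hik
      · exact le_rfl
  refine .ite (by omega) (fun c3 => .ite (by omega) (fun c4 => save _ (by omega) ?_)
    fun c4 => .nop (by omega) ?_) fun c3 => save _ (by omega) ?_
  all_goals
    rcases hbest with ⟨hb1, hb2⟩ | ⟨hb1, hb2, hb3, hb4⟩
  · simp [Test.Holds, k13, k17, hb1] at c3
  · simp [Test.Holds, k10, k12, hcost, hw₁ (n * n + 3) (by omega)] at c4
    exact fun i hi hik => c4.le.trans (hb4 i hi hik)
  · simp [Test.Holds, k13, k17, hb1] at c3
  · simp [Test.Holds, k10, k12, hcost, hw₁ (n * n + 3) (by omega)] at c4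
    refine ⟨hK.mono (by norm_num), fun a ha => hw₁ a (by omega), fun a _ => by rw [hm₁],
      .inr ⟨k17.trans hb1, by rw [hm₁, hb2], by rw [hm₁, hw₁ _ (by omega), hb3], ?_⟩⟩
    intro i hi hik
    rw [hw₁ _ (by omega)]
    rcases Nat.lt_succ_iff_lt_or_eq.1 hi with hlt | rfl
    · exact hb4 i hlt hik
    · exact c4
  · exact fun i hi hik => absurd hik (hb2 i hi)
  · simp [Test.Holds, k13, k17, hb1] at c3

/-- Pass to the next string of symbols, in the order of the numbers whose digits they are. Register
`18` is set after the last string. -/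
def nextProg : Program :=
  .const 30 1 ;; .forLoop 31 5 (.add 32 7 31 ;;
    .ite (.lt 13 30)
      (.load 33 32 ;; .add 33 33 2 ;;
        .ite (.lt 33 4) (.store 32 33 ;; .const 30 0) (.store 32 13))
      .nop) ;;
  .move 18 30

theorem pow_succ_dvd_iff {b j x : ℕ} :
    b ^ (j + 1) ∣ x ↔ b ^ j ∣ x ∧ b ∣ x / b ^ j := by
  rw [pow_succ]
  constructor
  · intro h
    exact ⟨(dvd_mul_right _ _).trans h, Nat.dvd_div_of_mul_dvd h⟩
  · rintro ⟨h1, h2⟩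
    exact Nat.mul_dvd_of_dvd_div h1 h2

open Classical in
theorem nextProg_spec {j : ℕ} (h : Env n k m W s)
    (hD : ∀ p < 9 * k, s.mem (2 * n + p) = j / (m + 4) ^ p % (m + 4)) (hB : 9 * k * 9 + 4 ≤ B) :
    Tot nextProg s B fun t => Keep 18 s t ∧ t.wt = s.wt ∧
      (∀ a, (a < 2 * n ∨ 2 * n + 9 * k ≤ a) → t.mem a = s.mem a) ∧
      (∀ p < 9 * k, t.mem (2 * n + p) = (j + 1) / (m + 4) ^ p % (m + 4)) ∧
      t.reg 18 = if (m + 4) ^ (9 * k) ∣ j + 1 then 1 else 0 := by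
  unfold nextProg
  refine .instr_seq (by omega) (.seq (Tot.forLoop (N := 9 * k) (T := 9) (fun q t => Keep 18 s t ∧
    t.wt = s.wt ∧ t.reg 31 = q ∧ (∀ a, (a < 2 * n ∨ 2 * n + 9 * k ≤ a) → t.mem a = s.mem a) ∧
    (∀ p < q, t.mem (2 * n + p) = (j + 1) / (m + 4) ^ p % (m + 4)) ∧
    (∀ p < 9 * k, q ≤ p → t.mem (2 * n + p) = j / (m + 4) ^ p % (m + 4)) ∧
    t.reg 30 = if (m + 4) ^ q ∣ j + 1 then 1 else 0) ?_ ?_ ?_ le_rfl) (by omega) ?_)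
  · simpa using hD
  · intro q t ht
    exact ⟨ht.2.2.1, (ht.1 5 (by norm_num)).trans h.r5⟩
  · intro q hq t ⟨hk, hw, g31, hm, hnew, hold, g30⟩
    have k2 := (hk 2 (by norm_num)).trans h.r2
    have k4 := (hk 4 (by norm_num)).trans h.r4
    have k7 := (hk 7 (by norm_num)).trans h.r7
    have k13 := (hk 13 (by norm_num)).trans h.r13
    have hq' := hold q hq le_rfl
    have hdiv := Nat.succ_div (a := j) (b := (m + 4) ^ q)
    have hdvd := pow_succ_dvd_iff (b := m + 4) (j := q) (x := j + 1)
    set d := j / (m + 4) ^ q % (m + 4) with hd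
    have hdlt : d < m + 4 := Nat.mod_lt _ (by omega)
    have hmod : (j / (m + 4) ^ q + 1) % (m + 4) = if d + 1 < m + 4 then d + 1 else 0 := by
      rw [Nat.add_mod, ← hd, Nat.mod_eq_of_lt (show 1 < m + 4 by omega)]
      split_ifs with hc
      · exact Nat.mod_eq_of_lt hc
      · rw [show d + 1 = m + 4 by omega, Nat.mod_self]
    -- The cell `q` and the carry are updated, the other cells are as before.
    have close : ∀ t' : State, Keep 18 s t' → t'.wt = s.wt → t'.reg 31 = q → t'.reg 2 = 1 →
        (∀ a, a ≠ 2 * n + q → t'.mem a = t.mem a) →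
        t'.mem (2 * n + q) = (j + 1) / (m + 4) ^ q % (m + 4) →
        t'.reg 30 = (if (m + 4) ^ (q + 1) ∣ j + 1 then 1 else 0) →
        Keep 18 s (t'.set 31 (t'.reg 31 + t'.reg 2)) ∧
        (t'.set 31 (t'.reg 31 + t'.reg 2)).wt = s.wt ∧
        (t'.set 31 (t'.reg 31 + t'.reg 2)).reg 31 = q + 1 ∧
        (∀ a, (a < 2 * n ∨ 2 * n + 9 * k ≤ a) →
          (t'.set 31 (t'.reg 31 + t'.reg 2)).mem a = s.mem a) ∧
        (∀ p < q + 1, (t'.set 31 (t'.reg 31 + t'.reg 2)).mem (2 * n + p)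
          = (j + 1) / (m + 4) ^ p % (m + 4)) ∧
        (∀ p < 9 * k, q + 1 ≤ p → (t'.set 31 (t'.reg 31 + t'.reg 2)).mem (2 * n + p)
          = j / (m + 4) ^ p % (m + 4)) ∧
        (t'.set 31 (t'.reg 31 + t'.reg 2)).reg 30
          = if (m + 4) ^ (q + 1) ∣ j + 1 then 1 else 0 := by
      intro t' hk' hw' e31 e2 hother hcell hcarry
      refine ⟨by simpa using hk', hw', by simp [e31, e2], fun a ha => ?_, fun p hp => ?_,
        fun p hp hqp => ?_, by simpa using hcarry⟩
      · rw [State.set_mem, hother a (by omega), hm a ha]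
      · rcases Nat.lt_succ_iff_lt_or_eq.1 hp with hlt | rfl
        · rw [State.set_mem, hother _ (by omega), hnew p hlt]
        · exact hcell
      · rw [State.set_mem, hother _ (by omega), hold p hp (by omega)]
    refine .instr_seq (by omega) (.ite (by omega) (fun c1 => ?_) fun c1 => ?_)
    · simp [Test.Holds, k13, g30] at c1
      replace c1 : (m + 4) ^ q ∣ j + 1 := by
        by_contra hc
        rw [if_neg hc] at c1
        exact lt_irrefl 0 c1
      rw [if_pos c1] at hdiv
      refine .instr_seq (by omega) (.instr_seq (by omega) (.ite (by omega)
        (fun c2 => .instr_seq (by omega) (.instr (by omega) (close _ ?_ ?_ ?_ ?_ ?_ ?_ ?_)))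
        fun c2 => .instr (by omega) (close _ ?_ ?_ ?_ ?_ ?_ ?_ ?_)))
      all_goals simp [Test.Holds, k7, g31, k2, k4, hq'] at c2
      · simpa using hk
      · simpa using hw
      · simpa using g31
      · simpa using k2
      · intro a ha
        simp [k7, g31, ha]
      · rw [hdiv, hmod, if_pos (show d + 1 < m + 4 by omega)]
        simp [k7, g31, hq', k2]
      · have : ¬ (m + 4) ^ (q + 1) ∣ j + 1 := by
          rw [hdvd, hdiv]
          rintro ⟨_, h2⟩
          rw [Nat.dvd_iff_mod_eq_zero, hmod, if_pos (by omega)] at h2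
          omega
        simp [this]
      · simpa using hk
      · simpa using hw
      · simpa using g31
      · simpa using k2
      · intro a ha
        simp [k7, g31, ha]
      · rw [hdiv, hmod, if_neg (show ¬ d + 1 < m + 4 by omega)]
        simp [k7, g31, k13]
      · have : (m + 4) ^ (q + 1) ∣ j + 1 := by
          rw [hdvd, hdiv]
          exact ⟨c1, by rw [Nat.dvd_iff_mod_eq_zero, hmod, if_neg (by omega)]⟩
        simp [this, g30, c1]
    · simp [Test.Holds, k13, g30] at c1
      rw [if_neg c1, add_zero] at hdiv
      refine .nop (by omega) (close _ ?_ ?_ ?_ ?_ ?_ ?_ ?_)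
      · simpa using hk
      · simpa using hw
      · simpa using g31
      · simpa using k2
      · simp
      · rw [hdiv]; simpa using hq'
      · have : ¬ (m + 4) ^ (q + 1) ∣ j + 1 := fun h' => c1 (hdvd.1 h').1
        simp [this, g30, c1]
  · intro t ⟨hk, hw, _, hm, hnew, _, g30⟩
    exact .instr (by omega) ⟨by simpa using hk, by simpa using hw, by simpa using hm,
      by simpa using hnew, by simpa using g30⟩

end MinKVC

/-! ### The algorithm -/

namespace MinKVC

open RAM RAM.Program Finset

variable {n k m B : ℕ} {s t : State}

/-- Fill the registers with fixed contents. Register `9` receives `n²` by `n` additions. -/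
def setupProg (m : ℕ) : Program :=
  .const 2 1 ;; .const 3 m ;; .const 4 (m + 4) ;;
  .add 5 1 1 ;; .add 5 5 5 ;; .add 5 5 5 ;; .add 5 5 1 ;;
  .move 6 0 ;; .add 7 0 0 ;; .add 8 7 7 ;; .add 8 8 8 ;; .add 8 8 7 ;; .add 8 8 0 ;;
  .const 14 (m + 1) ;; .const 15 (m + 2) ;; .const 16 (m + 3) ;;
  .const 9 0 ;; .forLoop 30 0 (.add 9 9 0) ;; .add 10 9 2 ;; .add 11 10 2 ;; .add 12 11 2

theorem setupProg_spec (w : Sym2 (Fin n) → ℝ≥0) (hB : n * 3 + 22 ≤ B) :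
    Tot (setupProg m) (inputState w k) B fun t => Env n k m (edgeWeight w) t ∧
      (∀ a, t.mem a = 0) ∧ t.reg 17 = 0 ∧ t.reg 18 = 0 := by
  unfold setupProg
  iterate 17 refine .instr_seq (by omega) ?_
  refine .seq (Tot.forLoop (N := n) (T := 3) (fun j t => t.reg 30 = j ∧ t.reg 9 = j * n ∧
    t.mem = (inputState w k).mem ∧ t.wt = (inputState w k).wt ∧ ∀ i < 30, i ≠ 9 → t.reg i =
      [n, k, 1, m, m + 4, 9 * k, n, 2 * n, 11 * n, 0, 0, 0, 0, 0, m + 1, m + 2, m + 3].getD i 0)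
    ?_ ?_ ?_ le_rfl) (by omega) ?_
  · refine ⟨by simp, by simp, rfl, rfl, fun i hi h9 => ?_⟩
    interval_cases i <;> simp [inputState] <;> omega
  · intro j t ⟨h1, _, _, _, h2⟩
    refine ⟨h1, ?_⟩
    simp [h2 0 (by norm_num) (by norm_num)]
  · intro j hj t ⟨h1, h2, h3, h4, h5⟩
    have k0 := h5 0 (by norm_num) (by norm_num)
    have k2 := h5 2 (by norm_num) (by norm_num)
    simp at k0 k2
    refine .instr (by omega) ⟨by simp [h1, k2], by simp [h2, k0, add_mul], by simpa using h3,
      by simpa using h4, fun i hi h9 => ?_⟩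
    rw [← h5 i hi h9]
    simp [h9, show i ≠ 30 by omega]
  · intro t ⟨h1, h2, h3, h4, h5⟩
    have k2 := h5 2 (by norm_num) (by norm_num)
    simp at k2
    refine .instr_seq (by omega) (.instr_seq (by omega) (.instr (by omega) ⟨?_, ?_, ?_, ?_⟩))
    · constructor
      case weight =>
        intro i hi j hj
        have e1 : (i * n + j) / n = i := by
          rw [mul_comm, Nat.mul_add_div (by omega), Nat.div_eq_of_lt hj, add_zero]
        have e2 : (i * n + j) % n = j := by
          rw [mul_comm, Nat.mul_add_mod, Nat.mod_eq_of_lt hj]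
        simp [h4, inputState, edgeWeight, e1, e2]
      case zero =>
        rcases Nat.eq_zero_or_pos n with h0 | hpos
        · simp [h4, inputState, h0]
        · simp [h4, inputState, hpos]
      all_goals
        simp [h2, k2]
        try simp [h5]
    · simp [h3, inputState]
    · simpa using h5 17 (by norm_num) (by norm_num)
    · simpa using h5 18 (by norm_num) (by norm_num)

/-- Decode all strings of length `9 k` over `m + 4` symbols, and return the best result. -/
def mainProg (m : ℕ) : Program :=
  setupProg m ;; .loop (.lt 18 2) (decodeProg ;; recordProg ;; nextProg)

/-- A time bound for one iteration of the loop of `mainProg`. -/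
def iterTime (n : ℕ) : ℕ :=
  9 * n * stepTime n + n * (n * 6 + 14) + n * (n * 9 + 7) + n * 97 + 37

/-- The vertices chosen by the string whose symbols are the lowest `9 k` digits of `j`. -/
noncomputable def chosenBy (n k m : ℕ) (W : ℕ → ℕ → ℝ≥0) (j : ℕ) : ℕ → ℕ :=
  (decode W n m (pairCover W n)
    ((List.range (9 * k)).map fun p => j / (m + 4) ^ p % (m + 4))).chosen

theorem BestOf.congr {W : ℕ → ℕ → ℝ≥0} {f : ℕ → ℕ → ℕ} {j : ℕ} (h : BestOf n k W f j s)
    (h17 : t.reg 17 = s.reg 17) (hm : ∀ v < n, t.mem v = s.mem v)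
    (hw : t.wt (n * n + 3) = s.wt (n * n + 3)) : BestOf n k W f j t := by
  unfold BestOf
  rwa [h17, hw, supp_congr hm]

theorem mainProg_spec (hkn : k ≤ n) (w : Sym2 (Fin n) → ℝ≥0)
    (hB : (m + 4) ^ (9 * k) * (iterTime n + 1) + n * 3 + 23 ≤ B) :
    Tot (mainProg m) (inputState w k) B
      (BestOf n k (edgeWeight w) (chosenBy n k m (edgeWeight w)) ((m + 4) ^ (9 * k))) := by
  classical
  set W := edgeWeight w
  set N := (m + 4) ^ (9 * k) with hN
  have hNpos : 0 < N := by positivity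
  unfold mainProg
  refine .seq (setupProg_spec w le_rfl) (by omega) ?_
  intro s ⟨henv, hmem, h17, h18⟩
  refine (Tot.loop (N := N) (T := iterTime n) (fun j t => Env n k m W t ∧
    (∀ p < 9 * k, t.mem (2 * n + p) = j / (m + 4) ^ p % (m + 4)) ∧
    t.reg 18 = (if j < N then 0 else 1) ∧ BestOf n k W (chosenBy n k m W) j t) ?_ ?_ ?_
    (by omega)).mono le_rfl fun t ht => ht.2.2.2
  · exact ⟨henv, fun p _ => by simp [hmem], by simp [h18, hNpos], .inl ⟨h17, by simp⟩⟩
  · intro t ⟨henv, _, h18, _⟩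
    simp [Test.Holds, henv.r2, h18]
  intro j hj t ⟨henv, hD, h18, hbest⟩
  refine ⟨by simp [Test.Holds, henv.r2, h18, hj], ?_⟩
  have hmul : 9 * k * stepTime n ≤ 9 * n * stepTime n := by gcongr
  refine .seq (decodeProg_spec hkn henv hD le_rfl) (by unfold iterTime; omega) ?_
  intro t₁ ⟨hk₁, hw₁, hm₁, hc₁⟩
  have henv₁ : Env n k m W t₁ :=
    henv.keep (by norm_num) hk₁ fun a ha => hw₁ a (by omega) (by omega)
  have hbest₁ : BestOf n k W (chosenBy n k m W) j t₁ :=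
    hbest.congr (hk₁ 17 (by norm_num)) (fun v hv => hm₁ v (.inl hv)) (hw₁ _ (by omega) (by omega))
  refine .seq (recordProg_spec henv₁ hc₁ hbest₁ le_rfl) (by unfold iterTime; omega) ?_
  intro t₂ ⟨hk₂, hw₂, hm₂, hbest₂⟩
  have hD₂ : ∀ p < 9 * k, t₂.mem (2 * n + p) = j / (m + 4) ^ p % (m + 4) := fun p hp => by
    rw [hm₂ _ (by omega), hm₁ _ (.inr (by omega)), hD p hp]
  refine (nextProg_spec (henv₁.keep le_rfl hk₂ hw₂) hD₂ le_rfl).mono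
    (by unfold iterTime; omega) ?_
  intro t₃ ⟨hk₃, hw₃, hm₃, hD₃, h18₃⟩
  refine ⟨(henv₁.keep le_rfl hk₂ hw₂).keep (by norm_num) hk₃ fun a _ => by rw [hw₃], hD₃, ?_,
    hbest₂.congr (hk₃ 17 (by norm_num)) (fun v hv => hm₃ v (.inl (by omega))) (by rw [hw₃])⟩
  rw [h18₃]
  -- As `j + 1 ≤ N`, it is a multiple of `N` only if it is `N`.
  have : N ∣ j + 1 ↔ ¬ j + 1 < N :=
    ⟨fun h => not_lt.2 (Nat.le_of_dvd (by omega) h), fun h => by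
      rw [show j + 1 = N by omega]⟩
  by_cases h : j + 1 < N <;> simp [← hN, this, h]

/-- A list of digits is recovered from the number that it represents. -/
theorem map_digit_ofDigits {b : ℕ} (a : List ℕ) (ha : ∀ x ∈ a, x < b) :
    ((List.range a.length).map fun p => Nat.ofDigits b a / b ^ p % b) = a := by
  induction a with
  | nil => rfl
  | cons x a ih =>
    have hx := ha x (by simp)
    have hb : 0 < b := by omega
    rw [List.length_cons, List.range_succ_eq_map, List.map_cons, List.map_map]
    congr 1
    · simp [Nat.ofDigits_cons, Nat.add_mul_mod_self_left, Nat.mod_eq_of_lt hx]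
    · refine Eq.trans (List.map_congr_left fun p _ => ?_) (ih fun y hy => ha y (by simp [hy]))
      simp only [Function.comp, Nat.succ_eq_add_one, pow_succ']
      rw [← Nat.div_div_eq_div_mul, Nat.ofDigits_cons, Nat.add_mul_div_left _ _ hb,
        Nat.div_eq_of_lt hx, zero_add]

/-- Some string yields a near-optimal set. -/
theorem exists_chosenBy (w : Sym2 (Fin n) → ℝ≥0) (hm : 0 < m) (S : Finset (Fin n)) :
    ∃ j < (m + 4) ^ (9 * #S), #(supp n (chosenBy n #S m (edgeWeight w) j)) = #S ∧
      m * pairCover (edgeWeight w) n (supp n (chosenBy n #S m (edgeWeight w) j))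
        ≤ (m + 2) * coverWeight w S := by
  obtain ⟨a, h1, h2, f, c, h3, h4, h5⟩ := exists_decode w hm S
  -- Further symbols `m` do not change the chosen vertices.
  set a' := a ++ List.replicate (9 * #S - a.length) m with ha'
  have hlen : a'.length = 9 * #S := by simp [ha', h1]
  have hlt : ∀ x ∈ a', x < m + 4 := by
    intro x hx
    rcases List.mem_append.1 hx with h | h
    · exact h2 x h
    · rw [List.eq_of_mem_replicate h]; omega
  have hchosen : chosenBy n #S m (edgeWeight w) (Nat.ofDigits (m + 4) a') = f := by
    unfold chosenBy
    rw [← hlen, map_digit_ofDigits a' hlt, ha', decode, List.foldl_append, ← decode, h3]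
    refine (foldl_step_walk _ (fun x hx => ?_) _).2.1
    rw [List.eq_of_mem_replicate hx]; omega
  refine ⟨Nat.ofDigits (m + 4) a', ?_, ?_, ?_⟩
  · rw [← hlen]
    exact Nat.ofDigits_lt_base_pow_length (by omega) hlt
  · rw [hchosen, h4]
  · rw [hchosen]; exact h5

theorem mainProg_approx (hkn : k ≤ n) (hm : 0 < m) (w : Sym2 (Fin n) → ℝ≥0)
    (hk : k ≤ Fintype.card (Fin n)) :
    Tot (mainProg m) (inputState w k) ((m + 4) ^ (9 * k) * (iterTime n + 1) + n * 3 + 23)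
      fun s => #(outputSet n s) = k ∧
        m * coverWeight w (outputSet n s) ≤ (m + 2) * optMin w k hk := by
  obtain ⟨S, hS, hopt⟩ := exists_mem_eq_inf' (powersetCard_nonempty.2 hk) (coverWeight w)
  obtain rfl := (mem_powersetCard.1 hS).2
  obtain ⟨j, hj, h1, h2⟩ := exists_chosenBy w hm S
  refine (mainProg_spec hkn w le_rfl).mono le_rfl fun s hs => ?_
  have hout : outputSet n s = toVertices n (supp n s.mem) := by
    ext v
    simp [outputSet, mem_toVertices, mem_supp]
  rcases hs with ⟨_, hs⟩ | ⟨_, hcard, hcost, hmin⟩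
  · exact absurd h1 (hs j hj)
  · rw [hout]
    refine ⟨?_, ?_⟩
    · rw [← card_map Fin.valEmbedding, 
        map_toVertices (X := supp n s.mem) (filter_subset _ _), hcard]
    · rw [← pairCover_eq, ← hcost]
      unfold optMin
      rw [hopt]
      exact (mul_le_mul_right (hmin j hj h1) _).trans h2

/-- The running time of `mainProg` per string, including a share of the time before the loop. -/
noncomputable def timePoly : Polynomial ℕ :=
  open Polynomial in
  9 * X * (X * (X * 10 + X * (X * 7 + 9) + 27) + X * (X * (X * 9 + 7) + 16) + X * (X * 6 + 14)
    + X * 7 + 29) + X * (X * 6 + 14) + X * (X * 9 + 7) + X * 100 + 61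

theorem eval_timePoly (n : ℕ) : timePoly.eval n = iterTime n + 1 + (n * 3 + 23) := by
  simp [timePoly, iterTime, stepTime]
  ring

end MinKVC

/-- For every `ε > 0` there is a `(1 + ε)`-approximation algorithm for Weighted Min `k`-Vertex
Cover running in time `O(1/ε)^{O(k)} · poly(n)`; the constants and the polynomial do not depend
on `ε`. -/
theorem theorem5 :
    ∃ (A B : ℕ) (p : Polynomial ℕ), ∀ ε : ℝ, 0 < ε →
      ∃ P : RAM.Program, MinKVC.IsApproxAlgorithm P (1 + ε)
        (fun n k => ((A : ℝ) * max 1 (1 / ε)) ^ (B * k) * ((p.eval n : ℕ) : ℝ)) := by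
  refine ⟨7, 9, MinKVC.timePoly, fun ε hε => ?_⟩
  -- Then `1 + 2 / m ≤ 1 + ε`, and `m + 4 ≤ 2 / ε + 5 ≤ 7 * max 1 (1 / ε)`.
  set m := ⌈2 / ε⌉₊ with hm
  have hpos : 0 < m := Nat.ceil_pos.2 (by positivity)
  have hle : 2 / ε ≤ m := Nat.le_ceil _
  refine ⟨MinKVC.mainProg m, fun n k hk w => ?_⟩
  obtain ⟨t, s, h1, h2, h3, h4⟩ := MinKVC.mainProg_approx (by simpa using hk) hpos w hk
  refine ⟨t, s, h1, ?_, h3, ?_⟩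
  · set a : ℝ := ((7 : ℕ) : ℝ) * max 1 (1 / ε) with ha
    have h7 : ((m + 4 : ℕ) : ℝ) ≤ a := by
      have := (Nat.ceil_lt_add_one (show 0 ≤ 2 / ε by positivity)).le
      rw [← hm] at this
      have e1 := le_max_left 1 (1 / ε)
      have e2 := le_max_right 1 (1 / ε)
      rw [show 2 / ε = 2 * (1 / ε) by ring] at this
      rw [ha]
      push_cast
      linarith
    have h1a : 1 ≤ a := (by norm_cast; omega : (1 : ℝ) ≤ ((m + 4 : ℕ) : ℝ)).trans h7
    have hpow : (((m + 4) ^ (9 * k) : ℕ) : ℝ) ≤ a ^ (9 * k) := by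
      rw [Nat.cast_pow]; gcongr
    have hone : 1 ≤ a ^ (9 * k) := one_le_pow₀ h1a
    calc (t : ℝ) ≤ (((m + 4) ^ (9 * k) * (MinKVC.iterTime n + 1) + n * 3 + 23 : ℕ) : ℝ) := by
          exact_mod_cast h2
      _ = (((m + 4) ^ (9 * k) : ℕ) : ℝ) * (MinKVC.iterTime n + 1 : ℕ) + 1 * (n * 3 + 23 : ℕ) := by
          push_cast; ring
      _ ≤ a ^ (9 * k) * (MinKVC.iterTime n + 1 : ℕ) + a ^ (9 * k) * (n * 3 + 23 : ℕ) := by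
          gcongr
      _ = a ^ (9 * k) * (MinKVC.iterTime n + 1 + (n * 3 + 23) : ℕ) := by
          push_cast; ring
      _ = _ := by
          simp only [MinKVC.eval_timePoly]
  · have hm' : (0 : ℝ) < m := by exact_mod_cast hpos
    have h4' : (m : ℝ) * (MinKVC.coverWeight w (MinKVC.outputSet n s) : ℝ)
        ≤ (m + 2) * (MinKVC.optMin w k hk : ℝ) := by exact_mod_cast h4
    have h2m : 2 ≤ ε * m := by rwa [div_le_iff₀' hε] at hle
    refine le_of_mul_le_mul_left ?_ hm'
    refine h4'.trans ?_
    rw [← mul_assoc]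
    refine mul_le_mul_of_nonneg_right ?_ (NNReal.coe_nonneg _)
    linarith
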